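/- Let $d\ge 2$, let $\theta$ be a real skew-symmetric $d\times d$ matrix, and let $\mathbb T^d_\theta$ be the quantum torus: the von Neumann algebra generated, in the GNS representation of its canonical faithful trace $\tau$, by unitaries $U_1,\dots,U_d$ with $U_kU_j=e^{2\pi i\theta_{kj}}U_jU_k$, where $\tau\big(\sum_m a_mU^m\big)=a_0$ and $U^m=U_1^{m_1}\cdots U_d^{m_d}$ for $m\in\mathbb Z^d$. Let $\|x\|_p=\tau(|x|^p)^{1/p}$ for $1\le p<\infty$, and let $\|\cdot\|_\infty$ be the operator norm. Let $\mathcal S(\mathbb T^d_\theta)$ be the space of all $\sum_m a_mU^m$ with $(a_m)$ rapidly decreasing, with the topology given by the norms $p_k(x)=\sup_{|m|_1\le k}\|D^mx\|_\infty$, where $D^m=\partial_1^{m_1}\cdots\partial_d^{m_d}$ and $\partial_jU^n=2\pi i\,n_jU^n$. Let $\mathcal S'(\mathbb T^d_\theta)$ be its dual, the space of distributions, and $\widehat x(m)=\langle x,(U^m)^*\rangle$ for $x\in\mathcal S'(\mathbb T^d_\theta)$. For a function $\phi$ of polynomial growth on $\mathbb Z^d$, the Fourier multiplier $M_\phi$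 is the map on $\mathcal S'(\mathbb T^d_\theta)$ with $\widehat{M_\phi x}(m)=\phi(m)\widehat x(m)$. Let $\varphi$ be a real-valued Schwartz function on $\mathbb R^d$ with $\operatorname{supp}\varphi\subset\{\tfrac12\le|\xi|\le2\}$, $\varphi>0$ on $\{\tfrac12<|\xi|<2\}$ and $\sum_{k\in\mathbb Z}\varphi(2^{-k}\xi)=1$ for $\xi\ne0$, and let $\widetilde\varphi_k*x=\sum_{m}\varphi(2^{-k}m)\widehat x(m)U^m$ (a finite sum). For $1\le p,q\le\infty$ and $\alpha\in\mathbb R$, the Besov space $B^\alpha_{p,q}(\mathbb T^d_\theta)$ consists of all $x\in\mathcal S'(\mathbb T^d_\theta)$ with $$\|x\|_{B^\alpha_{p,q}}=\Big(|\widehat x(0)|^q+\sum_{k\ge0}2^{qk\alpha}\|\widetilde\varphi_k*x\|_p^q\Big)^{1/q}<\infty,$$ with a supremum in place of the sum if $q=\infty$. The Bessel potential $J^\beta$ and the Riesz potential $I^\beta$ are the Fourier multipliers with symbols $(1+|m|^2)^{\beta/2}$ and $|m|^\beta$, the latter acting on distributions with $\widehat x(0)=0$. For $b\ge0$, $D_i^b$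 is the Fourier multiplier with symbol $(2\pi i\,m_i)^b$ (principal branch, with the value $1$ for $b=0$), and $D^a=D_1^{a_1}\cdots D_d^{a_d}$ for $a\in[0,\infty)^d$. Theorem. Let $1\le p,q\le\infty$ and $\alpha\in\mathbb R$. All constants $C$ below are finite and independent of $x$. (i) For every $\beta\in\mathbb R$, $J^\beta$ is an isomorphism (a linear bijection, bounded in both directions) from $B^\alpha_{p,q}(\mathbb T^d_\theta)$ onto $B^{\alpha-\beta}_{p,q}(\mathbb T^d_\theta)$, and $I^\beta$ is an isomorphism from $\{x\in B^\alpha_{p,q}(\mathbb T^d_\theta):\widehat x(0)=0\}$ onto $\{x\in B^{\alpha-\beta}_{p,q}(\mathbb T^d_\theta):\widehat x(0)=0\}$. (ii) For every $a\in[0,\infty)^d$ there is $C$ such that, for all $x\in B^\alpha_{p,q}(\mathbb T^d_\theta)$, one has $D^ax\in B^{\alpha-|a|_1}_{p,q}(\mathbb T^d_\theta)$ and $\|D^ax\|_{B^{\alpha-|a|_1}_{p,q}}\le C\|x\|_{B^\alpha_{p,q}}$, where $|a|_1=a_1+\cdots+a_d$. (iii) For every $\beta>0$, a distribution $x$ on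 $\mathbb T^d_\theta$ belongs to $B^\alpha_{p,q}(\mathbb T^d_\theta)$ if and only if $D_i^\beta x\in B^{\alpha-\beta}_{p,q}(\mathbb T^d_\theta)$ for all $i=1,\dots,d$. Moreover, there is $C$ such that, for all $x\in B^\alpha_{p,q}(\mathbb T^d_\theta)$, $$C^{-1}\|x\|_{B^\alpha_{p,q}}\le|\widehat x(0)|+\sum_{i=1}^d\|D_i^\beta x\|_{B^{\alpha-\beta}_{p,q}}\le C\|x\|_{B^\alpha_{p,q}}.$$ -/

import Mathlib

noncomputable section

namespace QuantumTorus

open scoped ENNReal NNReal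

/-! ### The quantum torus in the GNS representation of its trace -/

/-- The GNS Hilbert space of the trace `τ`: `ℓ²(ℤᵈ)`, where the basis vector `δ_n` is the class of
the monomial `Uⁿ`. -/
abbrev GNS (d : ℕ) : Type := lp (fun _ : Fin d → ℤ => ℂ) 2

variable {d : ℕ}

/-- The unitary operator `(T f)(n) = c n * f (n - m)` on `ℓ²(ℤᵈ)`, for unimodular weights `c`. -/
def weightedShift (c : (Fin d → ℤ) → Circle) (m : Fin d → ℤ) : GNS d ≃ₗᵢ[ℂ] GNS d where
  toFun f := ⟨fun n => (c n : ℂ) * f (n - m), by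
    have h := (memℓp_gen_iff (by norm_num)).1 (lp.memℓp f)
    refine memℓp_gen (((Equiv.subRight m).summable_iff.2 h).congr fun n => ?_)
    simp [Circle.norm_coe]⟩
  invFun f := ⟨fun n => ((c (n + m))⁻¹ : Circle) * f (n + m), by
    have h := (memℓp_gen_iff (by norm_num)).1 (lp.memℓp f)
    refine memℓp_gen (((Equiv.addRight m).summable_iff.2 h).congr fun n => ?_)
    simp [Circle.norm_coe]⟩
  map_add' f g := by ext n; simp [mul_add]; rfl
  map_smul' a f := by ext n; simp [mul_left_comm]
  left_inv f := by ext n; simp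
  right_inv f := by ext n; simp
  norm_map' f := by
    rw [lp.norm_eq_tsum_rpow (by norm_num), lp.norm_eq_tsum_rpow (by norm_num)]
    congr 1
    rw [← (Equiv.subRight m).tsum_eq (fun n => ‖f n‖ ^ _)]
    simp [Circle.norm_coe]

@[simp] lemma weightedShift_apply (c : (Fin d → ℤ) → Circle) (m : Fin d → ℤ) (f : GNS d)
    (n : Fin d → ℤ) : weightedShift c m f n = (c n : ℂ) * f (n - m) := rfl

/-- The generator `U_j`: it maps `δ_n = Uⁿ` to
`U_j Uⁿ = exp (2πi ∑_{k<j} θ_{jk} n_k) U^{n + e_j}`. -/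
def gen (θ : Matrix (Fin d) (Fin d) ℝ) (j : Fin d) : GNS d ≃ₗᵢ[ℂ] GNS d :=
  weightedShift (fun n => Real.fourierChar (∑ k with k < j, θ j k * n k)) (Pi.single j 1)

/-- The monomial `U^m = U_1^{m_1} ⋯ U_d^{m_d}`, as a unitary operator. -/
def monomialUnitary (θ : Matrix (Fin d) (Fin d) ℝ) (m : Fin d → ℤ) : GNS d ≃ₗᵢ[ℂ] GNS d :=
  ((List.finRange d).map fun j => gen θ j ^ m j).prod

/-- The monomial `U^m`, as a bounded operator. -/
def monomial (θ : Matrix (Fin d) (Fin d) ℝ) (m : Fin d → ℤ) : GNS d →L[ℂ] GNS d :=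
  (monomialUnitary θ m : GNS d →L[ℂ] GNS d)

/-- The trace `τ (x) = ⟨x δ_0, δ_0⟩`; on polynomials it is `τ (∑ a_m U^m) = a_0`. -/
def trace (x : GNS d →L[ℂ] GNS d) : ℂ :=
  inner ℂ (lp.single 2 (0 : Fin d → ℤ) (1 : ℂ) : GNS d) (x (lp.single 2 (0 : Fin d → ℤ) (1 : ℂ)))

/-- `|x|^p`, by continuous functional calculus. -/
def absPow {H : Type*} [NormedAddCommGroup H] [InnerProductSpace ℂ H] [CompleteSpace H]
    (x : H →L[ℂ] H) (p : ℝ) : H →L[ℂ] H :=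
  CFC.abs x ^ p

/-- The noncommutative `L_p`-norm `‖x‖_p = τ(|x|^p)^{1/p}` of a bounded `x` in the von Neumann
algebra of the quantum torus, `‖x‖_∞` being the operator norm. -/
def lpNorm (p : ℝ≥0∞) (x : GNS d →L[ℂ] GNS d) : ℝ :=
  if p = ∞ then ‖x‖ else (trace (absPow x p.toReal)).re ^ (1 / p.toReal)

/-! Explicit form of the monomials. -/

/-- The phase in `U^m Uⁿ = exp (2πi twist(m, n)) U^{m+n}`. -/
def twist (θ : Matrix (Fin d) (Fin d) ℝ) (m n : Fin d → ℤ) : ℝ :=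
  ∑ j, ∑ k with k < j, θ j k * m j * n k

lemma twist_add_left (θ : Matrix (Fin d) (Fin d) ℝ) (m m' n : Fin d → ℤ) :
    twist θ (m + m') n = twist θ m n + twist θ m' n := by
  simp only [twist, ← Finset.sum_add_distrib]
  refine Finset.sum_congr rfl fun j _ => Finset.sum_congr rfl fun k _ => ?_
  push_cast [Pi.add_apply]; ring

lemma twist_add_right (θ : Matrix (Fin d) (Fin d) ℝ) (m n n' : Fin d → ℤ) :
    twist θ m (n + n') = twist θ m n + twist θ m n' := by
  simp only [twist, ← Finset.sum_add_distrib]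
  refine Finset.sum_congr rfl fun j _ => Finset.sum_congr rfl fun k _ => ?_
  push_cast [Pi.add_apply]; ring

/-- The unitary acting by `δ_n ↦ exp (2πi twist(m, n)) δ_{m+n}`. -/
def weyl (θ : Matrix (Fin d) (Fin d) ℝ) (m : Fin d → ℤ) : GNS d ≃ₗᵢ[ℂ] GNS d :=
  weightedShift (fun n => Real.fourierChar (twist θ m (n - m))) m

lemma weyl_apply (θ : Matrix (Fin d) (Fin d) ℝ) (m : Fin d → ℤ) (f : GNS d) (n : Fin d → ℤ) :
    weyl θ m f n = (Real.fourierChar (twist θ m (n - m)) : ℂ) * f (n - m) := rfl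

lemma weyl_mul (θ : Matrix (Fin d) (Fin d) ℝ) (m m' : Fin d → ℤ) (h : twist θ m m' = 0) :
    weyl θ m * weyl θ m' = weyl θ (m + m') := by
  ext f n
  rw [LinearIsometryEquiv.coe_mul, Function.comp_apply, weyl_apply, weyl_apply, weyl_apply, ← mul_assoc,
    ← Circle.coe_mul, ← AddChar.map_add_eq_mul, sub_sub]
  congr 4
  have h1 : n - m = (n - (m + m')) + m' := by abel
  rw [twist_add_left, h1, twist_add_right θ m, h, add_zero]

lemma weyl_zero (θ : Matrix (Fin d) (Fin d) ℝ) : weyl θ 0 = 1 := by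
  ext f n
  rw [weyl_apply]
  simp [twist]

lemma twist_eq_zero (θ : Matrix (Fin d) (Fin d) ℝ) (m n : Fin d → ℤ)
    (h : ∀ j k, k < j → m j = 0 ∨ n k = 0) : twist θ m n = 0 := by
  refine Finset.sum_eq_zero fun j _ => Finset.sum_eq_zero fun k hk => ?_
  rcases h j k (by simpa using hk) with h | h <;> simp [h]

lemma gen_eq_weyl (θ : Matrix (Fin d) (Fin d) ℝ) (j : Fin d) :
    gen θ j = weyl θ (Pi.single j 1) := by
  ext f n
  rw [weyl_apply, gen, weightedShift_apply]
  congr 3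
  symm
  rw [twist, Finset.sum_eq_single j]
  · refine Finset.sum_congr rfl fun k hk => ?_
    have : k ≠ j := (by simpa using hk : k < j).ne
    simp [this]
  · intro b _ hb
    simp [hb]
  · simp

lemma gen_zpow (θ : Matrix (Fin d) (Fin d) ℝ) (j : Fin d) (z : ℤ) :
    gen θ j ^ z = weyl θ (Pi.single j z) := by
  have key : ∀ a b : ℤ, weyl θ (Pi.single j a) * weyl θ (Pi.single j b)
      = weyl θ (Pi.single j (a + b)) := by
    intro a b
    rw [weyl_mul, Pi.single_add]
    refine twist_eq_zero _ _ _ fun i k hk => ?_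
    by_cases hi : i = j
    · right
      have : k ≠ j := fun h => by simp [h, hi] at hk
      simp [this]
    · left; simp [hi]
  have hnat : ∀ n : ℕ, gen θ j ^ n = weyl θ (Pi.single j (n : ℤ)) := by
    intro n
    induction n with
    | zero => simp [weyl_zero]
    | succ n ih => rw [pow_succ, ih, gen_eq_weyl, key]; simp
  obtain ⟨n, rfl | rfl⟩ := z.eq_nat_or_neg
  · rw [zpow_natCast, hnat]
  · rw [zpow_neg, zpow_natCast, hnat, inv_eq_iff_mul_eq_one, key]
    simp [weyl_zero]

lemma monomialUnitary_eq_weyl (θ : Matrix (Fin d) (Fin d) ℝ) (m : Fin d → ℤ) :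
    monomialUnitary θ m = weyl θ m := by
  have key : ∀ l : List (Fin d), l.Pairwise (· < ·) →
      (l.map fun j => gen θ j ^ m j).prod = weyl θ (fun j => if j ∈ l then m j else 0) := by
    intro l hl
    induction l with
    | nil => simpa using! (weyl_zero θ).symm
    | cons i l ih =>
      rw [List.pairwise_cons] at hl
      rw [List.map_cons, List.prod_cons, ih hl.2, gen_zpow, weyl_mul]
      · congr 1
        ext j
        by_cases hj : j = i
        · subst hj
          have : j ∉ l := fun h => lt_irrefl _ (hl.1 j h)
          simp [this]
        · simp [hj]
      · refine twist_eq_zero _ _ _ fun j k hk => ?_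
        by_cases hj : j = i
        · right
          subst hj
          have : k ∉ l := fun h => lt_asymm hk (hl.1 k h)
          simp [this]
        · left; simp [hj]
  rw [monomialUnitary, key _ (List.pairwise_lt_finRange d)]
  simp

lemma monomial_apply (θ : Matrix (Fin d) (Fin d) ℝ) (m : Fin d → ℤ) (f : GNS d) (n : Fin d → ℤ) :
    monomial θ m f n = (Real.fourierChar (twist θ m (n - m)) : ℂ) * f (n - m) := by
  rw [← weyl_apply, ← monomialUnitary_eq_weyl]; rfl

lemma weyl_weyl_apply (θ : Matrix (Fin d) (Fin d) ℝ) (m m' : Fin d → ℤ) (f : GNS d) :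
    weyl θ m (weyl θ m' f) = (Real.fourierChar (twist θ m m') : ℂ) • weyl θ (m + m') f := by
  ext n
  rw [lp.coeFn_smul, Pi.smul_apply, smul_eq_mul, weyl_apply, weyl_apply, weyl_apply, ← mul_assoc,
    ← mul_assoc, ← Circle.coe_mul, ← Circle.coe_mul, ← AddChar.map_add_eq_mul,
    ← AddChar.map_add_eq_mul, sub_sub]
  congr 3
  have h1 : n - m = (n - (m + m')) + m' := by abel
  rw [twist_add_left, h1, twist_add_right θ m]
  ring

lemma twist_single (θ : Matrix (Fin d) (Fin d) ℝ) (k j : Fin d) :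
    twist θ (Pi.single k 1) (Pi.single j 1) = if j < k then θ k j else 0 := by
  rw [twist, Finset.sum_eq_single k]
  · simp [Pi.single_apply]
  · intro b _ hb
    simp [hb]
  · simp

/-- The defining commutation relation `U_k U_j = exp (2πi θ_{kj}) U_j U_k`. -/
lemma gen_comm (θ : Matrix (Fin d) (Fin d) ℝ) (hθ : θ.transpose = -θ) (k j : Fin d) (f : GNS d) :
    gen θ k (gen θ j f) = (Real.fourierChar (θ k j) : ℂ) • gen θ j (gen θ k f) := by
  have hs : θ j k = - θ k j := congrFun (congrFun hθ k) j
  rw [gen_eq_weyl, gen_eq_weyl, weyl_weyl_apply, weyl_weyl_apply, smul_smul, ← Circle.coe_mul,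
    ← AddChar.map_add_eq_mul, twist_single, twist_single, add_comm (Pi.single j 1 : Fin d → ℤ)]
  congr 3
  rcases lt_trichotomy j k with h | h | h
  · simp [h, h.not_gt]
  · subst h
    have : θ j j = 0 := by linarith
    simp [this]
  · simp [h, h.not_gt, hs]

/-! ### Smooth elements, distributions and Fourier multipliers -/

/-- Rapidly decreasing families indexed by `ℤᵈ`. -/
def rapid (d : ℕ) : Submodule ℂ ((Fin d → ℤ) → ℂ) where
  carrier := {a | ∀ k : ℕ, ∃ C : ℝ, ∀ m, (1 + ‖m‖) ^ k * ‖a m‖ ≤ C}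
  add_mem' {a b} ha hb k := by
    obtain ⟨A, hA⟩ := ha k
    obtain ⟨B, hB⟩ := hb k
    refine ⟨A + B, fun m => ?_⟩
    calc (1 + ‖m‖) ^ k * ‖a m + b m‖ ≤ (1 + ‖m‖) ^ k * (‖a m‖ + ‖b m‖) := by
          gcongr; exact norm_add_le _ _
      _ ≤ A + B := by rw [mul_add]; exact add_le_add (hA m) (hB m)
  zero_mem' k := ⟨0, fun m => by simp⟩
  smul_mem' c a ha k := by
    obtain ⟨A, hA⟩ := ha k
    refine ⟨‖c‖ * A, fun m => ?_⟩
    rw [Pi.smul_apply, smul_eq_mul, norm_mul, mul_left_comm]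
    exact mul_le_mul_of_nonneg_left (hA m) (norm_nonneg c)

lemma summable_weight (d : ℕ) : Summable fun m : Fin d → ℤ => ((1 + ‖m‖) ^ (2 * d))⁻¹ := by
  have h1 : Summable fun n : ℤ => ((1 + ‖n‖) ^ 2)⁻¹ := by
    have h2 : Summable fun n : ℕ => (((n : ℝ) + 1) ^ 2)⁻¹ := by
      have := (summable_nat_add_iff 1).2 (Real.summable_nat_pow_inv.2 (one_lt_two))
      simpa using this
    refine Summable.of_nat_of_neg (h2.congr fun n => ?_) (h2.congr fun n => ?_)
    · rw [add_comm]; simp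
    · rw [add_comm]; simp
  have h3 : Summable fun m : Fin d → ℤ => ∏ j, ((1 + ‖m j‖) ^ 2)⁻¹ := by
    refine summable_of_sum_le (c := ∏ _j : Fin d, ∑' n : ℤ, ((1 + ‖n‖) ^ 2)⁻¹)
      (fun m => Finset.prod_nonneg fun j _ => by positivity) fun s => ?_
    classical
    calc ∑ m ∈ s, ∏ j, ((1 + ‖m j‖) ^ 2)⁻¹
        ≤ ∑ m ∈ Fintype.piFinset fun j => s.image fun m => m j, ∏ j, ((1 + ‖m j‖) ^ 2)⁻¹ := by
          refine Finset.sum_le_sum_of_subset_of_nonneg (fun m hm => ?_)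
            fun m _ _ => Finset.prod_nonneg fun j _ => by positivity
          exact Fintype.mem_piFinset.2 fun j => Finset.mem_image_of_mem _ hm
      _ = ∏ j, ∑ n ∈ s.image fun m => m j, ((1 + ‖n‖) ^ 2)⁻¹ := by
          rw [Finset.prod_univ_sum]
      _ ≤ _ := by
          refine Finset.prod_le_prod (fun j _ => Finset.sum_nonneg fun n _ => by positivity)
            fun j _ => h1.sum_le_tsum _ fun n _ => by positivity
  refine Summable.of_nonneg_of_le (fun m => by positivity) (fun m => ?_) h3
  rw [Finset.prod_inv_distrib]
  refine inv_anti₀ (Finset.prod_pos fun j _ => by positivity) ?_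
  calc ∏ j, (1 + ‖m j‖) ^ 2 ≤ ∏ _j : Fin d, (1 + ‖m‖) ^ 2 := by
        refine Finset.prod_le_prod (fun j _ => by positivity) fun j _ => ?_
        gcongr
        exact norm_le_pi_norm m j
    _ = (1 + ‖m‖) ^ (2 * d) := by simp [pow_mul]

lemma norm_le_of_weight {d : ℕ} {a : (Fin d → ℤ) → ℂ} {C : ℝ} {k : ℕ}
    (h : ∀ m, (1 + ‖m‖) ^ (k + 2 * d) * ‖a m‖ ≤ C) (m : Fin d → ℤ) :
    (1 + ‖m‖) ^ k * ‖a m‖ ≤ C * ((1 + ‖m‖) ^ (2 * d))⁻¹ := by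
  have hp : 0 < (1 + ‖m‖) ^ (2 * d) := by positivity
  rw [← div_eq_mul_inv, le_div_iff₀ hp]
  calc _ = (1 + ‖m‖) ^ (k + 2 * d) * ‖a m‖ := by rw [pow_add]; ring
    _ ≤ C := h m

lemma rapid_summable (a : rapid d) : Summable fun m => ‖(a : (Fin d → ℤ) → ℂ) m‖ := by
  obtain ⟨C, hC⟩ := a.2 (0 + 2 * d)
  refine Summable.of_nonneg_of_le (fun m => norm_nonneg _) (fun m => ?_)
    ((summable_weight d).mul_left C)
  simpa using norm_le_of_weight hC m

lemma norm_monomial_le (θ : Matrix (Fin d) (Fin d) ℝ) (m : Fin d → ℤ) : ‖monomial θ m‖ ≤ 1 :=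
  ContinuousLinearMap.opNorm_le_bound _ zero_le_one fun f => by
    rw [one_mul]; exact ((monomialUnitary θ m).norm_map f).le

lemma summable_synth (θ : Matrix (Fin d) (Fin d) ℝ) (a : rapid d) :
    Summable fun m => (a : (Fin d → ℤ) → ℂ) m • monomial θ m := by
  refine Summable.of_norm_bounded (rapid_summable a) fun m => ?_
  rw [norm_smul]
  exact mul_le_of_le_one_right (norm_nonneg _) (norm_monomial_le θ m)

/-- The operator `∑_m a_m U^m` (norm convergent) of a rapidly decreasing family `a`. -/
def synth (θ : Matrix (Fin d) (Fin d) ℝ) : rapid d →ₗ[ℂ] (GNS d →L[ℂ] GNS d) where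
  toFun a := ∑' m, (a : (Fin d → ℤ) → ℂ) m • monomial θ m
  map_add' a b := by
    rw [← (summable_synth θ a).tsum_add (summable_synth θ b)]
    simp [add_smul]
  map_smul' c a := by
    rw [RingHom.id_apply, ← (summable_synth θ a).tsum_const_smul]
    simp [smul_smul]

lemma norm_synth_le (θ : Matrix (Fin d) (Fin d) ℝ) (a : rapid d) :
    ‖synth θ a‖ ≤ ∑' m, ‖(a : (Fin d → ℤ) → ℂ) m‖ := by
  refine tsum_of_norm_bounded (rapid_summable a).hasSum fun m => ?_
  rw [norm_smul]
  exact mul_le_of_le_one_right (norm_nonneg _) (norm_monomial_le θ m)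

lemma monomial_single (θ : Matrix (Fin d) (Fin d) ℝ) (m n : Fin d → ℤ) :
    monomial θ m (lp.single 2 (0 : Fin d → ℤ) (1 : ℂ)) n = if n = m then 1 else 0 := by
  rw [monomial_apply, lp.single_apply]
  by_cases h : n = m
  · subst h
    simp [twist]
  · have : n - m ≠ 0 := sub_ne_zero.2 h
    simp [h, this]

lemma synth_single (θ : Matrix (Fin d) (Fin d) ℝ) (a : rapid d) (m : Fin d → ℤ) :
    synth θ a (lp.single 2 (0 : Fin d → ℤ) (1 : ℂ)) m = (a : (Fin d → ℤ) → ℂ) m := by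
  have h1 := (ContinuousLinearMap.apply ℂ (GNS d)
    (lp.single 2 (0 : Fin d → ℤ) (1 : ℂ) : GNS d)).hasSum (summable_synth θ a).hasSum
  have h2 := (lp.evalCLM ℂ (fun _ : Fin d → ℤ => ℂ) 2 m).hasSum h1
  refine h2.unique ?_
  have h3 : ∀ n, (a : (Fin d → ℤ) → ℂ) n *
      (monomial θ n (lp.single 2 (0 : Fin d → ℤ) (1 : ℂ))) m =
      if n = m then (a : (Fin d → ℤ) → ℂ) m else 0 := by
    intro n
    rw [monomial_single]
    by_cases h : n = m
    · subst h; simp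
    · simp [h, Ne.symm h]
  exact (hasSum_ite_eq m ((a : (Fin d → ℤ) → ℂ) m)).congr_fun fun n => h3 n

lemma norm_coeff_le (θ : Matrix (Fin d) (Fin d) ℝ) (a : rapid d) (m : Fin d → ℤ) :
    ‖(a : (Fin d → ℤ) → ℂ) m‖ ≤ ‖synth θ a‖ := by
  rw [← synth_single θ a m]
  refine (lp.norm_apply_le_norm two_ne_zero _ _).trans ?_
  refine (ContinuousLinearMap.le_opNorm _ _).trans ?_
  rw [lp.norm_single (by norm_num)]
  simp

lemma synth_injective (θ : Matrix (Fin d) (Fin d) ℝ) : Function.Injective (synth θ) := by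
  intro a b h
  ext m
  rw [← synth_single θ a, ← synth_single θ b, h]

/-- `𝓢(𝕋ᵈ_θ)`: the operators `∑_m a_m U^m` with rapidly decreasing coefficients. -/
def smooth (θ : Matrix (Fin d) (Fin d) ℝ) : Submodule ℂ (GNS d →L[ℂ] GNS d) :=
  LinearMap.range (synth θ)

/-- The correspondence between rapidly decreasing families and elements of `𝓢(𝕋ᵈ_θ)`. -/
def smoothEquiv (θ : Matrix (Fin d) (Fin d) ℝ) : rapid d ≃ₗ[ℂ] smooth θ :=
  LinearEquiv.ofInjective (synth θ) (synth_injective θ)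

/-- Symbols of polynomial growth on `ℤᵈ`. -/
def PolyGrowth (s : (Fin d → ℤ) → ℂ) : Prop :=
  ∃ (k : ℕ) (C : ℝ), ∀ m, ‖s m‖ ≤ C * (1 + ‖m‖) ^ k

lemma PolyGrowth.exists_nonneg {s : (Fin d → ℤ) → ℂ} (hs : PolyGrowth s) :
    ∃ (k : ℕ) (C : ℝ), 0 ≤ C ∧ ∀ m, ‖s m‖ ≤ C * (1 + ‖m‖) ^ k := by
  obtain ⟨k, C, h⟩ := hs
  refine ⟨k, max C 0, le_max_right _ _, fun m => (h m).trans ?_⟩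
  gcongr
  exact le_max_left _ _

lemma PolyGrowth.const (c : ℂ) : PolyGrowth (fun _ : Fin d → ℤ => c) :=
  ⟨0, ‖c‖, fun m => by simp⟩

lemma PolyGrowth.mul {s t : (Fin d → ℤ) → ℂ} (hs : PolyGrowth s) (ht : PolyGrowth t) :
    PolyGrowth (fun m => s m * t m) := by
  obtain ⟨k, C, hC, h⟩ := hs.exists_nonneg
  obtain ⟨l, D, hD, h'⟩ := ht.exists_nonneg
  refine ⟨k + l, C * D, fun m => ?_⟩
  rw [norm_mul]
  calc ‖s m‖ * ‖t m‖ ≤ (C * (1 + ‖m‖) ^ k) * (D * (1 + ‖m‖) ^ l) := by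
        gcongr
        · exact h m
        · exact h' m
    _ = C * D * (1 + ‖m‖) ^ (k + l) := by rw [pow_add]; ring

lemma PolyGrowth.prod {ι : Type*} (u : Finset ι) {s : ι → (Fin d → ℤ) → ℂ}
    (hs : ∀ i, PolyGrowth (s i)) : PolyGrowth (fun m => ∏ i ∈ u, s i m) := by
  classical
  induction u using Finset.induction_on with
  | empty => simpa using PolyGrowth.const (d := d) 1
  | insert i u hi ih =>
    simp only [Finset.prod_insert hi]
    exact (hs i).mul ih

lemma PolyGrowth.comp_neg {s : (Fin d → ℤ) → ℂ} (hs : PolyGrowth s) :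
    PolyGrowth (fun m => s (-m)) := by
  obtain ⟨k, C, h⟩ := hs
  exact ⟨k, C, fun m => by simpa using h (-m)⟩

/-- Multiplication of a rapidly decreasing family by a symbol of polynomial growth. -/
def mulRapid (s : (Fin d → ℤ) → ℂ) (hs : PolyGrowth s) : rapid d →ₗ[ℂ] rapid d where
  toFun a := ⟨fun m => s m * (a : (Fin d → ℤ) → ℂ) m, fun k => by
    obtain ⟨l, D, hD, h⟩ := hs.exists_nonneg
    obtain ⟨A, hA⟩ := a.2 (k + l)
    refine ⟨D * A, fun m => ?_⟩
    rw [norm_mul]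
    calc (1 + ‖m‖) ^ k * (‖s m‖ * ‖(a : (Fin d → ℤ) → ℂ) m‖)
        ≤ (1 + ‖m‖) ^ k * ((D * (1 + ‖m‖) ^ l) * ‖(a : (Fin d → ℤ) → ℂ) m‖) := by
          gcongr; exact h m
      _ = D * ((1 + ‖m‖) ^ (k + l) * ‖(a : (Fin d → ℤ) → ℂ) m‖) := by rw [pow_add]; ring
      _ ≤ D * A := mul_le_mul_of_nonneg_left (hA m) hD⟩
  map_add' a b := by ext m; simp [mul_add]
  map_smul' c a := by ext m; simp [mul_left_comm]

/-- The Fourier multiplier `∑ a_m U^m ↦ ∑ s(m) a_m U^m` on `𝓢(𝕋ᵈ_θ)`. -/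
def smoothMultiplier (θ : Matrix (Fin d) (Fin d) ℝ) (s : (Fin d → ℤ) → ℂ) (hs : PolyGrowth s) :
    smooth θ →ₗ[ℂ] smooth θ :=
  (smoothEquiv θ).toLinearMap ∘ₗ mulRapid s hs ∘ₗ (smoothEquiv θ).symm.toLinearMap

lemma smoothMultiplier_synth (θ : Matrix (Fin d) (Fin d) ℝ) (s : (Fin d → ℤ) → ℂ)
    (hs : PolyGrowth s) (a : rapid d) :
    smoothMultiplier θ s hs (smoothEquiv θ a) = smoothEquiv θ (mulRapid s hs a) := by
  simp [smoothMultiplier]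

/-- The symbol `∏_j (2πi n_j)^{m_j}` of `D^m = ∂_1^{m_1} ⋯ ∂_d^{m_d}`, where `∂_j` is the derivation
with `∂_j U_j = 2πi U_j` and `∂_j U_k = 0` for `k ≠ j`. -/
def derivSymbol (m : Fin d → ℕ) (n : Fin d → ℤ) : ℂ :=
  ∏ j, (2 * Real.pi * Complex.I * (n j : ℂ)) ^ m j

lemma polyGrowth_derivSymbol (m : Fin d → ℕ) : PolyGrowth (derivSymbol m) := by
  refine PolyGrowth.prod Finset.univ fun j => ⟨m j, (2 * Real.pi) ^ m j, fun n => ?_⟩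
  rw [norm_pow, ← mul_pow]
  gcongr
  have h1 : ‖((n j : ℤ) : ℂ)‖ = ‖n j‖ := by simp [Int.norm_eq_abs]
  have h2 := norm_le_pi_norm n j
  simp only [norm_mul, Complex.norm_I, mul_one, h1, Complex.norm_real, Complex.norm_ofNat,
    Real.norm_of_nonneg Real.pi_pos.le]
  gcongr
  linarith

/-- The partial derivation `D^m` on `𝓢(𝕋ᵈ_θ)`. -/
def smoothDeriv (θ : Matrix (Fin d) (Fin d) ℝ) (m : Fin d → ℕ) : smooth θ →ₗ[ℂ] smooth θ :=
  smoothMultiplier θ (derivSymbol m) (polyGrowth_derivSymbol m)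

/-- The multi-indices `m ∈ ℕᵈ` with `|m|_1 ≤ k`. -/
def multiIndices (d k : ℕ) : Finset (Fin d → ℕ) :=
  {m ∈ Fintype.piFinset fun _ => Finset.range (k + 1) | ∑ j, m j ≤ k}

/-- The norm `p_k(x) = sup_{|m|_1 ≤ k} ‖D^m x‖_∞`. The increasing sequence `(p_k)` defines the
topology of `𝓢(𝕋ᵈ_θ)`. -/
def smoothNorm (θ : Matrix (Fin d) (Fin d) ℝ) (k : ℕ) : Seminorm ℂ (smooth θ) :=
  (multiIndices d k).sup fun m =>
    (normSeminorm ℂ (GNS d →L[ℂ] GNS d)).comp ((smooth θ).subtype ∘ₗ smoothDeriv θ m)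

lemma smoothNorm_mono (θ : Matrix (Fin d) (Fin d) ℝ) {k l : ℕ} (h : k ≤ l) :
    smoothNorm θ k ≤ smoothNorm θ l := by
  refine Finset.sup_mono fun m hm => ?_
  simp only [multiIndices, Finset.mem_filter, Fintype.mem_piFinset, Finset.mem_range] at hm ⊢
  exact ⟨fun j => (hm.1 j).trans_le (by omega), hm.2.trans h⟩

/-- `𝓢'(𝕋ᵈ_θ)`: the distributions, i.e. the linear functionals on `𝓢(𝕋ᵈ_θ)` that are continuous,
which means bounded by a multiple of some `p_k`. -/
def Distribution (θ : Matrix (Fin d) (Fin d) ℝ) : Submodule ℂ (smooth θ →ₗ[ℂ] ℂ) where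
  carrier := {F | ∃ (k : ℕ) (C : ℝ), ∀ x, ‖F x‖ ≤ C * smoothNorm θ k x}
  add_mem' {F G} hF hG := by
    obtain ⟨k, C, hF⟩ := hF
    obtain ⟨l, D, hG⟩ := hG
    refine ⟨max k l, |C| + |D|, fun x => (norm_add_le _ _).trans ?_⟩
    rw [add_mul]
    refine add_le_add ((hF x).trans ?_) ((hG x).trans ?_)
    · exact mul_le_mul (le_abs_self C) (smoothNorm_mono θ (le_max_left k l) x) (apply_nonneg _ _)
        (abs_nonneg C)
    · exact mul_le_mul (le_abs_self D) (smoothNorm_mono θ (le_max_right k l) x) (apply_nonneg _ _)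
        (abs_nonneg D)
  zero_mem' := ⟨0, 0, fun x => by simp⟩
  smul_mem' c F hF := by
    obtain ⟨k, C, hF⟩ := hF
    refine ⟨k, ‖c‖ * C, fun x => ?_⟩
    rw [LinearMap.smul_apply, norm_smul, mul_assoc]
    exact mul_le_mul_of_nonneg_left (hF x) (norm_nonneg c)

lemma norm_smoothDeriv_le (θ : Matrix (Fin d) (Fin d) ℝ) (k : ℕ) (m : Fin d → ℕ)
    (hm : ∑ j, m j ≤ k) (x : smooth θ) :
    ‖(smoothDeriv θ m x : GNS d →L[ℂ] GNS d)‖ ≤ smoothNorm θ k x := by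
  have hm' : m ∈ multiIndices d k := by
    simp only [multiIndices, Finset.mem_filter, Fintype.mem_piFinset, Finset.mem_range]
    refine ⟨fun j => ?_, hm⟩
    have := Finset.single_le_sum (f := m) (fun i _ => Nat.zero_le _) (Finset.mem_univ j)
    omega
  exact (Finset.le_sup (f := fun m => (normSeminorm ℂ (GNS d →L[ℂ] GNS d)).comp
    ((smooth θ).subtype ∘ₗ smoothDeriv θ m)) hm') x

lemma weight_coeff_le (θ : Matrix (Fin d) (Fin d) ℝ) (k : ℕ) (a : rapid d) (n : Fin d → ℤ) :
    (1 + ‖n‖) ^ k * ‖(a : (Fin d → ℤ) → ℂ) n‖ ≤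
      2 ^ k * smoothNorm θ k (smoothEquiv θ a) := by
  have hcoe : ∀ b : rapid d, ((smoothEquiv θ b : smooth θ) : GNS d →L[ℂ] GNS d) = synth θ b :=
    fun b => rfl
  have key : ∀ m : Fin d → ℕ, ∑ j, m j ≤ k →
      ‖derivSymbol m n‖ * ‖(a : (Fin d → ℤ) → ℂ) n‖ ≤ smoothNorm θ k (smoothEquiv θ a) := by
    intro m hm
    refine le_trans ?_ (norm_smoothDeriv_le θ k m hm _)
    rw [smoothDeriv, smoothMultiplier_synth, hcoe, ← norm_mul]
    exact norm_coeff_le θ (mulRapid (derivSymbol m) (polyGrowth_derivSymbol m) a) n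
  have h0 := key 0 (by simp)
  have h0' : ‖(a : (Fin d → ℤ) → ℂ) n‖ ≤ smoothNorm θ k (smoothEquiv θ a) := by
    simpa [derivSymbol] using h0
  by_cases hn : ‖n‖ ≤ 1
  · have : (1 + ‖n‖) ^ k ≤ 2 ^ k := by gcongr; linarith
    exact mul_le_mul this h0' (norm_nonneg _) (by positivity)
  · rw [not_le] at hn
    obtain ⟨j, hj⟩ : ∃ j, ‖n j‖ = ‖n‖ := by
      have hne : Nonempty (Fin d) := by
        by_contra h
        rw [not_nonempty_iff] at h
        have : n = 0 := Subsingleton.elim _ _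
        rw [this, norm_zero] at hn
        linarith
      obtain ⟨j, -, hj⟩ := Finset.exists_mem_eq_sup' (Finset.univ_nonempty (α := Fin d))
        (fun j => ‖n j‖)
      refine ⟨j, le_antisymm (norm_le_pi_norm n j) ?_⟩
      rw [pi_norm_le_iff_of_nonneg (norm_nonneg _), ← hj]
      exact fun i => Finset.le_sup' (fun j => ‖n j‖) (Finset.mem_univ i)
    have h1 := key (Pi.single j k) (by simp)
    have h2 : ‖n‖ ^ k ≤ ‖derivSymbol (Pi.single j k) n‖ := by
      rw [derivSymbol, Finset.prod_eq_single j]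
      · rw [norm_pow, Pi.single_eq_same]
        gcongr
        have h1 : ‖((n j : ℤ) : ℂ)‖ = ‖n j‖ := by simp [Int.norm_eq_abs]
        simp only [norm_mul, Complex.norm_I, mul_one, h1, Complex.norm_real, Complex.norm_ofNat,
          Real.norm_of_nonneg Real.pi_pos.le, hj]
        have := Real.pi_gt_three
        nlinarith
      · intro i _ hi
        simp [hi]
      · simp
    have h3 : (1 + ‖n‖) ^ k ≤ 2 ^ k * ‖n‖ ^ k := by
      rw [← mul_pow]; gcongr; linarith
    calc (1 + ‖n‖) ^ k * ‖(a : (Fin d → ℤ) → ℂ) n‖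
        ≤ (2 ^ k * ‖derivSymbol (Pi.single j k) n‖) * ‖(a : (Fin d → ℤ) → ℂ) n‖ := by
          gcongr
          exact h3.trans (by gcongr)
      _ ≤ 2 ^ k * smoothNorm θ k (smoothEquiv θ a) := by
          rw [mul_assoc]; gcongr

lemma smoothMultiplier_bound (θ : Matrix (Fin d) (Fin d) ℝ) (s : (Fin d → ℤ) → ℂ)
    (hs : PolyGrowth s) : ∃ (l : ℕ) (C : ℝ), 0 ≤ C ∧ ∀ x,
      ‖(smoothMultiplier θ s hs x : GNS d →L[ℂ] GNS d)‖ ≤ C * smoothNorm θ l x := by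
  obtain ⟨k, D, hD, h⟩ := hs.exists_nonneg
  set S := ∑' m : Fin d → ℤ, ((1 + ‖m‖) ^ (2 * d))⁻¹ with hS
  have hS0 : 0 ≤ S := tsum_nonneg fun m => by positivity
  refine ⟨k + 2 * d, D * (2 ^ (k + 2 * d) * S), by positivity, fun x => ?_⟩
  obtain ⟨a, rfl⟩ := (smoothEquiv θ).surjective x
  rw [smoothMultiplier_synth]
  refine (norm_synth_le θ _).trans ?_
  set P := smoothNorm θ (k + 2 * d) (smoothEquiv θ a) with hP
  have h1 : ∀ m, ‖((mulRapid s hs a : rapid d) : (Fin d → ℤ) → ℂ) m‖ ≤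
      D * (2 ^ (k + 2 * d) * P) * ((1 + ‖m‖) ^ (2 * d))⁻¹ := by
    intro m
    have h2 := norm_le_of_weight (weight_coeff_le θ (k + 2 * d) a) m
    calc ‖((mulRapid s hs a : rapid d) : (Fin d → ℤ) → ℂ) m‖
        = ‖s m‖ * ‖(a : (Fin d → ℤ) → ℂ) m‖ := norm_mul _ _
      _ ≤ D * (1 + ‖m‖) ^ k * ‖(a : (Fin d → ℤ) → ℂ) m‖ := by gcongr; exact h m
      _ ≤ D * (2 ^ (k + 2 * d) * P * ((1 + ‖m‖) ^ (2 * d))⁻¹) := by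
          rw [mul_assoc]; gcongr
      _ = _ := by ring
  calc ∑' m, ‖((mulRapid s hs a : rapid d) : (Fin d → ℤ) → ℂ) m‖
      ≤ ∑' m : Fin d → ℤ, D * (2 ^ (k + 2 * d) * P) * ((1 + ‖m‖) ^ (2 * d))⁻¹ :=
        (rapid_summable _).tsum_le_tsum h1 ((summable_weight d).mul_left _)
    _ = D * (2 ^ (k + 2 * d) * S) * P := by rw [tsum_mul_left]; ring

lemma smoothMultiplier_comp (θ : Matrix (Fin d) (Fin d) ℝ) (s t : (Fin d → ℤ) → ℂ)
    (hs : PolyGrowth s) (ht : PolyGrowth t) (x : smooth θ) :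
    smoothMultiplier θ s hs (smoothMultiplier θ t ht x) =
      smoothMultiplier θ (fun m => s m * t m) (hs.mul ht) x := by
  obtain ⟨a, rfl⟩ := (smoothEquiv θ).surjective x
  simp only [smoothMultiplier_synth]
  congr 1
  ext m
  exact (mul_assoc _ _ _).symm

lemma smoothMultiplier_continuous (θ : Matrix (Fin d) (Fin d) ℝ) (s : (Fin d → ℤ) → ℂ)
    (hs : PolyGrowth s) (k : ℕ) : ∃ (l : ℕ) (C : ℝ), ∀ x,
      smoothNorm θ k (smoothMultiplier θ s hs x) ≤ C * smoothNorm θ l x := by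
  choose l C hC h using fun m : Fin d → ℕ =>
    smoothMultiplier_bound θ _ ((polyGrowth_derivSymbol m).mul hs)
  refine ⟨(multiIndices d k).sup l, ∑ m ∈ multiIndices d k, C m, fun x => ?_⟩
  refine Seminorm.finset_sup_apply_le
    (mul_nonneg (Finset.sum_nonneg fun m _ => hC m) (apply_nonneg _ _)) fun m hm => ?_
  change ‖(smoothDeriv θ m (smoothMultiplier θ s hs x) : GNS d →L[ℂ] GNS d)‖ ≤ _
  rw [smoothDeriv, smoothMultiplier_comp]
  refine (h m x).trans (mul_le_mul ?_ ?_ (apply_nonneg _ _) (Finset.sum_nonneg fun m _ => hC m))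
  · exact Finset.single_le_sum (f := C) (fun m _ => hC m) hm
  · exact smoothNorm_mono θ (Finset.le_sup hm) x

/-- The Fourier multiplier `M_s` on `𝓢'(𝕋ᵈ_θ)`, `⟨M_s F, x⟩ = ⟨F, M_{s(-·)} x⟩`; on Fourier
coefficients it is multiplication by `s`, see `fourierCoeff_multiplier`. -/
def multiplier (θ : Matrix (Fin d) (Fin d) ℝ) (s : (Fin d → ℤ) → ℂ) (hs : PolyGrowth s) :
    Distribution θ →ₗ[ℂ] Distribution θ where
  toFun F := ⟨(F : smooth θ →ₗ[ℂ] ℂ) ∘ₗ smoothMultiplier θ (fun m => s (-m)) hs.comp_neg, by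
    obtain ⟨k, C, hF⟩ := F.2
    obtain ⟨l, D, h⟩ := smoothMultiplier_continuous θ _ hs.comp_neg k
    refine ⟨l, |C| * D, fun x => (hF _).trans ?_⟩
    rw [mul_assoc]
    exact mul_le_mul (le_abs_self C) (h x) (apply_nonneg _ _) (abs_nonneg C)⟩
  map_add' F G := rfl
  map_smul' c F := rfl

/-- The family with the single nonzero entry `c` at `m`. -/
def rapidSingle (m : Fin d → ℤ) (c : ℂ) : rapid d :=
  ⟨Pi.single m c, fun k => ⟨(1 + ‖m‖) ^ k * ‖c‖, fun n => by
    by_cases h : n = m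
    · subst h; simp
    · simp only [Pi.single_eq_of_ne h, norm_zero, mul_zero]; positivity⟩⟩

lemma synth_rapidSingle (θ : Matrix (Fin d) (Fin d) ℝ) (m : Fin d → ℤ) (c : ℂ) :
    synth θ (rapidSingle m c) = c • monomial θ m := by
  change ∑' n, (Pi.single m c : (Fin d → ℤ) → ℂ) n • monomial θ n = _
  rw [tsum_eq_single m]
  · simp
  · intro n hn; simp [hn]

lemma star_monomial (θ : Matrix (Fin d) (Fin d) ℝ) (m : Fin d → ℤ) :
    star (monomial θ m) = (Real.fourierChar (twist θ m m) : ℂ) • monomial θ (-m) := by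
  have h1 : star (monomial θ m) =
      ((monomialUnitary θ m).symm : GNS d →L[ℂ] GNS d) :=
    (monomialUnitary θ m).star_eq_symm
  rw [h1]
  refine ContinuousLinearMap.ext fun f => ?_
  change (monomialUnitary θ m).symm f =
    (Real.fourierChar (twist θ m m) : ℂ) • monomialUnitary θ (-m) f
  have h2 : twist θ m (-m) = - twist θ m m := by
    have := twist_add_right θ m m (-m)
    rw [add_neg_cancel, twist_eq_zero θ m 0 (by simp)] at this
    linarith
  rw [LinearIsometryEquiv.symm_apply_eq, map_smul, monomialUnitary_eq_weyl,
    monomialUnitary_eq_weyl, weyl_weyl_apply, smul_smul, ← Circle.coe_mul,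
    ← AddChar.map_add_eq_mul, h2]
  simp [weyl_zero]

lemma star_monomial_mem (θ : Matrix (Fin d) (Fin d) ℝ) (m : Fin d → ℤ) :
    star (monomial θ m) ∈ smooth θ :=
  ⟨rapidSingle (-m) (Real.fourierChar (twist θ m m) : ℂ), by
    rw [synth_rapidSingle, star_monomial]⟩

/-- The Fourier coefficient `F̂(m) = ⟨F, (U^m)^*⟩` of a distribution. -/
def fourierCoeff {θ : Matrix (Fin d) (Fin d) ℝ} (F : Distribution θ) (m : Fin d → ℤ) : ℂ :=
  (F : smooth θ →ₗ[ℂ] ℂ) ⟨star (monomial θ m), star_monomial_mem θ m⟩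

lemma fourierCoeff_multiplier {θ : Matrix (Fin d) (Fin d) ℝ} (s : (Fin d → ℤ) → ℂ)
    (hs : PolyGrowth s) (F : Distribution θ) (m : Fin d → ℤ) :
    fourierCoeff (multiplier θ s hs F) m = s m * fourierCoeff F m := by
  have h1 : (⟨star (monomial θ m), star_monomial_mem θ m⟩ : smooth θ) =
      smoothEquiv θ (rapidSingle (-m) (Real.fourierChar (twist θ m m) : ℂ)) :=
    Subtype.ext ((star_monomial θ m).trans (synth_rapidSingle θ (-m) _).symm)
  have h2 : mulRapid (fun n => s (-n)) hs.comp_neg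
      (rapidSingle (-m) (Real.fourierChar (twist θ m m) : ℂ)) =
      s m • rapidSingle (-m) (Real.fourierChar (twist θ m m) : ℂ) := by
    ext n
    change s (-n) * (Pi.single (-m) _ : (Fin d → ℤ) → ℂ) n =
      s m * (Pi.single (-m) _ : (Fin d → ℤ) → ℂ) n
    by_cases h : n = -m
    · subst h; simp
    · simp [h]
  change (F : smooth θ →ₗ[ℂ] ℂ) (smoothMultiplier θ _ hs.comp_neg _) =
    s m * (F : smooth θ →ₗ[ℂ] ℂ) _
  rw [h1, smoothMultiplier_synth, h2, map_smul, map_smul, smul_eq_mul]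

/-! ### Bessel and Riesz potentials, fractional partial derivatives -/

/-- The point `m ∈ ℤᵈ` as a vector of the Euclidean space `ℝᵈ`. -/
def toEuclid (m : Fin d → ℤ) : EuclideanSpace ℝ (Fin d) :=
  WithLp.toLp 2 fun j => (m j : ℝ)

lemma polyGrowth_rpow (x : (Fin d → ℤ) → ℝ) (hx : ∀ m, x m = 0 ∨ 1 ≤ x m)
    (A : ℝ) (hA : ∀ m, x m ≤ A * (1 + ‖m‖)) (b : ℝ) :
    PolyGrowth fun m => ((x m ^ b : ℝ) : ℂ) := by
  refine ⟨⌈|b|⌉₊, (1 + |A|) ^ ⌈|b|⌉₊, fun m => ?_⟩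
  have hx0 : 0 ≤ x m := by rcases hx m with h | h <;> linarith
  have h1 : x m ^ b ≤ (1 + x m) ^ ⌈|b|⌉₊ := by
    have h2 : (1 : ℝ) ≤ (1 + x m) ^ ⌈|b|⌉₊ := one_le_pow₀ (by linarith)
    rcases hx m with h | h
    · rw [h]
      rw [h] at h2
      refine le_trans ?_ h2
      rcases eq_or_ne b 0 with rfl | hb
      · simp
      · rw [Real.zero_rpow hb]; exact zero_le_one
    · calc x m ^ b ≤ x m ^ (⌈|b|⌉₊ : ℝ) :=
            Real.rpow_le_rpow_of_exponent_le h ((le_abs_self b).trans (Nat.le_ceil _))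
        _ = x m ^ ⌈|b|⌉₊ := Real.rpow_natCast _ _
        _ ≤ _ := by gcongr; linarith
  rw [Complex.norm_real, Real.norm_of_nonneg (Real.rpow_nonneg hx0 b), ← mul_pow]
  refine h1.trans ?_
  gcongr
  have h3 := hA m
  have h4 : A * (1 + ‖m‖) ≤ |A| * (1 + ‖m‖) := by gcongr; exact le_abs_self A
  have h5 := norm_nonneg m
  nlinarith

lemma norm_sq_toEuclid (m : Fin d → ℤ) : ‖toEuclid m‖ ^ 2 = ((∑ j, m j ^ 2 : ℤ) : ℝ) := by
  rw [EuclideanSpace.norm_sq_eq]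
  simp [toEuclid]

lemma norm_toEuclid_le (m : Fin d → ℤ) : ‖toEuclid m‖ ≤ d * ‖m‖ := by
  rw [EuclideanSpace.norm_eq]
  refine Real.sqrt_le_iff.2 ⟨by positivity, ?_⟩
  calc ∑ i, ‖(toEuclid m) i‖ ^ 2 ≤ ∑ _i : Fin d, ‖m‖ ^ 2 := by
        refine Finset.sum_le_sum fun i _ => ?_
        have h : ‖(toEuclid m) i‖ = ‖m i‖ := by simp [toEuclid, Int.norm_eq_abs]
        rw [h]
        gcongr
        exact norm_le_pi_norm m i
    _ = d * ‖m‖ ^ 2 := by simp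
    _ ≤ (d * ‖m‖) ^ 2 := by
        rw [mul_pow]
        gcongr
        exact_mod_cast Nat.le_self_pow two_ne_zero d

lemma norm_toEuclid_zero_or (m : Fin d → ℤ) : ‖toEuclid m‖ = 0 ∨ 1 ≤ ‖toEuclid m‖ := by
  have h := norm_sq_toEuclid m
  have h0 : 0 ≤ ∑ j, m j ^ 2 := Finset.sum_nonneg fun j _ => sq_nonneg _
  rcases h0.eq_or_lt with h1 | h1
  · left
    rw [← h1] at h
    simpa using h
  · right
    have : (1 : ℝ) ≤ ((∑ j, m j ^ 2 : ℤ) : ℝ) := by exact_mod_cast h1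
    rw [← h] at this
    nlinarith [norm_nonneg (toEuclid m)]

/-- The symbol `J_β(m) = (1 + |m|²)^{β/2}`. -/
def besselSymbol (β : ℝ) (m : Fin d → ℤ) : ℂ := (((1 + ‖toEuclid m‖ ^ 2) ^ (β / 2) : ℝ) : ℂ)

/-- The symbol `I_β(m) = |m|^β`. Its value at `m = 0` does not matter: the Riesz potential is only
considered on distributions with `x̂(0) = 0`. -/
def rieszSymbol (β : ℝ) (m : Fin d → ℤ) : ℂ := ((‖toEuclid m‖ ^ β : ℝ) : ℂ)

/-- The symbol `D_{i,b}(m) = (2πi m_i)^b` (principal branch), equal to `1` if `b = 0`. -/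
def partialSymbol (i : Fin d) (b : ℝ) (m : Fin d → ℤ) : ℂ :=
  (2 * Real.pi * Complex.I * (m i : ℂ)) ^ (b : ℂ)

lemma polyGrowth_rieszSymbol (β : ℝ) : PolyGrowth (rieszSymbol (d := d) β) :=
  polyGrowth_rpow _ norm_toEuclid_zero_or d (fun m => (norm_toEuclid_le m).trans (by
    gcongr; linarith)) β

lemma polyGrowth_besselSymbol (β : ℝ) : PolyGrowth (besselSymbol (d := d) β) := by
  have h := polyGrowth_rpow (d := d) (fun m => Real.sqrt (1 + ‖toEuclid m‖ ^ 2))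
    (fun m => Or.inr (Real.one_le_sqrt.2 (by nlinarith [sq_nonneg ‖toEuclid m‖]))) (1 + d)
    (fun m => ?_) β
  · refine (funext fun m => ?_ : _ = besselSymbol (d := d) β) ▸ h
    rw [besselSymbol, Real.sqrt_eq_rpow, ← Real.rpow_mul (by positivity)]
    congr 2
    ring
  · refine Real.sqrt_le_iff.2 ⟨by positivity, ?_⟩
    have h1 := norm_toEuclid_le m
    have h2 := norm_nonneg m
    have h3 : ‖toEuclid m‖ ^ 2 ≤ (d * ‖m‖) ^ 2 := by gcongr
    have h4 : (0 : ℝ) ≤ d := Nat.cast_nonneg d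
    have h5 : 0 ≤ (d : ℝ) * ‖m‖ := by positivity
    nlinarith

lemma polyGrowth_partialSymbol (i : Fin d) (b : ℝ) : PolyGrowth (partialSymbol i b) := by
  have hn : ∀ m : Fin d → ℤ, ‖(2 * Real.pi * Complex.I * (m i : ℂ))‖ = 2 * Real.pi * ‖m i‖ := by
    intro m
    have h1 : ‖((m i : ℤ) : ℂ)‖ = ‖m i‖ := by simp [Int.norm_eq_abs]
    simp only [norm_mul, Complex.norm_I, mul_one, h1, Complex.norm_real, Complex.norm_ofNat,
      Real.norm_of_nonneg Real.pi_pos.le]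
  have h1 : ∀ m : Fin d → ℤ, 2 * Real.pi * ‖m i‖ = 0 ∨ 1 ≤ 2 * Real.pi * ‖m i‖ := by
    intro m
    rcases eq_or_ne (m i) 0 with h | h
    · left; simp [h]
    · right
      have h1 : (1 : ℝ) ≤ ‖m i‖ := by
        rw [Int.norm_eq_abs]
        exact_mod_cast Int.one_le_abs h
      nlinarith [Real.pi_gt_three]
  have h2 : ∀ m : Fin d → ℤ, 2 * Real.pi * ‖m i‖ ≤ 2 * Real.pi * (1 + ‖m‖) := by
    intro m
    have := norm_le_pi_norm m i
    gcongr
    linarith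
  obtain ⟨k, C, h⟩ := polyGrowth_rpow _ h1 _ h2 b
  refine ⟨k, C, fun m => le_trans (le_of_eq ?_) (h m)⟩
  have := Real.pi_pos
  rw [partialSymbol, Complex.norm_cpow_real, hn, Complex.norm_real, Real.norm_of_nonneg]
  positivity

/-- The Bessel potential `J^β` on distributions. -/
def besselPotential (θ : Matrix (Fin d) (Fin d) ℝ) (β : ℝ) : Distribution θ →ₗ[ℂ] Distribution θ :=
  multiplier θ (besselSymbol β) (polyGrowth_besselSymbol β)

/-- The Riesz potential `I^β`, to be used on distributions with `x̂(0) = 0`. -/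
def rieszPotential (θ : Matrix (Fin d) (Fin d) ℝ) (β : ℝ) : Distribution θ →ₗ[ℂ] Distribution θ :=
  multiplier θ (rieszSymbol β) (polyGrowth_rieszSymbol β)

/-- The fractional partial derivative `D_i^b`. -/
def fracPartial (θ : Matrix (Fin d) (Fin d) ℝ) (i : Fin d) (b : ℝ) :
    Distribution θ →ₗ[ℂ] Distribution θ :=
  multiplier θ (partialSymbol i b) (polyGrowth_partialSymbol i b)

/-- The fractional partial derivative `D^a = D_1^{a_1} ⋯ D_d^{a_d}`, with symbol
`D_a = D_{1,a_1} ⋯ D_{d,a_d}`. -/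
def fracDeriv (θ : Matrix (Fin d) (Fin d) ℝ) (a : Fin d → ℝ) :
    Distribution θ →ₗ[ℂ] Distribution θ :=
  multiplier θ (fun m => ∏ i, partialSymbol i (a i) m)
    (PolyGrowth.prod Finset.univ fun i => polyGrowth_partialSymbol i (a i))

/-! ### Besov spaces -/

/-- The Littlewood-Paley functions: `φ` is a Schwartz function supported in `1/2 ≤ |ξ| ≤ 2`, positive
for `1/2 < |ξ| < 2`, with `∑_{k ∈ ℤ} φ(2^{-k} ξ) = 1` for `ξ ≠ 0`. -/
structure IsLittlewoodPaley (φ : SchwartzMap (EuclideanSpace ℝ (Fin d)) ℝ) : Prop where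
  support : tsupport φ ⊆ {ξ | 1 / 2 ≤ ‖ξ‖ ∧ ‖ξ‖ ≤ 2}
  pos : ∀ ξ, 1 / 2 < ‖ξ‖ → ‖ξ‖ < 2 → 0 < φ ξ
  hasSum : ∀ ξ, ξ ≠ 0 → HasSum (fun k : ℤ => φ ((2 : ℝ) ^ (-k) • ξ)) 1

/-- The Littlewood-Paley piece `φ̃_k * x = ∑_m φ(2^{-k} m) x̂(m) U^m`. Since `φ(2^{-k} m) = 0` for
`|m| ≥ 2^{k+1}`, this is a polynomial, and the sum runs over the finitely many `m` with
`|m_j| ≤ 2^{k+1}` for all `j`. -/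
def piece {θ : Matrix (Fin d) (Fin d) ℝ} (φ : SchwartzMap (EuclideanSpace ℝ (Fin d)) ℝ) (k : ℕ)
    (x : Distribution θ) : GNS d →L[ℂ] GNS d :=
  ∑ m ∈ Fintype.piFinset fun _ : Fin d => Finset.Icc (-2 ^ (k + 1) : ℤ) (2 ^ (k + 1)),
    (((φ ((2 : ℝ) ^ (-(k : ℤ)) • toEuclid m) : ℝ) : ℂ) * fourierCoeff x m) • monomial θ m

/-- The Besov norm `(|x̂(0)|^q + ∑_{k ≥ 0} (2^{kα} ‖φ̃_k * x‖_p)^q)^{1/q}`, with a supremum for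
`q = ∞`, as an extended nonnegative number. -/
def besovNorm {θ : Matrix (Fin d) (Fin d) ℝ} (φ : SchwartzMap (EuclideanSpace ℝ (Fin d)) ℝ)
    (α : ℝ) (p q : ℝ≥0∞) (x : Distribution θ) : ℝ≥0∞ :=
  if q = ∞ then
    max ‖fourierCoeff x 0‖ₑ
      (⨆ k : ℕ, ENNReal.ofReal ((2 : ℝ) ^ (k * α) * lpNorm p (piece φ k x)))
  else
    (‖fourierCoeff x 0‖ₑ ^ q.toReal +
      ∑' k : ℕ, ENNReal.ofReal ((2 : ℝ) ^ (k * α) * lpNorm p (piece φ k x)) ^ q.toReal) ^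
        (1 / q.toReal)

/-- The Besov space `B^α_{p,q}(𝕋ᵈ_θ)`, defined with the Littlewood-Paley function `φ`. -/
def besovSpace (θ : Matrix (Fin d) (Fin d) ℝ) (φ : SchwartzMap (EuclideanSpace ℝ (Fin d)) ℝ)
    (α : ℝ) (p q : ℝ≥0∞) : Set (Distribution θ) :=
  {x | besovNorm φ α p q x < ∞}

/-- The distributions with `x̂(0) = 0`. -/
def meanZero (θ : Matrix (Fin d) (Fin d) ℝ) : Set (Distribution θ) :=
  {x | fourierCoeff x 0 = 0}

/-- The linear map `T` restricts to an isomorphism from `X`, with norm `N`, onto `Y`, with norm `N'`: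
a bijection that is bounded and has a bounded inverse. -/
def IsIsomorphismOn {θ : Matrix (Fin d) (Fin d) ℝ} (T : Distribution θ →ₗ[ℂ] Distribution θ)
    (X : Set (Distribution θ)) (N : Distribution θ → ℝ≥0∞)
    (Y : Set (Distribution θ)) (N' : Distribution θ → ℝ≥0∞) : Prop :=
  Set.BijOn T X Y ∧ ∃ C : ℝ≥0, ∀ x ∈ X, N' (T x) ≤ C * N x ∧ N x ≤ C * N' (T x)

end QuantumTorus

end

/-! Everything reduces to one estimate: a symbol of order `β`, restricted to the frequencies `|m| ~
2^k`, is a Fourier multiplier on every `L_p` with norm at most `C 2^(kβ)`. A Fourier multiplier acts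
on each Littlewood-Paley piece of `x` separately, and each piece has its frequencies in one annulus.
The estimate can therefore be inserted term by term into the Besov norm; neighbouring pieces never
interact (`exists_besovNorm_multiplier_le`).

The estimate comes from transference. A character `χ` of `ℤᵈ` acts by `U^m ↦ χ(m) U^m`, which is
conjugation by a unitary fixing the trace vector, hence an isometry for every `L_p`-norm. By Fourier
inversion a sampled Schwartz function `m ↦ Ψ(v₀ + L m)` is an integral of characters of `m` with
total mass at most the `L¹`-norm of the inverse transform of `Ψ`. So this norm bounds the
multiplier, whatever the affine map (`IsLpMultiplier.integral`, `IsLpMultiplier.schwartz`), and the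
scaling `L m = 2^(-k) m` costs nothing. Bessel and Riesz symbols, rescaled, are smooth near the
annulus. The symbol `(2πi m_i)^b` is singular on `m_i = 0`, and for `b > 0` it is summed as a
geometric series of dyadic pieces in the single variable `m_i`. For the lower bound in (iii),
cutoffs away from `ξ_i = 0` write `1 = ∑ s_i (2πi m_i)^β` on each annulus, with `s_i` of order `-β`.

Averaging characters requires the `L_p`-balls to be convex and closed, that is, Minkowski's
inequality for `τ(|x|^p)^(1/p)`. It is proved here on a C⋆-algebra with a tracial state; the norm
closure of the polynomials is enough, because all pieces are polynomials. With `r = p/2`, the map `x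
↦ τ((x⋆x)^r)` is shown to be convex by means of Klein's trace inequality. For `r ≥ 1` one uses the
tangent to `s^r`. For `1/2 ≤ r < 1` one uses that `τ((x⋆x)^r)` is the infimum over `c` of `r τ(x⋆x
c⁻¹) + (1-r) τ(c^(r/(1-r)))`, a jointly convex expression in `(x, c)`. -/

noncomputable section

/-! ### Trace inequalities -/

/-- `T` is (the real part of) a state on a C⋆-algebra that is tracial on a closed star
subalgebra `S`. -/
structure IsTracialStateOn {A : Type*} [CStarAlgebra A] [PartialOrder A]
    (S : StarSubalgebra ℂ A) (T : A →L[ℝ] ℝ) : Prop where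
  isClosed : IsClosed (S : Set A)
  nonneg : ∀ a, 0 ≤ a → 0 ≤ T a
  comm : ∀ a ∈ S, ∀ b ∈ S, T (a * b) = T (b * a)
  map_one : T 1 = 1

namespace IsTracialStateOn

variable {A : Type*} [CStarAlgebra A] [PartialOrder A] [StarOrderedRing A]
  {S : StarSubalgebra ℂ A} {T : A →L[ℝ] ℝ}

omit [StarOrderedRing A] in
lemma cfc_mem (hT : IsTracialStateOn S T) (f : ℝ → ℝ) {a : A} (ha : a ∈ S) : cfc f a ∈ S :=
  have := hT.isClosed
  _root_.cfc_mem (𝕜' := ℂ) f ha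

lemma mono (hT : IsTracialStateOn S T) {a b : A} (h : a ≤ b) : T a ≤ T b := by
  have := hT.nonneg (b - a) (sub_nonneg.2 h)
  rw [map_sub] at this
  linarith

/-- Traciality turns `τ(ab)` into `τ(√b a √b)`, the state of a positive element. The root lies in
`S` because `S` is closed, hence stable under functional calculus. -/
lemma mul_nonneg (hT : IsTracialStateOn S T) {a b : A} (ha : a ∈ S) (hb : b ∈ S)
    (ha0 : 0 ≤ a) (hb0 : 0 ≤ b) : 0 ≤ T (a * b) := by
  have hc : CFC.sqrt b ∈ S := by
    rw [CFC.sqrt_eq_rpow, CFC.rpow_eq_cfc_real hb0]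
    exact hT.cfc_mem _ hb
  have hcs : star (CFC.sqrt b) = CFC.sqrt b := (IsSelfAdjoint.of_nonneg (CFC.sqrt_nonneg b))
  have h := hT.nonneg _ (star_right_conjugate_nonneg ha0 (CFC.sqrt b))
  rw [hcs, mul_assoc, hT.comm _ hc _ (mul_mem ha hc), mul_assoc, CFC.sqrt_mul_sqrt_self b hb0] at h
  exact h

lemma self_mul_star_nonneg (hT : IsTracialStateOn S T) {w v : A} (hw : w ∈ S) (hv : v ∈ S)
    (hv0 : 0 ≤ v) : 0 ≤ T (star w * w * v) :=
  hT.mul_nonneg (mul_mem (star_mem hw) hw) hv (star_mul_self_nonneg w) hv0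

/-- Klein's inequality. -/
theorem klein (hT : IsTracialStateOn S T) {a b : A} (ha : a ∈ S) (hb : b ∈ S)
    (hsa : IsSelfAdjoint a) (hsb : IsSelfAdjoint b) {f u v : ℝ → ℝ}
    (hf : ContinuousOn f (spectrum ℝ a)) (hu : ContinuousOn u (spectrum ℝ b))
    (hv : ContinuousOn v (spectrum ℝ b))
    (h : ∀ s ∈ spectrum ℝ a, ∀ t ∈ spectrum ℝ b, u t + s * v t ≤ f s) :
    T (cfc u b) + T (a * cfc v b) ≤ T (cfc f a) := by
  have key : ∀ δ > 0, T (cfc u b) + T (a * cfc v b) ≤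
      T (cfc f a) + δ * (‖T‖ + ‖T‖ * ‖a‖) := by
    intro δ hδ
    -- A partition of unity on the spectrum of `b`, finer than the moduli of continuity of `u` and
    -- `v`, replaces `u(b)` and `v(b)` by finite combinations of positive elements `ρ_i(b)`.
    have hK : IsCompact (spectrum ℝ b) := ContinuousFunctionalCalculus.isCompact_spectrum b
    obtain ⟨η₁, hη₁, hu'⟩ := Metric.uniformContinuousOn_iff.1
      (hK.uniformContinuousOn_of_continuous hu) δ hδ
    obtain ⟨η₂, hη₂, hv'⟩ := Metric.uniformContinuousOn_iff.1
      (hK.uniformContinuousOn_of_continuous hv) δ hδ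
    obtain ⟨t, htK, htf, hcov⟩ := hK.finite_cover_balls (lt_min hη₁ hη₂)
    have : Fintype t := htf.fintype
    obtain ⟨ρ, hρ⟩ := PartitionOfUnity.exists_isSubordinate hK.isClosed
      (fun i : t => Metric.ball (i : ℝ) (min η₁ η₂)) (fun _ => Metric.isOpen_ball)
      (by simpa [Set.iUnion_subtype] using hcov)
    have hsum : ∀ x ∈ spectrum ℝ b, ∑ i, ρ i x = 1 := fun x hx => by
      rw [← finsum_eq_sum_of_fintype]; exact ρ.sum_eq_one hx
    have happrox : ∀ w : ℝ → ℝ, ContinuousOn w (spectrum ℝ b) →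
        (∀ x ∈ spectrum ℝ b, ∀ y ∈ spectrum ℝ b, dist x y < min η₁ η₂ → dist (w x) (w y) < δ) →
        ‖cfc w b - ∑ i : t, w i • cfc (ρ i) b‖ ≤ δ := by
      intro w hw hw'
      have e1 : ∑ i : t, w i • cfc (ρ i) b = cfc (fun x => ∑ i : t, w i * ρ i x) b := by
        rw [← Finset.sum_fn, cfc_sum _ _ _ (fun i _ => by fun_prop)]
        exact Finset.sum_congr rfl fun i _ => (cfc_const_mul _ _ _ (by fun_prop)).symm
      rw [e1, ← cfc_sub _ _ _ hw (by fun_prop)]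
      refine norm_cfc_le hδ.le fun x hx => ?_
      have e2 : w x - ∑ i : t, w i * ρ i x = ∑ i : t, (w x - w i) * ρ i x := by
        simp only [sub_mul, Finset.sum_sub_distrib, ← Finset.mul_sum, hsum x hx, mul_one]
      rw [e2]
      calc ‖∑ i : t, (w x - w i) * ρ i x‖ ≤ ∑ i : t, δ * ρ i x := by
            refine norm_sum_le_of_le _ fun i _ => ?_
            rw [norm_mul, Real.norm_of_nonneg (ρ.nonneg i x)]
            by_cases h0 : ρ i x = 0
            · simp [h0]
            · refine mul_le_mul_of_nonneg_right ?_ (ρ.nonneg i x)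
              have hx' : x ∈ Metric.ball (i : ℝ) (min η₁ η₂) :=
                hρ i (subset_tsupport _ h0)
              exact (hw' x hx i (htK i.2) hx').le
        _ = δ := by rw [← Finset.mul_sum, hsum x hx, mul_one]
    have hone : ∑ i : t, cfc (ρ i) b = 1 := by
      rw [← cfc_sum _ _ _ (fun i _ => by fun_prop), ← cfc_one ℝ b]
      exact cfc_congr fun x hx => by simpa using hsum x hx
    have h1 : T (∑ i : t, u i • cfc (ρ i) b) + T (a * ∑ i : t, v i • cfc (ρ i) b) ≤
        T (cfc f a) := by
      rw [← mul_one (cfc f a), ← hone, Finset.mul_sum, Finset.mul_sum, map_sum, map_sum, map_sum,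
        ← Finset.sum_add_distrib]
      refine Finset.sum_le_sum fun i _ => ?_
      -- With `t` frozen at the node `i`, the hypothesis concerns functions of `a` alone, so the
      -- first factor is positive, and so is `ρ_i(b)`.
      have hp : 0 ≤ T ((cfc f a - (u i • 1 + v i • a)) * cfc (ρ i) b) := by
        have e3 : cfc f a - (u i • 1 + v i • a) = cfc (fun s => f s - (u i + v i * s)) a := by
          rw [cfc_sub _ _ _ hf (by fun_prop), cfc_const_add _ _ _ (by fun_prop),
            cfc_const_mul _ _ _ (by fun_prop), cfc_id' ℝ a, Algebra.algebraMap_eq_smul_one]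
        rw [e3]
        refine hT.mul_nonneg (hT.cfc_mem _ ha) (hT.cfc_mem _ hb)
          (cfc_nonneg fun s hs => ?_) (cfc_nonneg fun s hs => ρ.nonneg i s)
        have := h s hs i (htK i.2)
        linarith
      rw [sub_mul, add_mul, map_sub, map_add, smul_mul_assoc, smul_mul_assoc, one_mul] at hp
      rw [mul_smul_comm]
      linarith
    have h2 := happrox u hu fun x hx y hy hxy => hu' x hx y hy (hxy.trans_le (min_le_left _ _))
    have h3 := happrox v hv fun x hx y hy hxy => hv' x hx y hy (hxy.trans_le (min_le_right _ _))
    have h4 : T (cfc u b) - T (∑ i : t, u i • cfc (ρ i) b) ≤ ‖T‖ * δ := by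
      rw [← map_sub]
      exact (le_abs_self _).trans ((T.le_opNorm _).trans (by gcongr))
    have h5 : T (a * cfc v b) - T (a * ∑ i : t, v i • cfc (ρ i) b) ≤ ‖T‖ * (‖a‖ * δ) := by
      rw [← map_sub, ← mul_sub]
      exact (le_abs_self _).trans ((T.le_opNorm _).trans (by
        gcongr; exact (norm_mul_le _ _).trans (by gcongr)))
    linarith
  have hlim : Filter.Tendsto (fun δ : ℝ => T (cfc f a) + δ * (‖T‖ + ‖T‖ * ‖a‖))
      (nhdsWithin 0 (Set.Ioi 0)) (nhds (T (cfc f a) + 0 * (‖T‖ + ‖T‖ * ‖a‖))) :=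
    Filter.Tendsto.mono_left (Continuous.tendsto (by fun_prop) 0) nhdsWithin_le_nhds
  rw [zero_mul, add_zero] at hlim
  exact ge_of_tendsto hlim (Filter.eventually_of_mem self_mem_nhdsWithin key)

end IsTracialStateOn

end

/-! ### Convexity of `x ↦ τ((x⋆x)^r)` for `r ≥ 1/2`. -/

noncomputable section

namespace IsTracialStateOn

variable {A : Type*} [CStarAlgebra A] [PartialOrder A] [StarOrderedRing A]
  {S : StarSubalgebra ℂ A} {T : A →L[ℝ] ℝ}

lemma spectrum_nonneg {a : A} (ha : 0 ≤ a) {t : ℝ} (ht : t ∈ spectrum ℝ a) :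
    0 ≤ t := spectrum_nonneg_of_nonneg ha ht

/-- The tangent inequality for the convex power `s ^ r`, `1 ≤ r`. -/
lemma rpow_tangent_le {r : ℝ} (hr : 1 ≤ r) {s t : ℝ} (hs : 0 ≤ s) (ht : 0 ≤ t) :
    (1 - r) * t ^ r + s * (r * t ^ (r - 1)) ≤ s ^ r := by
  rcases ht.eq_or_lt with rfl | ht
  · rw [Real.zero_rpow (by linarith)]
    -- At `t = 0` the factor `0 ^ (r - 1)` is `1` for `r = 1` and `0` for `r > 1`.
    rcases hr.eq_or_lt with rfl | hr
    · simp
    · rw [Real.zero_rpow (by linarith)]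
      simpa using Real.rpow_nonneg hs r
  -- Bernoulli's inequality for the ratio `s / t`, then multiplication by `t ^ r`.
  · have h := one_add_mul_self_le_rpow_one_add (s := s / t - 1)
      (by have := div_nonneg hs ht.le; linarith) hr
    rw [add_sub_cancel, Real.div_rpow hs ht.le, le_div_iff₀ (Real.rpow_pos_of_pos ht r)] at h
    rw [Real.rpow_sub ht, Real.rpow_one]
    refine le_trans (le_of_eq ?_) h
    field_simp
    ring

/-- The tangent inequality for the concave power `s ^ r`, in the variable `t ^ (1 / (1 - r))`. -/
lemma rpow_le_tangent {r : ℝ} (hr0 : 0 < r) (hr1 : r < 1) {s t : ℝ} (hs : 0 ≤ s) (ht : 0 < t) :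
    s ^ r ≤ (1 - r) * t ^ (r / (1 - r)) + s * (r * t⁻¹) := by
  -- Weights `1 - r` and `r` on `t^(r/(1-r))` and `s/t`: the powers of `t` cancel in the geometric
  -- mean and leave `s^r`.
  have h := Real.geom_mean_le_arith_mean2_weighted (sub_nonneg.2 hr1.le) hr0.le
    (Real.rpow_nonneg ht.le (r / (1 - r))) (_root_.mul_nonneg hs (inv_nonneg.2 ht.le)) (by ring)
  rw [← Real.rpow_mul ht.le, div_mul_cancel₀ _ (by linarith), Real.mul_rpow hs (by positivity),
    Real.inv_rpow ht.le, mul_left_comm, mul_inv_cancel₀ (Real.rpow_pos_of_pos ht r).ne',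
    mul_one] at h
  linarith

/-- Klein's inequality for the power `s`, `1 ≤ s`. -/
lemma klein_rpow (hT : IsTracialStateOn S T) {s : ℝ} (hs : 1 ≤ s) {a b : A} (ha : a ∈ S)
    (hb : b ∈ S) (ha0 : 0 ≤ a) (hb0 : 0 ≤ b) :
    T (cfc (fun t : ℝ => (1 - s) * t ^ s) b) + T (a * cfc (fun t : ℝ => s * t ^ (s - 1)) b) ≤
      T (cfc (fun t : ℝ => t ^ s) a) := by
  have hc1 : Continuous fun t : ℝ => t ^ s := Real.continuous_rpow_const (by linarith)
  have hc2 : Continuous fun t : ℝ => t ^ (s - 1) := Real.continuous_rpow_const (by linarith)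
  exact hT.klein ha hb (.of_nonneg ha0) (.of_nonneg hb0) (by fun_prop) (by fun_prop)
    (by fun_prop) fun p hp t ht => rpow_tangent_le hs (spectrum_nonneg ha0 hp)
      (spectrum_nonneg hb0 ht)

/-- The case of equality in `klein_rpow`. -/
lemma klein_rpow_self (T : A →L[ℝ] ℝ) {s : ℝ} (hs : 1 ≤ s) {b : A} (hb0 : 0 ≤ b) :
    T (cfc (fun t : ℝ => t ^ s) b) =
      T (cfc (fun t : ℝ => (1 - s) * t ^ s) b) + T (b * cfc (fun t : ℝ => s * t ^ (s - 1)) b) := by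
  have hc1 : Continuous fun t : ℝ => t ^ s := Real.continuous_rpow_const (by linarith)
  have hc2 : Continuous fun t : ℝ => t ^ (s - 1) := Real.continuous_rpow_const (by linarith)
  nth_rw 3 [← cfc_id' ℝ b]
  rw [← cfc_mul _ _ _ (by fun_prop) (by fun_prop), ← map_add, ← cfc_add _ _ _ (by fun_prop)
    (by fun_prop)]
  congr 1
  refine cfc_congr fun t ht => ?_
  rcases (spectrum_nonneg hb0 ht).eq_or_lt with rfl | ht0
  · rw [Real.zero_rpow (by linarith)]; simp
  · simp only [Real.rpow_sub ht0, Real.rpow_one]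
    field_simp
    ring

/-- Convexity of `a ↦ τ (a ^ s)`, `1 ≤ s`, on positive elements. -/
lemma rpow_convex (hT : IsTracialStateOn S T) {s : ℝ} (hs : 1 ≤ s) {a b : A} (ha : a ∈ S)
    (hb : b ∈ S) (ha0 : 0 ≤ a) (hb0 : 0 ≤ b) {l m : ℝ} (hl : 0 ≤ l) (hm : 0 ≤ m)
    (hlm : l + m = 1) :
    T (cfc (fun t : ℝ => t ^ s) (l • a + m • b)) ≤
      l * T (cfc (fun t : ℝ => t ^ s) a) + m * T (cfc (fun t : ℝ => t ^ s) b) := by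
  set z := l • a + m • b with hz
  have hz0 : 0 ≤ z := add_nonneg (smul_nonneg hl ha0) (smul_nonneg hm hb0)
  have hzS : z ∈ S := add_mem
    (by simpa using SMulMemClass.smul_mem (l : ℂ) ha) (by simpa using SMulMemClass.smul_mem (m : ℂ) hb)
  -- The tangent at the convex combination `z` supports the function at `a` and `b`; the weighted
  -- sum of the two bounds is the equality case at `z`.
  have h1 := mul_le_mul_of_nonneg_left (hT.klein_rpow hs ha hzS ha0 hz0) hl
  have h2 := mul_le_mul_of_nonneg_left (hT.klein_rpow hs hb hzS hb0 hz0) hm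
  have e2 : T (z * cfc (fun t : ℝ => s * t ^ (s - 1)) z) =
      l * T (a * cfc (fun t : ℝ => s * t ^ (s - 1)) z) +
      m * T (b * cfc (fun t : ℝ => s * t ^ (s - 1)) z) := by
    nth_rw 1 [hz]
    rw [add_mul, smul_mul_assoc, smul_mul_assoc, map_add, map_smul, map_smul]
    rfl
  rw [klein_rpow_self T hs hz0, e2]
  have e3 : T (cfc (fun t : ℝ => (1 - s) * t ^ s) z) =
    (l + m) * T (cfc (fun t : ℝ => (1 - s) * t ^ s) z) := by rw [hlm, one_mul]
  rw [e3]
  linarith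

omit [PartialOrder A] [StarOrderedRing A] in
lemma smul_mem_real {x : A} (hx : x ∈ S) (l : ℝ) : l • x ∈ S := by
  simpa using SMulMemClass.smul_mem (l : ℂ) hx

/-- Convexity of `w ↦ τ (w⋆ w v)` for a positive `v`. -/
lemma quadratic_convex (hT : IsTracialStateOn S T) {v : A} (hv : v ∈ S) (hv0 : 0 ≤ v) {x y : A}
    (hx : x ∈ S) (hy : y ∈ S) {l m : ℝ} (hl : 0 ≤ l) (hm : 0 ≤ m) (hlm : l + m = 1) :
    T (star (l • x + m • y) * (l • x + m • y) * v) ≤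
      l * T (star x * x * v) + m * T (star y * y * v) := by
  -- For a quadratic form the gap in the convexity inequality is `l m` times its value at `x - y`.
  have h := hT.self_mul_star_nonneg (sub_mem hx hy) hv hv0
  obtain rfl : m = 1 - l := by linarith
  have h' := _root_.mul_nonneg (_root_.mul_nonneg hl hm) h
  simp only [star_add, star_sub, star_smul, star_trivial, add_mul, mul_add, sub_mul, mul_sub,
    smul_mul_assoc, mul_smul_comm, map_add, map_sub, map_smul, smul_eq_mul] at h' ⊢
  linarith

/-- Convexity of `x ↦ τ ((x⋆ x) ^ r)` for `1 ≤ r`. -/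
lemma star_mul_self_rpow_convex_of_one_le (hT : IsTracialStateOn S T) {r : ℝ} (hr : 1 ≤ r)
    {x y : A} (hx : x ∈ S) (hy : y ∈ S) {l m : ℝ} (hl : 0 ≤ l) (hm : 0 ≤ m) (hlm : l + m = 1) :
    T (cfc (fun t : ℝ => t ^ r) (star (l • x + m • y) * (l • x + m • y))) ≤
      l * T (cfc (fun t : ℝ => t ^ r) (star x * x)) +
        m * T (cfc (fun t : ℝ => t ^ r) (star y * y)) := by
  set w := l • x + m • y with hw
  have hwS : w ∈ S := add_mem (smul_mem_real hx l) (smul_mem_real hy m)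
  set z := star w * w with hz
  have hz0 : 0 ≤ z := star_mul_self_nonneg w
  have hzS : z ∈ S := mul_mem (star_mem hwS) hwS
  -- The tangent at `z = w⋆w` is linear in `x⋆x`, with slope `v = r z^(r-1) ≥ 0`. What remains is
  -- the convexity of `x ↦ τ(x⋆x v)` for this fixed `v`.
  have h1 := mul_le_mul_of_nonneg_left (hT.klein_rpow hr (mul_mem (star_mem hx) hx) hzS
    (star_mul_self_nonneg x) hz0) hl
  have h2 := mul_le_mul_of_nonneg_left (hT.klein_rpow hr (mul_mem (star_mem hy) hy) hzS
    (star_mul_self_nonneg y) hz0) hm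
  have e2 := hT.quadratic_convex (v := cfc (fun t : ℝ => r * t ^ (r - 1)) z) (hT.cfc_mem _ hzS)
    (cfc_nonneg fun t ht => by
      have := spectrum_nonneg hz0 ht
      positivity) hx hy hl hm hlm
  rw [← hw, ← hz] at e2
  rw [klein_rpow_self T hr hz0]
  have e3 : T (cfc (fun t : ℝ => (1 - r) * t ^ r) z) =
    (l + m) * T (cfc (fun t : ℝ => (1 - r) * t ^ r) z) := by rw [hlm, one_mul]
  rw [e3]
  linarith

/-- Joint convexity of `(x, c) ↦ τ (x⋆ x c⁻¹)`, with `v`, `v'`, `V` the inverses of `c`, `c'` and of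
their convex combination. -/
lemma jointly_convex (hT : IsTracialStateOn S T) {c c' v v' V x y : A} (hx : x ∈ S)
    (hy : y ∈ S) (hc : c ∈ S) (hc' : c' ∈ S) (hv : v ∈ S) (hv' : v' ∈ S) (hV : V ∈ S)
    (hcs : IsSelfAdjoint c) (hcs' : IsSelfAdjoint c')
    (hv0 : 0 ≤ v) (hv0' : 0 ≤ v') (hcv : c * v = 1) (hcv' : c' * v' = 1)
    {l m : ℝ} (hl : 0 ≤ l) (hm : 0 ≤ m) (hVc : V * (l • c + m • c') = 1) :
    T (star (l • x + m • y) * (l • x + m • y) * V) ≤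
      l * T (star x * x * v) + m * T (star y * y * v') := by
  set z := l • x + m • y with hz
  have hzS : z ∈ S := add_mem (smul_mem_real hx l) (smul_mem_real hy m)
  set w := z * V with hw
  have hwS : w ∈ S := mul_mem hzS hV
  -- Completing the square: `τ((x - wc)⋆(x - wc) c⁻¹) ≥ 0` bounds `τ(x⋆x c⁻¹)` below by an
  -- expression that is real-linear in `(x, c)` for fixed `w`. Equality holds for `x = wc`, and `w =
  -- z V` is chosen to achieve this at the convex combination.
  have key : ∀ {c v x : A}, x ∈ S → c ∈ S → v ∈ S → IsSelfAdjoint c → 0 ≤ v → c * v = 1 →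
      T (star x * w) + T (star w * x) - T (star w * w * c) ≤ T (star x * x * v) := by
    intro c v x hx hc hv hcs hv0 hcv
    have h := hT.self_mul_star_nonneg (sub_mem hx (mul_mem hwS hc)) hv hv0
    have hvc : v * c = 1 := by
      have := congrArg star hcv
      rwa [star_mul, star_one, hcs.star_eq, (IsSelfAdjoint.of_nonneg hv0).star_eq] at this
    have e1 : star (x - w * c) * (x - w * c) * v =
        star x * x * v - star x * w * (c * v) - c * (star w * x * v) +
          c * (star w * w * (c * v)) := by
      rw [star_sub, star_mul, hcs.star_eq]
      noncomm_ring
    rw [e1, hcv, mul_one, mul_one, map_add, map_sub, map_sub,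
      hT.comm c hc (star w * x * v) (mul_mem (mul_mem (star_mem hwS) hx) hv), mul_assoc _ v c, hvc,
      mul_one, hT.comm c hc (star w * w) (mul_mem (star_mem hwS) hwS)] at h
    linarith
  have h1 := mul_le_mul_of_nonneg_left (key hx hc hv hcs hv0 hcv) hl
  have h2 := mul_le_mul_of_nonneg_left (key hy hc' hv' hcs' hv0' hcv') hm
  have e2 : T (star z * w) = l * T (star x * w) + m * T (star y * w) := by
    rw [hz]
    simp only [star_add, star_smul, star_trivial, add_mul, smul_mul_assoc, map_add, map_smul,
      smul_eq_mul]
  have e3 : T (star w * z) = l * T (star w * x) + m * T (star w * y) := by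
    conv_lhs => rw [hz]
    simp only [mul_add, mul_smul_comm, map_add, map_smul, smul_eq_mul]
  have e4 : T (star w * w * (l • c + m • c')) =
      l * T (star w * w * c) + m * T (star w * w * c') := by
    simp only [mul_add, mul_smul_comm, map_add, map_smul, smul_eq_mul]
  have e5 : T (star w * w * (l • c + m • c')) = T (star w * z) := by
    rw [mul_assoc (star w), hw, mul_assoc z, hVc, mul_one]
  have e6 : T (star z * z * V) = T (star z * w) := by rw [hw, mul_assoc]
  rw [e6]
  linarith

/-- Convexity of `x ↦ τ ((x⋆ x) ^ r)` for `1 / 2 ≤ r < 1`. -/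
lemma star_mul_self_rpow_convex_of_lt_one (hT : IsTracialStateOn S T) {r : ℝ} (hr : 1 / 2 ≤ r)
    (hr1 : r < 1) {x y : A} (hx : x ∈ S) (hy : y ∈ S) {l m : ℝ} (hl : 0 ≤ l) (hm : 0 ≤ m)
    (hlm : l + m = 1) :
    T (cfc (fun t : ℝ => t ^ r) (star (l • x + m • y) * (l • x + m • y))) ≤
      l * T (cfc (fun t : ℝ => t ^ r) (star x * x)) +
        m * T (cfc (fun t : ℝ => t ^ r) (star y * y)) := by
  have hr0 : 0 < r := by linarith
  -- The condition `r ≥ 1/2` is exactly what makes `c ↦ τ(c^(r/(1-r)))` convex.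
  have hσ : 1 ≤ r / (1 - r) := by rw [le_div_iff₀ (by linarith)]; linarith
  have hc1 : Continuous fun t : ℝ => t ^ r := Real.continuous_rpow_const (by linarith)
  have hc2 : Continuous fun t : ℝ => t ^ (r / (1 - r)) := Real.continuous_rpow_const (by linarith)
  set w := l • x + m • y with hw
  have hwS : w ∈ S := add_mem (smul_mem_real hx l) (smul_mem_real hy m)
  -- The optimal `c` for `x` is `(x⋆x)^(1-r)`, which need not be invertible. Replacing `x⋆x` by `x⋆x
  -- + δ` costs at most `δ^r`, by subadditivity of `t^r`.
  have key : ∀ δ > 0, T (cfc (fun t : ℝ => t ^ r) (star w * w)) ≤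
      l * T (cfc (fun t : ℝ => t ^ r) (star x * x)) +
        m * T (cfc (fun t : ℝ => t ^ r) (star y * y)) + δ ^ r := by
    intro δ hδ
    have hct : ∀ {a : A}, 0 ≤ a → ∀ e : ℝ,
        ContinuousOn (fun t : ℝ => (t + δ) ^ e) (spectrum ℝ a) := by
      intro a ha e t ht
      have := spectrum_nonneg ha ht
      exact ((continuousAt_id.add continuousAt_const).rpow_const
        (Or.inl (by positivity : t + δ ≠ 0))).continuousWithinAt
    -- the perturbed powers attached to an element
    have hel : ∀ x ∈ S, ∃ c v : A, c ∈ S ∧ v ∈ S ∧ algebraMap ℝ A (δ ^ (1 - r)) ≤ c ∧ 0 ≤ v ∧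
        c * v = 1 ∧ r * T (star x * x * v) + (1 - r) * T (cfc (fun t : ℝ => t ^ (r / (1 - r))) c) ≤
          T (cfc (fun t : ℝ => t ^ r) (star x * x)) + δ ^ r := by
      intro x hx
      have hx0 := star_mul_self_nonneg x
      have hxs : IsSelfAdjoint (star x * x) := .of_nonneg hx0
      have hxS : star x * x ∈ S := mul_mem (star_mem hx) hx
      refine ⟨cfc (fun t : ℝ => (t + δ) ^ (1 - r)) (star x * x),
        cfc (fun t : ℝ => (t + δ) ^ (r - 1)) (star x * x), hT.cfc_mem _ hxS, hT.cfc_mem _ hxS,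
        ?_, ?_, ?_, ?_⟩
      · rw [algebraMap_le_cfc_iff _ _ _ (hct hx0 _)]
        intro t ht
        have := spectrum_nonneg hx0 ht
        exact Real.rpow_le_rpow hδ.le (by linarith) (by linarith)
      · refine cfc_nonneg fun t ht => ?_
        have := spectrum_nonneg hx0 ht
        positivity
      · rw [← cfc_mul _ _ _ (hct hx0 _) (hct hx0 _), ← cfc_one ℝ (star x * x)]
        refine cfc_congr fun t ht => ?_
        have := spectrum_nonneg hx0 ht
        simp only [Pi.one_apply]
        rw [← Real.rpow_add (by positivity)]
        simp
      · have e1 : star x * x * cfc (fun t : ℝ => (t + δ) ^ (r - 1)) (star x * x) =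
            cfc (fun t : ℝ => t * (t + δ) ^ (r - 1)) (star x * x) := by
          rw [cfc_mul _ _ _ (by fun_prop) (hct hx0 _), cfc_id' ℝ (star x * x)]
        have e2 : cfc (fun t : ℝ => t ^ (r / (1 - r)))
            (cfc (fun t : ℝ => (t + δ) ^ (1 - r)) (star x * x)) =
            cfc (fun t : ℝ => (t + δ) ^ r) (star x * x) := by
          rw [← cfc_comp _ _ _ hxs hc2.continuousOn (hct hx0 _)]
          refine cfc_congr fun t ht => ?_
          have := spectrum_nonneg hx0 ht
          simp only [Function.comp]
          rw [← Real.rpow_mul (by positivity), mul_div_cancel₀ _ (by linarith)]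
        have hcm : ContinuousOn (fun t : ℝ => t * (t + δ) ^ (r - 1)) (spectrum ℝ (star x * x)) :=
          continuousOn_id.mul (hct hx0 _)
        rw [e1, e2]
        have e3 : r * T (cfc (fun t : ℝ => t * (t + δ) ^ (r - 1)) (star x * x)) +
            (1 - r) * T (cfc (fun t : ℝ => (t + δ) ^ r) (star x * x)) =
            T (cfc (fun t : ℝ => r * (t * (t + δ) ^ (r - 1)) + (1 - r) * (t + δ) ^ r)
              (star x * x)) := by
          rw [cfc_add _ _ _ (hcm.const_mul r |>.congr fun _ _ => rfl)
              ((hct hx0 r).const_mul (1 - r) |>.congr fun _ _ => rfl),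
            cfc_const_mul _ _ _ hcm, cfc_const_mul _ _ _ (hct hx0 _), map_add, map_smul, map_smul]
          rfl
        have e4 : T (cfc (fun t : ℝ => t ^ r) (star x * x)) + δ ^ r =
            T (cfc (fun t : ℝ => t ^ r + δ ^ r) (star x * x)) := by
          rw [cfc_add_const _ _ _ hc1.continuousOn, map_add, Algebra.algebraMap_eq_smul_one,
            map_smul, hT.map_one, smul_eq_mul, mul_one]
        rw [e3, e4]
        refine hT.mono (cfc_mono (fun t ht => ?_)
          ((hcm.const_mul r).add ((hct hx0 r).const_mul (1 - r)))
          (hc1.continuousOn.add continuousOn_const))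
        have ht0 := spectrum_nonneg hx0 ht
        have htd : 0 < t + δ := by linarith
        have h1 : t * (t + δ) ^ (r - 1) ≤ (t + δ) ^ r := by
          calc t * (t + δ) ^ (r - 1) ≤ (t + δ) * (t + δ) ^ (r - 1) := by gcongr; linarith
            _ = (t + δ) ^ r := by rw [Real.rpow_sub_one htd.ne']; field_simp
        have h2 := Real.rpow_add_le_add_rpow ht0 hδ.le hr0.le hr1.le
        calc r * (t * (t + δ) ^ (r - 1)) + (1 - r) * (t + δ) ^ r
            ≤ r * (t + δ) ^ r + (1 - r) * (t + δ) ^ r := by gcongr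
          _ = (t + δ) ^ r := by ring
          _ ≤ _ := h2
    obtain ⟨c, v, hc, hv, hcδ, hv0, hcv, hcx⟩ := hel x hx
    obtain ⟨c', v', hc', hv', hcδ', hv0', hcv', hcy⟩ := hel y hy
    have hδ0 : (0 : A) ≤ algebraMap ℝ A (δ ^ (1 - r)) := by
      rw [Algebra.algebraMap_eq_smul_one]; exact smul_nonneg (by positivity) zero_le_one
    have hc0 := hδ0.trans hcδ
    have hc0' := hδ0.trans hcδ'
    set C := l • c + m • c' with hC
    have hCS : C ∈ S := add_mem (smul_mem_real hc l) (smul_mem_real hc' m)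
    have hCδ : algebraMap ℝ A (δ ^ (1 - r)) ≤ C := by
      calc algebraMap ℝ A (δ ^ (1 - r)) =
          l • algebraMap ℝ A (δ ^ (1 - r)) + m • algebraMap ℝ A (δ ^ (1 - r)) := by
            rw [← add_smul, hlm, one_smul]
        _ ≤ C := add_le_add (smul_le_smul_of_nonneg_left hcδ hl)
            (smul_le_smul_of_nonneg_left hcδ' hm)
    have hC0 := hδ0.trans hCδ
    have hCs : IsSelfAdjoint C := .of_nonneg hC0
    have hspec : ∀ t ∈ spectrum ℝ C, 0 < t := fun t ht =>
      (Real.rpow_pos_of_pos hδ _).trans_le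
        ((algebraMap_le_iff_le_spectrum (R := ℝ) hCs).1 hCδ t ht)
    have hinv : ContinuousOn (fun t : ℝ => t⁻¹) (spectrum ℝ C) :=
      continuousOn_inv₀.mono fun t ht => (hspec t ht).ne'
    have hVC : cfc (fun t : ℝ => t⁻¹) C * C = 1 := by
      nth_rw 2 [← cfc_id' ℝ C]
      rw [← cfc_mul _ _ _ hinv (by fun_prop), ← cfc_one ℝ C]
      exact cfc_congr fun t ht => inv_mul_cancel₀ (hspec t ht).ne'
    have hw0 := star_mul_self_nonneg w
    -- All signs are reversed because `s^r` is concave here: this is `τ((w⋆w)^r) ≤ (1-r)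
    -- τ(C^(r/(1-r))) + r τ(w⋆w C⁻¹)`, with `C` a possibly non-optimal choice for `w`.
    have hk := hT.klein (f := fun t => -t ^ r) (u := fun t => -((1 - r) * t ^ (r / (1 - r))))
      (v := fun t => -(r * t⁻¹)) (mul_mem (star_mem hwS) hwS) hCS (.of_nonneg hw0) hCs
      (by fun_prop) (by fun_prop) ((hinv.const_mul r).neg) (fun s hs t ht => by
        have := rpow_le_tangent hr0 hr1 (spectrum_nonneg hw0 hs) (hspec t ht)
        linarith)
    rw [cfc_neg, cfc_neg, cfc_neg, cfc_const_mul _ _ _ hc2.continuousOn, cfc_const_mul _ _ _ hinv,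
      map_neg, map_neg, mul_neg, map_neg, map_smul, mul_smul_comm, map_smul, smul_eq_mul,
      smul_eq_mul] at hk
    have h1 := hT.rpow_convex hσ hc hc' hc0 hc0' hl hm hlm
    have h2 := hT.jointly_convex hx hy hc hc' hv hv' (hT.cfc_mem _ hCS) (.of_nonneg hc0)
      (.of_nonneg hc0') hv0 hv0' hcv hcv' hl hm hVC
    rw [← hw] at h2
    rw [← hC] at h1
    have h3 := mul_le_mul_of_nonneg_left h2 hr0.le
    have h4 := mul_le_mul_of_nonneg_left h1 (sub_nonneg.2 hr1.le)
    have h5 := mul_le_mul_of_nonneg_left hcx hl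
    have h6 := mul_le_mul_of_nonneg_left hcy hm
    have h7 : l * δ ^ r + m * δ ^ r = δ ^ r := by rw [← add_mul, hlm, one_mul]
    linarith
  have hlim : Filter.Tendsto (fun δ : ℝ => l * T (cfc (fun t : ℝ => t ^ r) (star x * x)) +
        m * T (cfc (fun t : ℝ => t ^ r) (star y * y)) + δ ^ r)
      (nhdsWithin 0 (Set.Ioi 0)) (nhds (l * T (cfc (fun t : ℝ => t ^ r) (star x * x)) +
        m * T (cfc (fun t : ℝ => t ^ r) (star y * y)) + 0 ^ r)) :=
    Filter.Tendsto.mono_left (Continuous.tendsto (by fun_prop) 0) nhdsWithin_le_nhds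
  rw [Real.zero_rpow hr0.ne', add_zero] at hlim
  exact ge_of_tendsto hlim (Filter.eventually_of_mem self_mem_nhdsWithin key)

end IsTracialStateOn

end

/-! ### The norms `τ((x⋆x)^r)^(1/2r)` and Minkowski's inequality. -/

noncomputable section

namespace IsTracialStateOn

variable {A : Type*} [CStarAlgebra A] [PartialOrder A] [StarOrderedRing A]
  {S : StarSubalgebra ℂ A} {T : A →L[ℝ] ℝ}

/-- The quantity `τ ((x⋆ x) ^ r) ^ (1 / 2r)`, which is the `L_{2r}`-norm. -/
def powNorm (T : A →L[ℝ] ℝ) (r : ℝ) (x : A) : ℝ :=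
  T (cfc (fun t : ℝ => t ^ r) (star x * x)) ^ (1 / (2 * r))

lemma cfc_rpow_nonneg (hT : IsTracialStateOn S T) (r : ℝ) (x : A) :
    0 ≤ T (cfc (fun t : ℝ => t ^ r) (star x * x)) :=
  hT.nonneg _ (cfc_nonneg fun _ ht =>
    Real.rpow_nonneg (spectrum_nonneg (star_mul_self_nonneg x) ht) _)

lemma powNorm_nonneg (hT : IsTracialStateOn S T) (r : ℝ) (x : A) : 0 ≤ powNorm T r x :=
  Real.rpow_nonneg (hT.cfc_rpow_nonneg r x) _

lemma powNorm_le_norm (hT : IsTracialStateOn S T) {r : ℝ} (hr : 1 / 2 ≤ r) (x : A) :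
    powNorm T r x ≤ ‖x‖ := by
  have hr0 : 0 < r := by linarith
  have hx0 := star_mul_self_nonneg x
  have hc1 : Continuous fun t : ℝ => t ^ r := Real.continuous_rpow_const hr0.le
  have h1 : cfc (fun t : ℝ => t ^ r) (star x * x) ≤ algebraMap ℝ A (‖x‖ ^ (2 * r)) := by
    refine cfc_le_algebraMap _ _ _ (fun t ht => ?_) hc1.continuousOn
    have ht0 := spectrum_nonneg hx0 ht
    have ht1 : t ≤ ‖x‖ ^ 2 := by
      -- The normalisation `T 1 = 1` excludes the zero algebra.
      have : Nontrivial A := ⟨0, 1, fun h => by simpa [← h] using hT.map_one⟩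
      have := spectrum.norm_le_norm_of_mem ht
      rw [CStarRing.norm_star_mul_self, Real.norm_of_nonneg ht0] at this
      linarith
    rw [Real.rpow_mul (norm_nonneg x), Real.rpow_two]
    gcongr
  have h2 := hT.mono h1
  rw [Algebra.algebraMap_eq_smul_one, map_smul, hT.map_one, smul_eq_mul, mul_one] at h2
  calc powNorm T r x ≤ (‖x‖ ^ (2 * r)) ^ (1 / (2 * r)) :=
        Real.rpow_le_rpow (hT.cfc_rpow_nonneg r x) h2 (by positivity)
    _ = ‖x‖ := by
        rw [← Real.rpow_mul (norm_nonneg x), mul_one_div_cancel (by positivity), Real.rpow_one]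

lemma cfc_rpow_smul (T : A →L[ℝ] ℝ) {r : ℝ} (hr : 0 < r) (c : ℂ) (x : A) :
    T (cfc (fun t : ℝ => t ^ r) (star (c • x) * (c • x))) =
      ‖c‖ ^ (2 * r) * T (cfc (fun t : ℝ => t ^ r) (star x * x)) := by
  have hx0 := star_mul_self_nonneg x
  have hc1 : Continuous fun t : ℝ => t ^ r := Real.continuous_rpow_const hr.le
  have e1 : star (c • x) * (c • x) = (‖c‖ ^ 2 : ℝ) • (star x * x) := by
    rw [star_smul, smul_mul_smul_comm, Complex.star_def, ← Complex.normSq_eq_conj_mul_self,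
      Complex.normSq_eq_norm_sq, Complex.coe_smul]
  rw [e1, ← cfc_comp_smul _ _ _ hc1.continuousOn (.of_nonneg hx0)]
  have e2 : cfc (fun t : ℝ => ((‖c‖ ^ 2 : ℝ) • t) ^ r) (star x * x) =
      cfc (fun t : ℝ => ‖c‖ ^ (2 * r) * t ^ r) (star x * x) := by
    refine cfc_congr fun t ht => ?_
    simp only [smul_eq_mul]
    rw [Real.mul_rpow (by positivity) (spectrum_nonneg hx0 ht), Real.rpow_mul (norm_nonneg c),
      Real.rpow_two]
  rw [e2, cfc_const_mul _ _ _ hc1.continuousOn, map_smul, smul_eq_mul]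

lemma powNorm_smul (hT : IsTracialStateOn S T) {r : ℝ} (hr : 0 < r) (c : ℂ) (x : A) :
    powNorm T r (c • x) = ‖c‖ * powNorm T r x := by
  rw [powNorm, cfc_rpow_smul T hr, Real.mul_rpow (by positivity) (hT.cfc_rpow_nonneg r x),
    ← Real.rpow_mul (norm_nonneg c), mul_one_div_cancel (by positivity), Real.rpow_one, powNorm]

lemma cfc_rpow_convex (hT : IsTracialStateOn S T) {r : ℝ} (hr : 1 / 2 ≤ r)
    {x y : A} (hx : x ∈ S) (hy : y ∈ S) {l m : ℝ} (hl : 0 ≤ l) (hm : 0 ≤ m) (hlm : l + m = 1) :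
    T (cfc (fun t : ℝ => t ^ r) (star (l • x + m • y) * (l • x + m • y))) ≤
      l * T (cfc (fun t : ℝ => t ^ r) (star x * x)) +
        m * T (cfc (fun t : ℝ => t ^ r) (star y * y)) := by
  rcases le_or_gt 1 r with h | h
  · exact hT.star_mul_self_rpow_convex_of_one_le h hx hy hl hm hlm
  · exact hT.star_mul_self_rpow_convex_of_lt_one hr h hx hy hl hm hlm

/-- Minkowski's inequality. -/
theorem powNorm_add_le (hT : IsTracialStateOn S T) {r : ℝ} (hr : 1 / 2 ≤ r)
    {x y : A} (hx : x ∈ S) (hy : y ∈ S) :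
    powNorm T r (x + y) ≤ powNorm T r x + powNorm T r y := by
  have hr0 : 0 < r := by linarith
  have hpow : ∀ z, powNorm T r z ^ (2 * r) = T (cfc (fun t : ℝ => t ^ r) (star z * z)) := by
    intro z
    rw [powNorm, ← Real.rpow_mul (hT.cfc_rpow_nonneg r z), one_div_mul_cancel (by positivity),
      Real.rpow_one]
  have hunit : ∀ z (a : ℝ), 0 < a → powNorm T r z ≤ a →
      T (cfc (fun t : ℝ => t ^ r) (star (a⁻¹ • z) * (a⁻¹ • z))) ≤ 1 := by
    intro z a ha hza
    have h1 := hT.powNorm_smul hr0 ((a⁻¹ : ℝ) : ℂ) z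
    rw [Complex.coe_smul, Complex.norm_real, Real.norm_of_nonneg (by positivity)] at h1
    rw [← hpow, h1]
    refine Real.rpow_le_one (_root_.mul_nonneg (by positivity) (hT.powNorm_nonneg r z)) ?_
      (by positivity)
    rw [inv_mul_le_iff₀ ha]
    linarith
  refine le_of_forall_pos_le_add fun ε hε => ?_
  -- The `ε / 2` allows division by `a` and `b` even when a norm vanishes. Then `(x + y)/(a + b)` is
  -- a convex combination of `x/a` and `y/b`, which lie in the unit ball.
  set a := powNorm T r x + ε / 2 with ha
  set b := powNorm T r y + ε / 2 with hb
  have ha0 : 0 < a := by have := hT.powNorm_nonneg r x; positivity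
  have hb0 : 0 < b := by have := hT.powNorm_nonneg r y; positivity
  have hab : 0 < a + b := by positivity
  have h1 := hT.cfc_rpow_convex hr (smul_mem_real hx a⁻¹) (smul_mem_real hy b⁻¹)
    (l := a / (a + b)) (m := b / (a + b)) (by positivity) (by positivity) (by field_simp)
  have e1 : (a / (a + b)) • a⁻¹ • x + (b / (a + b)) • b⁻¹ • y = (a + b)⁻¹ • (x + y) := by
    rw [smul_smul, smul_smul, smul_add]
    congr 2 <;> field_simp
  have h2 := hunit x a ha0 (by linarith)
  have h3 := hunit y b hb0 (by linarith)
  rw [e1, ← hpow] at h1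
  have h4 : powNorm T r ((a + b)⁻¹ • (x + y)) ^ (2 * r) ≤ 1 := by
    calc _ ≤ _ := h1
      _ ≤ a / (a + b) * 1 + b / (a + b) * 1 := by gcongr
      _ = 1 := by field_simp
  have h5 : powNorm T r ((a + b)⁻¹ • (x + y)) ≤ 1 := by
    by_contra! h
    exact absurd h4 (not_le.2 (Real.one_lt_rpow h (by positivity)))
  have h6 := hT.powNorm_smul hr0 (((a + b)⁻¹ : ℝ) : ℂ) (x + y)
  rw [Complex.coe_smul, Complex.norm_real, Real.norm_of_nonneg (by positivity)] at h6
  rw [h6, inv_mul_le_iff₀ hab] at h5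
  linarith

end IsTracialStateOn

end

noncomputable section

namespace QuantumTorus

open scoped ENNReal NNReal

variable {d : ℕ}

/-! ### Noncommutative `L_p`-norms of a tracial vector state -/

section VectorState

variable {H : Type*} [NormedAddCommGroup H] [InnerProductSpace ℂ H] [CompleteSpace H]

/-- The real part of the vector state `x ↦ ⟨x v, v⟩`. -/
def vectorState (v : H) : (H →L[ℂ] H) →L[ℝ] ℝ :=
  Complex.reCLM.comp (((innerSL ℂ v).comp (ContinuousLinearMap.apply ℂ H v)).restrictScalars ℝ)

omit [CompleteSpace H] in
lemma vectorState_apply (v : H) (x : H →L[ℂ] H) : vectorState v x = (inner ℂ v (x v)).re := rfl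

/-- The unit vector `v` defines a tracial state on the closed star algebra `S`. -/
structure IsTracialVector (S : StarSubalgebra ℂ (H →L[ℂ] H)) (v : H) : Prop where
  isClosed : IsClosed (S : Set (H →L[ℂ] H))
  comm : ∀ x ∈ S, ∀ y ∈ S, inner ℂ v ((x * y) v) = inner ℂ v ((y * x) v)
  norm_eq_one : ‖v‖ = 1

lemma IsTracialVector.isTracialStateOn {S : StarSubalgebra ℂ (H →L[ℂ] H)} {v : H}
    (h : IsTracialVector S v) : IsTracialStateOn S (vectorState v) where
  isClosed := h.isClosed
  nonneg x hx := by
    rw [ContinuousLinearMap.nonneg_iff_isPositive] at hx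
    exact (Complex.le_def.1 (hx.inner_nonneg_right v)).1
  comm x hx y hy := congrArg Complex.re (h.comm x hx y hy)
  map_one := by
    rw [vectorState_apply, one_apply_eq_self, inner_self_eq_norm_sq_to_K,
      h.norm_eq_one]
    simp

/-- The `L_p`-norm of a vector state. -/
def vectorLpNorm (v : H) (p : ℝ≥0∞) (x : H →L[ℂ] H) : ℝ :=
  if p = ∞ then ‖x‖ else (inner ℂ v (absPow x p.toReal v)).re ^ (1 / p.toReal)

lemma absPow_eq_cfc (x : H →L[ℂ] H) {p : ℝ} (hp : 0 ≤ p) :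
    absPow x p = cfc (fun t : ℝ => t ^ (p / 2)) (star x * x) := by
  have hx := star_mul_self_nonneg x
  rw [absPow, CFC.abs, CFC.sqrt_eq_rpow, CFC.rpow_rpow_of_exponent_nonneg _ _ _ (by norm_num) hp,
    CFC.rpow_eq_cfc_real hx, one_div_mul_eq_div]

lemma vectorLpNorm_top (v : H) (x : H →L[ℂ] H) : vectorLpNorm v ∞ x = ‖x‖ := if_pos rfl

/-- Since `|x|^p = (x⋆x)^(p/2)`, the exponent is `r = p/2`, and `p ≥ 1` becomes `r ≥ 1/2`. -/
lemma vectorLpNorm_eq_powNorm (v : H) {p : ℝ≥0∞} (hp : p ≠ ∞) (x : H →L[ℂ] H) :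
    vectorLpNorm v p x = IsTracialStateOn.powNorm (vectorState v) (p.toReal / 2) x := by
  rw [vectorLpNorm, if_neg hp, absPow_eq_cfc x ENNReal.toReal_nonneg, IsTracialStateOn.powNorm,
    mul_div_cancel₀ _ two_ne_zero, vectorState_apply]

lemma half_le_toReal {p : ℝ≥0∞} (hp : p ≠ ∞) (h : 1 ≤ p) : 1 / 2 ≤ p.toReal / 2 := by
  have := (ENNReal.toReal_le_toReal ENNReal.one_ne_top hp).2 h
  rw [ENNReal.toReal_one] at this
  linarith

namespace IsTracialVector

variable {S : StarSubalgebra ℂ (H →L[ℂ] H)} {v : H}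

lemma lpNorm_nonneg (hv : IsTracialVector S v) (p : ℝ≥0∞) (x : H →L[ℂ] H) :
    0 ≤ vectorLpNorm v p x := by
  by_cases hp : p = ∞
  · rw [hp, vectorLpNorm_top]; exact norm_nonneg x
  · rw [vectorLpNorm_eq_powNorm v hp]
    exact hv.isTracialStateOn.powNorm_nonneg _ _

lemma lpNorm_le_norm (hv : IsTracialVector S v) {p : ℝ≥0∞} (h : 1 ≤ p) (x : H →L[ℂ] H) :
    vectorLpNorm v p x ≤ ‖x‖ := by
  by_cases hp : p = ∞
  · rw [hp, vectorLpNorm_top]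
  · rw [vectorLpNorm_eq_powNorm v hp]
    exact hv.isTracialStateOn.powNorm_le_norm (half_le_toReal hp h) _

lemma lpNorm_smul (hv : IsTracialVector S v) {p : ℝ≥0∞} (h : 1 ≤ p) (c : ℂ) (x : H →L[ℂ] H) :
    vectorLpNorm v p (c • x) = ‖c‖ * vectorLpNorm v p x := by
  by_cases hp : p = ∞
  · rw [hp, vectorLpNorm_top, vectorLpNorm_top, norm_smul]
  · rw [vectorLpNorm_eq_powNorm v hp, vectorLpNorm_eq_powNorm v hp]
    have := half_le_toReal hp h
    exact hv.isTracialStateOn.powNorm_smul (by linarith) _ _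

lemma lpNorm_real_smul (hv : IsTracialVector S v) {p : ℝ≥0∞} (h : 1 ≤ p) {c : ℝ} (hc : 0 ≤ c)
    (x : H →L[ℂ] H) : vectorLpNorm v p (c • x) = c * vectorLpNorm v p x := by
  rw [← Complex.coe_smul, hv.lpNorm_smul h, Complex.norm_real, Real.norm_of_nonneg hc]

lemma lpNorm_add_le (hv : IsTracialVector S v) {p : ℝ≥0∞} (h : 1 ≤ p)
    {x y : H →L[ℂ] H} (hx : x ∈ S) (hy : y ∈ S) :
    vectorLpNorm v p (x + y) ≤ vectorLpNorm v p x + vectorLpNorm v p y := by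
  by_cases hp : p = ∞
  · rw [hp, vectorLpNorm_top, vectorLpNorm_top, vectorLpNorm_top]; exact norm_add_le x y
  · rw [vectorLpNorm_eq_powNorm v hp, vectorLpNorm_eq_powNorm v hp, vectorLpNorm_eq_powNorm v hp]
    exact hv.isTracialStateOn.powNorm_add_le (half_le_toReal hp h) hx hy

end IsTracialVector

/-- Conjugation by a unitary is a star isomorphism, so it commutes with functional calculus; it
preserves the state because the unitary fixes `v`. -/
lemma vectorLpNorm_conj {v : H} {p : ℝ≥0∞} (h : 1 ≤ p) (W : H ≃ₗᵢ[ℂ] H) (hW : W.symm v = v)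
    (x : H →L[ℂ] H) : vectorLpNorm v p (W.conjStarAlgEquiv x) = vectorLpNorm v p x := by
  have hiso := NonUnitalStarAlgHom.isometry (W.conjStarAlgEquiv) W.conjStarAlgEquiv.injective
  by_cases hp : p = ∞
  · rw [hp, vectorLpNorm_top, vectorLpNorm_top]
    exact NonUnitalStarAlgHom.norm_map W.conjStarAlgEquiv W.conjStarAlgEquiv.injective x
  · have hr := half_le_toReal hp h
    have hc : Continuous fun t : ℝ => t ^ (p.toReal / 2) :=
      Real.continuous_rpow_const (by linarith)
    have hs : IsSelfAdjoint (star x * x) := .star_mul_self x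
    have hst : ∀ y : H →L[ℂ] H, vectorState v (W.conjStarAlgEquiv y) = vectorState v y := by
      intro y
      change (inner ℂ v (W (y (W.symm v)))).re = _
      rw [hW, ← W.symm.inner_map_map, hW, LinearIsometryEquiv.symm_apply_apply]
      rfl
    rw [vectorLpNorm_eq_powNorm v hp, vectorLpNorm_eq_powNorm v hp, IsTracialStateOn.powNorm,
      IsTracialStateOn.powNorm, ← map_star, ← map_mul,
      ← StarAlgHomClass.map_cfc (S := ℂ) W.conjStarAlgEquiv _ _ hc.continuousOn hiso.continuous hs
        (hs.map _), hst]

end VectorState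

/-! ### The algebra of the quantum torus and its noncommutative `L_p`-norms -/

lemma monomial_mul (θ : Matrix (Fin d) (Fin d) ℝ) (m n : Fin d → ℤ) :
    monomial θ m * monomial θ n =
      (Real.fourierChar (twist θ m n) : ℂ) • monomial θ (m + n) := by
  refine ContinuousLinearMap.ext fun f => ?_
  change monomialUnitary θ m (monomialUnitary θ n f) =
    (Real.fourierChar (twist θ m n) : ℂ) • monomialUnitary θ (m + n) f
  rw [monomialUnitary_eq_weyl, monomialUnitary_eq_weyl, monomialUnitary_eq_weyl, weyl_weyl_apply]

lemma monomial_zero (θ : Matrix (Fin d) (Fin d) ℝ) : monomial θ 0 = 1 := by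
  refine ContinuousLinearMap.ext fun f => ?_
  change monomialUnitary θ 0 f = f
  rw [monomialUnitary_eq_weyl, weyl_zero]
  rfl

/-- The star algebra of the polynomials `∑ a_m U^m`. -/
def polyAlgebra (θ : Matrix (Fin d) (Fin d) ℝ) : StarSubalgebra ℂ (GNS d →L[ℂ] GNS d) where
  carrier := Submodule.span ℂ (Set.range (monomial θ))
  mul_mem' {x y} hx hy := by
    refine Submodule.span_induction₂ (p := fun x y _ _ =>
      x * y ∈ Submodule.span ℂ (Set.range (monomial θ))) ?_ ?_ ?_ ?_ ?_ ?_ ?_ hx hy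
    · rintro _ _ ⟨m, rfl⟩ ⟨n, rfl⟩
      rw [monomial_mul]
      exact Submodule.smul_mem _ _ (Submodule.subset_span ⟨_, rfl⟩)
    · intro y _; simp
    · intro x _; simp
    · intro x y z _ _ _ h h'; rw [add_mul]; exact add_mem h h'
    · intro x y z _ _ _ h h'; rw [mul_add]; exact add_mem h h'
    · intro c x y _ _ h; rw [smul_mul_assoc]; exact Submodule.smul_mem _ _ h
    · intro c x y _ _ h; rw [mul_smul_comm]; exact Submodule.smul_mem _ _ h
  add_mem' hx hy := add_mem hx hy
  algebraMap_mem' c := by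
    rw [Algebra.algebraMap_eq_smul_one, ← monomial_zero θ]
    exact Submodule.smul_mem _ _ (Submodule.subset_span ⟨_, rfl⟩)
  star_mem' {x} hx := by
    refine Submodule.span_induction (p := fun x _ =>
      star x ∈ Submodule.span ℂ (Set.range (monomial θ))) ?_ ?_ ?_ ?_ hx
    · rintro _ ⟨m, rfl⟩
      rw [star_monomial]
      exact Submodule.smul_mem _ _ (Submodule.subset_span ⟨_, rfl⟩)
    · simp
    · intro x y _ _ h h'; rw [star_add]; exact add_mem h h'
    · intro c x _ h; rw [star_smul]; exact Submodule.smul_mem _ _ h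

/-- The C⋆-algebra of the quantum torus. -/
def torusAlgebra (θ : Matrix (Fin d) (Fin d) ℝ) : StarSubalgebra ℂ (GNS d →L[ℂ] GNS d) :=
  (polyAlgebra θ).topologicalClosure

lemma monomial_mem_torusAlgebra (θ : Matrix (Fin d) (Fin d) ℝ) (m : Fin d → ℤ) :
    monomial θ m ∈ torusAlgebra θ :=
  (polyAlgebra θ).le_topologicalClosure
    (Submodule.subset_span ⟨m, rfl⟩ : monomial θ m ∈ Submodule.span ℂ (Set.range (monomial θ)))

/-- The trace as a continuous linear functional. -/
def traceCLM (d : ℕ) : (GNS d →L[ℂ] GNS d) →L[ℂ] ℂ :=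
  (innerSL ℂ (lp.single 2 (0 : Fin d → ℤ) (1 : ℂ) : GNS d)).comp
    (ContinuousLinearMap.apply ℂ (GNS d) (lp.single 2 (0 : Fin d → ℤ) (1 : ℂ) : GNS d))

lemma traceCLM_apply (x : GNS d →L[ℂ] GNS d) : traceCLM d x = trace x := rfl

lemma traceCLM_monomial (θ : Matrix (Fin d) (Fin d) ℝ) (m : Fin d → ℤ) :
    traceCLM d (monomial θ m) = if m = 0 then 1 else 0 := by
  rw [traceCLM_apply, trace, lp.inner_single_left, monomial_single]
  simp [eq_comm]

/-- For monomials both traces vanish unless `n = -m`, where bilinearity gives `twist(m,-m) =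
twist(-m,m)`, so the two phases agree. Linearity, then density and continuity in each factor, give
the rest. -/
lemma traceCLM_comm (θ : Matrix (Fin d) (Fin d) ℝ) {x y : GNS d →L[ℂ] GNS d}
    (hx : x ∈ torusAlgebra θ) (hy : y ∈ torusAlgebra θ) :
    traceCLM d (x * y) = traceCLM d (y * x) := by
  have hpoly : ∀ x ∈ polyAlgebra θ, ∀ y ∈ polyAlgebra θ,
      traceCLM d (x * y) = traceCLM d (y * x) := by
    intro x hx y hy
    refine Submodule.span_induction₂ (s := Set.range (monomial θ)) (t := Set.range (monomial θ))
      (p := fun x y _ _ => traceCLM d (x * y) = traceCLM d (y * x)) ?_ ?_ ?_ ?_ ?_ ?_ ?_ hx hy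
    · rintro _ _ ⟨m, rfl⟩ ⟨n, rfl⟩
      rw [monomial_mul, monomial_mul, map_smul, map_smul, traceCLM_monomial, traceCLM_monomial,
        add_comm n m]
      by_cases h : m + n = 0
      · obtain rfl : n = -m := (neg_eq_of_add_eq_zero_right h).symm
        have h1 := twist_add_right θ m m (-m)
        have h2 := twist_add_left θ m (-m) m
        rw [add_neg_cancel, twist_eq_zero θ _ _ (by simp)] at h1 h2
        rw [show twist θ m (-m) = twist θ (-m) m by linarith]
      · simp [h]
    · intro y _; simp
    · intro x _; simp
    · intro x y z _ _ _ h h'; rw [add_mul, mul_add, map_add, map_add, h, h']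
    · intro x y z _ _ _ h h'; rw [add_mul, mul_add, map_add, map_add, h, h']
    · intro c x y _ _ h; rw [smul_mul_assoc, mul_smul_comm, map_smul, map_smul, h]
    · intro c x y _ _ h; rw [smul_mul_assoc, mul_smul_comm, map_smul, map_smul, h]
  have h1 : ∀ x ∈ polyAlgebra θ, ∀ y ∈ torusAlgebra θ,
      traceCLM d (x * y) = traceCLM d (y * x) := by
    intro x hx y hy
    exact closure_minimal (t := {y | traceCLM d (x * y) = traceCLM d (y * x)}) (hpoly x hx)
      (isClosed_eq (by fun_prop) (by fun_prop)) hy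
  exact closure_minimal (t := {x | traceCLM d (x * y) = traceCLM d (y * x)})
    (fun x hx => h1 x hx y hy) (isClosed_eq (by fun_prop) (by fun_prop)) hx

/-- The vector `δ_0` of the trace. -/
abbrev vacuum (d : ℕ) : GNS d := lp.single 2 (0 : Fin d → ℤ) (1 : ℂ)

lemma isTracialVector_vacuum (θ : Matrix (Fin d) (Fin d) ℝ) :
    IsTracialVector (torusAlgebra θ) (vacuum d) where
  isClosed := (polyAlgebra θ).isClosed_topologicalClosure
  comm _ hx _ hy := traceCLM_comm θ hx hy
  norm_eq_one := by rw [lp.norm_single (by norm_num), norm_one]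

lemma lpNorm_nonneg (p : ℝ≥0∞) (x : GNS d →L[ℂ] GNS d) : 0 ≤ lpNorm p x :=
  -- The norm depends only on the vector `δ_0` and not on `θ`, so the algebra with `θ = 0` serves
  -- wherever membership plays no role.
  (isTracialVector_vacuum 0).lpNorm_nonneg p x

lemma lpNorm_le_norm {p : ℝ≥0∞} (h : 1 ≤ p) (x : GNS d →L[ℂ] GNS d) : lpNorm p x ≤ ‖x‖ :=
  (isTracialVector_vacuum 0).lpNorm_le_norm h x

lemma lpNorm_smul {p : ℝ≥0∞} (h : 1 ≤ p) (c : ℂ) (x : GNS d →L[ℂ] GNS d) :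
    lpNorm p (c • x) = ‖c‖ * lpNorm p x :=
  (isTracialVector_vacuum 0).lpNorm_smul h c x

lemma lpNorm_real_smul {p : ℝ≥0∞} (h : 1 ≤ p) {c : ℝ} (hc : 0 ≤ c) (x : GNS d →L[ℂ] GNS d) :
    lpNorm p (c • x) = c * lpNorm p x :=
  (isTracialVector_vacuum 0).lpNorm_real_smul h hc x

lemma lpNorm_add_le (θ : Matrix (Fin d) (Fin d) ℝ) {p : ℝ≥0∞} (h : 1 ≤ p)
    {x y : GNS d →L[ℂ] GNS d} (hx : x ∈ torusAlgebra θ) (hy : y ∈ torusAlgebra θ) :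
    lpNorm p (x + y) ≤ lpNorm p x + lpNorm p y :=
  (isTracialVector_vacuum θ).lpNorm_add_le h hx hy

lemma lpNorm_zero {p : ℝ≥0∞} (h : 1 ≤ p) : lpNorm p (0 : GNS d →L[ℂ] GNS d) = 0 :=
  le_antisymm (by simpa using lpNorm_le_norm h (0 : GNS d →L[ℂ] GNS d)) (lpNorm_nonneg _ _)

lemma lpNorm_sum_le (θ : Matrix (Fin d) (Fin d) ℝ) {p : ℝ≥0∞} (h : 1 ≤ p) {ι : Type*}
    (s : Finset ι) (x : ι → GNS d →L[ℂ] GNS d) (hx : ∀ i ∈ s, x i ∈ torusAlgebra θ) :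
    lpNorm p (∑ i ∈ s, x i) ≤ ∑ i ∈ s, lpNorm p (x i) := by
  classical
  induction s using Finset.induction_on with
  | empty => simp [lpNorm_zero h]
  | insert i s hi ih =>
    have hx' : ∀ j ∈ s, x j ∈ torusAlgebra θ := fun j hj => hx j (Finset.mem_insert_of_mem hj)
    rw [Finset.sum_insert hi, Finset.sum_insert hi]
    refine (lpNorm_add_le θ h (hx i (Finset.mem_insert_self _ _)) (sum_mem hx')).trans ?_
    gcongr
    exact ih hx'

/-- Minkowski's inequality in the form needed for averaging operators. Membership in the algebra is
part of the set because the trace is only known to be tracial there. -/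
lemma convex_lpNorm_le (θ : Matrix (Fin d) (Fin d) ℝ) {p : ℝ≥0∞} (h : 1 ≤ p) (C : ℝ) :
    Convex ℝ {x : GNS d →L[ℂ] GNS d | x ∈ torusAlgebra θ ∧ lpNorm p x ≤ C} := by
  rintro x ⟨hx, hxC⟩ y ⟨hy, hyC⟩ a b ha hb hab
  have hx' := IsTracialStateOn.smul_mem_real hx a
  have hy' := IsTracialStateOn.smul_mem_real hy b
  refine ⟨add_mem hx' hy', (lpNorm_add_le θ h hx' hy').trans ?_⟩
  refine (add_le_add (lpNorm_real_smul h ha x).le (lpNorm_real_smul h hb y).le).trans ?_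
  calc a * lpNorm p x + b * lpNorm p y ≤ a * C + b * C := by gcongr
    _ = C := by rw [← add_mul, hab, one_mul]

/-- The operator norm dominates the `L_p`-norm, so by Minkowski an approximation in operator norm
changes the `L_p`-norm by at most the same error. -/
lemma isClosed_lpNorm_le (θ : Matrix (Fin d) (Fin d) ℝ) {p : ℝ≥0∞} (h : 1 ≤ p) (C : ℝ) :
    IsClosed {x : GNS d →L[ℂ] GNS d | x ∈ torusAlgebra θ ∧ lpNorm p x ≤ C} := by
  refine isClosed_of_closure_subset fun x hx => ?_
  have hxS : x ∈ torusAlgebra θ :=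
    closure_minimal (fun y hy => hy.1) (isTracialVector_vacuum θ).isClosed hx
  refine ⟨hxS, le_of_forall_pos_le_add fun ε hε => ?_⟩
  obtain ⟨y, ⟨hyS, hyC⟩, hxy⟩ := Metric.mem_closure_iff.1 hx ε hε
  rw [dist_eq_norm] at hxy
  calc lpNorm p x = lpNorm p (y + (x - y)) := by rw [add_sub_cancel]
    _ ≤ lpNorm p y + lpNorm p (x - y) := lpNorm_add_le θ h hyS (sub_mem hxS hyS)
    _ ≤ C + ε := add_le_add hyC ((lpNorm_le_norm h _).trans hxy.le)

/-- The unitary `δ_n ↦ χ(n) δ_n` for a character `χ` of `ℤᵈ`. -/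
def rotation (χ : AddChar (Fin d → ℤ) Circle) : GNS d ≃ₗᵢ[ℂ] GNS d := weightedShift χ 0

lemma rotation_apply (χ : AddChar (Fin d → ℤ) Circle) (f : GNS d) (n : Fin d → ℤ) :
    rotation χ f n = (χ n : ℂ) * f n := by
  rw [rotation, weightedShift_apply, sub_zero]

lemma rotation_symm_apply (χ : AddChar (Fin d → ℤ) Circle) (f : GNS d) (n : Fin d → ℤ) :
    (rotation χ).symm f n = ((χ n)⁻¹ : Circle) * f n := by
  change ((χ (n + 0))⁻¹ : Circle) * f (n + 0) = _
  rw [add_zero]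

lemma rotation_symm_single (χ : AddChar (Fin d → ℤ) Circle) :
    (rotation χ).symm (lp.single 2 (0 : Fin d → ℤ) (1 : ℂ)) = lp.single 2 (0 : Fin d → ℤ) (1 : ℂ) := by
  ext n
  rw [rotation_symm_apply, lp.single_apply]
  by_cases hn : n = 0
  · subst hn; simp
  · simp [hn]

/-- The monomial shifts `δ_{n-m}` to `δ_n` up to a phase, and the diagonal unitaries contribute
`χ(n)/χ(n-m) = χ(m)`. This is the dual action of the torus. -/
lemma conj_rotation_monomial (θ : Matrix (Fin d) (Fin d) ℝ) (χ : AddChar (Fin d → ℤ) Circle)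
    (m : Fin d → ℤ) :
    (rotation χ).conjStarAlgEquiv (monomial θ m) = (χ m : ℂ) • monomial θ m := by
  refine ContinuousLinearMap.ext fun f => ?_
  ext n
  change rotation χ (monomial θ m ((rotation χ).symm f)) n = (χ m : ℂ) * monomial θ m f n
  rw [rotation_apply, monomial_apply, monomial_apply, rotation_symm_apply, sub_eq_add_neg,
    AddChar.map_add_eq_mul, AddChar.map_neg_eq_inv]
  have h : (χ n : ℂ) ≠ 0 := Circle.coe_ne_zero _
  push_cast [mul_inv_rev, inv_inv]
  field_simp

lemma lpNorm_conj_rotation {p : ℝ≥0∞} (h : 1 ≤ p) (χ : AddChar (Fin d → ℤ) Circle)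
    (x : GNS d →L[ℂ] GNS d) : lpNorm p ((rotation χ).conjStarAlgEquiv x) = lpNorm p x :=
  vectorLpNorm_conj h (rotation χ) (rotation_symm_single χ) x

end QuantumTorus

end

noncomputable section

namespace QuantumTorus

open scoped ENNReal NNReal SchwartzMap FourierTransform ContDiff
open MeasureTheory

variable {d : ℕ}

/-! ### Fourier multipliers on `L_p` -/

/-- The polynomial `∑_{m ∈ F} a_m U^m`. -/
def trigPoly (θ : Matrix (Fin d) (Fin d) ℝ) (F : Finset (Fin d → ℤ)) (a : (Fin d → ℤ) → ℂ) :
    GNS d →L[ℂ] GNS d :=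
  ∑ m ∈ F, a m • monomial θ m

lemma trigPoly_mem (θ : Matrix (Fin d) (Fin d) ℝ) (F : Finset (Fin d → ℤ))
    (a : (Fin d → ℤ) → ℂ) : trigPoly θ F a ∈ torusAlgebra θ :=
  sum_mem fun m _ => SMulMemClass.smul_mem _ (monomial_mem_torusAlgebra θ m)

lemma trigPoly_congr (θ : Matrix (Fin d) (Fin d) ℝ) {F : Finset (Fin d → ℤ)}
    {a b : (Fin d → ℤ) → ℂ} (h : ∀ m ∈ F, a m = b m) : trigPoly θ F a = trigPoly θ F b :=
  Finset.sum_congr rfl fun m hm => by rw [h m hm]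

/-- The symbol `s` defines a Fourier multiplier of norm at most `C` on the polynomials with
frequencies in `F`, for all `L_p`-norms. -/
def IsLpMultiplier (θ : Matrix (Fin d) (Fin d) ℝ) (F : Finset (Fin d → ℤ))
    (s : (Fin d → ℤ) → ℂ) (C : ℝ) : Prop :=
  ∀ p : ℝ≥0∞, 1 ≤ p → ∀ a : (Fin d → ℤ) → ℂ,
    lpNorm p (trigPoly θ F fun m => s m * a m) ≤ C * lpNorm p (trigPoly θ F a)

namespace IsLpMultiplier

variable {θ : Matrix (Fin d) (Fin d) ℝ} {F : Finset (Fin d → ℤ)} {s t : (Fin d → ℤ) → ℂ}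
  {C D : ℝ}

lemma congr (hs : IsLpMultiplier θ F s C) (h : ∀ m ∈ F, s m = t m) : IsLpMultiplier θ F t C := by
  intro p hp a
  rw [trigPoly_congr θ (b := fun m => s m * a m) fun m hm => by rw [h m hm]]
  exact hs p hp a

lemma mono (hs : IsLpMultiplier θ F s C) (h : C ≤ D) : IsLpMultiplier θ F s D :=
  fun p hp a => (hs p hp a).trans (mul_le_mul_of_nonneg_right h (lpNorm_nonneg _ _))

lemma mul (hs : IsLpMultiplier θ F s C) (ht : IsLpMultiplier θ F t D) (hC : 0 ≤ C) :
    IsLpMultiplier θ F (fun m => s m * t m) (C * D) := by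
  intro p hp a
  have h1 := hs p hp fun m => t m * a m
  simp only [← mul_assoc] at h1
  refine h1.trans ?_
  rw [mul_assoc]
  exact mul_le_mul_of_nonneg_left (ht p hp a) hC

lemma const (c : ℂ) : IsLpMultiplier θ F (fun _ => c) ‖c‖ := by
  intro p hp a
  have : trigPoly θ F (fun m => c * a m) = c • trigPoly θ F a := by
    simp only [trigPoly, Finset.smul_sum, smul_smul]
  rw [this, lpNorm_smul hp]

lemma const_mul (hs : IsLpMultiplier θ F s C) (c : ℂ) :
    IsLpMultiplier θ F (fun m => c * s m) (‖c‖ * C) :=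
  (const c).mul hs (norm_nonneg c)

lemma sum {ι : Type*} (u : Finset ι) {s : ι → (Fin d → ℤ) → ℂ} {C : ι → ℝ}
    (h : ∀ i ∈ u, IsLpMultiplier θ F (s i) (C i)) :
    IsLpMultiplier θ F (fun m => ∑ i ∈ u, s i m) (∑ i ∈ u, C i) := by
  intro p hp a
  have : trigPoly θ F (fun m => (∑ i ∈ u, s i m) * a m) =
      ∑ i ∈ u, trigPoly θ F fun m => s i m * a m := by
    simp only [trigPoly, Finset.sum_mul, Finset.sum_smul]
    exact Finset.sum_comm
  rw [this, Finset.sum_mul]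
  exact (lpNorm_sum_le θ hp u _ fun i _ => trigPoly_mem θ F _).trans
    (Finset.sum_le_sum fun i hi => h i hi p hp a)

lemma prod {ι : Type*} (u : Finset ι) {s : ι → (Fin d → ℤ) → ℂ} {C : ι → ℝ} (hC : ∀ i, 0 ≤ C i)
    (h : ∀ i ∈ u, IsLpMultiplier θ F (s i) (C i)) :
    IsLpMultiplier θ F (fun m => ∏ i ∈ u, s i m) (∏ i ∈ u, C i) := by
  classical
  induction u using Finset.induction_on with
  | empty => simpa using const (θ := θ) (F := F) (1 : ℂ)
  | insert i u hi ih =>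
    simp only [Finset.prod_insert hi]
    exact (h i (Finset.mem_insert_self _ _)).mul
      (ih fun j hj => h j (Finset.mem_insert_of_mem hj)) (hC i)

/-- As `F` is finite, pointwise convergence of symbols gives operator-norm convergence of the
polynomials, and `L_p`-balls are closed. -/
lemma of_tendsto {s : ℕ → (Fin d → ℤ) → ℂ} (hs : ∀ n, IsLpMultiplier θ F (s n) C)
    (h : ∀ m ∈ F, Filter.Tendsto (fun n => s n m) Filter.atTop (nhds (t m))) :
    IsLpMultiplier θ F t C := by
  intro p hp a
  refine ((isClosed_lpNorm_le θ hp (C * lpNorm p (trigPoly θ F a))).mem_of_tendsto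
    (b := Filter.atTop) (f := fun n => trigPoly θ F fun m => s n m * a m) ?_
      (.of_forall fun n => ⟨trigPoly_mem θ F _, hs n p hp a⟩)).2
  exact tendsto_finsetSum _ fun m hm => ((h m hm).mul_const _).smul_const _

lemma character (χ : AddChar (Fin d → ℤ) Circle) :
    IsLpMultiplier θ F (fun m => (χ m : ℂ)) 1 := by
  intro p hp a
  have : trigPoly θ F (fun m => (χ m : ℂ) * a m) =
      (rotation χ).conjStarAlgEquiv (trigPoly θ F a) := by
    rw [trigPoly, trigPoly, map_sum]
    refine Finset.sum_congr rfl fun m _ => ?_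
    rw [map_smul, conj_rotation_monomial, smul_smul, mul_comm]
  rw [this, lpNorm_conj_rotation hp, one_mul]

/-- Superpositions of characters are multipliers. -/
lemma integral {V : Type*} [MeasurableSpace V] {μ : Measure V} {g : V → ℂ} (hg : Measurable g)
    (hgi : Integrable g μ) (χ : V → AddChar (Fin d → ℤ) Circle)
    (hχ : ∀ m, Measurable fun v => (χ v m : ℂ)) :
    IsLpMultiplier θ F (fun m => ∫ v, g v * χ v m ∂μ) (∫ v, ‖g v‖ ∂μ) := by
  have hm : Measurable fun v => ‖g v‖₊ := hg.nnnorm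
  -- Absorbing `|g|` into a finite measure makes the integral its total mass times an average of
  -- isometric images, up to phases. The average stays in the closed convex `L_p`-ball. Mass zero is
  -- treated apart, since there is nothing to normalise.
  set ν := μ.withDensity fun v => (‖g v‖₊ : ℝ≥0∞) with hν
  have hνr : ν.real Set.univ = ∫ v, ‖g v‖ ∂μ := by
    have h := integral_withDensity_eq_integral_smul (μ := μ) hm (fun _ => (1 : ℝ))
    rw [integral_const] at h
    simpa [NNReal.smul_def] using h
  have hfin : IsFiniteMeasure ν := by
    exact isFiniteMeasure_withDensity hgi.2.ne
  intro p hp a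
  by_cases h0 : ∫ v, ‖g v‖ ∂μ = 0
  · have hg0 : g =ᵐ[μ] 0 := by
      have := (integral_eq_zero_iff_of_nonneg (fun v => norm_nonneg (g v)) hgi.norm).1 h0
      filter_upwards [this] with v hv
      simpa using hv
    have h1 : ∀ m, ∫ v, g v * χ v m ∂μ = 0 := fun m => by
      rw [integral_eq_zero_of_ae]
      filter_upwards [hg0] with v hv
      simp [hv]
    simp [h1, h0, trigPoly, lpNorm_zero hp]
  have hne : NeZero ν := ⟨fun h => h0 (by rw [← hνr, h]; simp)⟩
  set c : V → (Fin d → ℤ) → ℂ := fun v m => (g v / ‖g v‖) * χ v m with hc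
  have hsgn : ∀ v, ‖g v / ‖g v‖‖ ≤ 1 := fun v => by
    rw [norm_div, Complex.norm_real, norm_norm]
    exact div_self_le_one _
  have hcm : ∀ m, Measurable fun v => c v m := fun m =>
    (hg.div (Complex.measurable_ofReal.comp hg.norm)).mul (hχ m)
  have hci : ∀ m, Integrable (fun v => c v m) ν := fun m =>
    Integrable.of_bound (hcm m).aestronglyMeasurable 1 (.of_forall fun v => by
      rw [hc, norm_mul, Circle.norm_coe, mul_one]; exact hsgn v)
  have hint : ∀ m, ∫ v, c v m ∂ν = ∫ v, g v * χ v m ∂μ := fun m => by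
    rw [hν, integral_withDensity_eq_integral_smul hm]
    refine integral_congr_ae (.of_forall fun v => ?_)
    simp only [hc, NNReal.smul_def, coe_nnnorm, Complex.real_smul]
    by_cases hv : g v = 0
    · simp [hv]
    · have : (‖g v‖ : ℂ) ≠ 0 := by simpa using hv
      field_simp
  have hmem := (convex_lpNorm_le θ hp (lpNorm p (trigPoly θ F a))).average_mem (μ := ν)
    (f := fun v => trigPoly θ F fun m => c v m * a m) (isClosed_lpNorm_le θ hp _)
    (.of_forall fun v => ⟨trigPoly_mem θ F _, by
      have h1 := (const (θ := θ) (F := F) (g v / ‖g v‖)).mul (character (χ v)) (norm_nonneg _)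
      refine (h1 p hp a).trans ?_
      rw [mul_one]
      exact mul_le_of_le_one_left (lpNorm_nonneg _ _) (hsgn v)⟩)
    (integrable_finsetSum _ fun m _ => ((hci m).mul_const _).smul_const _)
  have havg : ∫ v, trigPoly θ F (fun m => c v m * a m) ∂ν =
      trigPoly θ F fun m => (∫ v, g v * χ v m ∂μ) * a m := by
    simp only [trigPoly]
    rw [integral_finsetSum _ fun m _ => ((hci m).mul_const _).smul_const _]
    refine Finset.sum_congr rfl fun m _ => ?_
    rw [integral_smul_const, integral_mul_const, hint]
  have h2 := hmem.2
  have hI : 0 < ∫ v, ‖g v‖ ∂μ :=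
    lt_of_le_of_ne (integral_nonneg fun v => norm_nonneg _) (Ne.symm h0)
  rw [average_eq, havg, hνr] at h2
  exact (inv_mul_le_iff₀ hI).1 ((lpNorm_real_smul hp (inv_nonneg.2 hI.le) _).symm.le.trans h2)

/-! ### Sampling smooth functions along affine maps. -/

section Schwartz

variable {V : Type*} [NormedAddCommGroup V] [InnerProductSpace ℝ V] [FiniteDimensional ℝ V]
  [MeasurableSpace V] [BorelSpace V]

/-- Sampling a Schwartz function along an affine map gives a multiplier, with a bound that does not
depend on the affine map. -/
lemma schwartz (Ψ : 𝓢(V, ℂ)) (L : (Fin d → ℤ) →+ V) (v₀ : V) :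
    IsLpMultiplier θ F (fun m => Ψ (v₀ + L m)) (∫ v, ‖(𝓕⁻ Ψ : 𝓢(V, ℂ)) v‖) := by
  set g : 𝓢(V, ℂ) := 𝓕⁻ Ψ with hg
  have hinv : ∀ w, Ψ w = ∫ v, Real.fourierChar (-inner ℝ v w) • g v := fun w => by
    rw [← Real.fourier_eq, ← SchwartzMap.fourier_coe, hg, FourierInvPair.fourier_fourierInv_eq]
  let χ : V → AddChar (Fin d → ℤ) Circle := fun v =>
    { toFun := fun m => Real.fourierChar (-inner ℝ v (L m))
      map_zero_eq_one' := by simp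
      map_add_eq_mul' := fun m n => by
        rw [map_add, inner_add_right, neg_add, AddChar.map_add_eq_mul] }
  have hχ : ∀ m, Measurable fun v => (χ v m : ℂ) := fun m =>
    (continuous_subtype_val.comp (Real.continuous_fourierChar.comp
      (by fun_prop : Continuous fun v : V => -inner ℝ v (L m)))).measurable
  -- The translation `v₀` contributes only a unimodular factor, and `L` enters only through the
  -- characters. Neither affects the `L¹`-norm of the density.
  have hc : Continuous fun v : V => (Real.fourierChar (-inner ℝ v v₀) : ℂ) * g v :=
    (continuous_subtype_val.comp (Real.continuous_fourierChar.comp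
      (by fun_prop : Continuous fun v : V => -inner ℝ v v₀))).mul g.continuous
  have hn : ∀ v, ‖(Real.fourierChar (-inner ℝ v v₀) : ℂ) * g v‖ = ‖g v‖ := fun v => by
    rw [norm_mul, Circle.norm_coe, one_mul]
  have h := integral (θ := θ) (F := F) (μ := volume) hc.measurable
    ((g.integrable (μ := volume)).mono hc.aestronglyMeasurable (.of_forall fun v => (hn v).le)) χ hχ
  simp only [hn] at h
  refine h.congr fun m _ => ?_
  rw [hinv]
  refine integral_congr_ae (.of_forall fun v => ?_)
  change _ * g v * (Real.fourierChar (-inner ℝ v (L m)) : ℂ) = _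
  simp only [Circle.smul_def, smul_eq_mul]
  rw [inner_add_right, neg_add, AddChar.map_add_eq_mul, Circle.coe_mul]
  ring

omit [MeasurableSpace V] [BorelSpace V] in
/-- A function that is smooth near a compact set `K` agrees on `K` with a Schwartz function. -/
lemma _root_.exists_schwartzMap_eqOn {K U : Set V} (hK : IsCompact K) (hU : IsOpen U) (hKU : K ⊆ U)
    {f : V → ℂ} (hf : ContDiffOn ℝ ∞ f U) : ∃ Ψ : 𝓢(V, ℂ), Set.EqOn Ψ f K := by
  obtain ⟨L, hL, hKL, hLU⟩ := exists_compact_between hK hU hKU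
  obtain ⟨η, hη1, hη0, -⟩ := exists_contMDiffMap_one_nhds_of_subset_interior
    (n := ⊤) (modelWithCornersSelf ℝ V) hK.isClosed hKL
  have hη : ContDiff ℝ ∞ η := η.contMDiff.contDiff
  have hsupp : HasCompactSupport fun x => η x • f x :=
    HasCompactSupport.intro hL fun x hx => by simp [hη0 x hx]
  have hsm : ContDiff ℝ ∞ fun x => η x • f x := by
    rw [contDiff_iff_contDiffAt]
    intro x
    by_cases hx : x ∈ U
    · exact hη.contDiffAt.smul (hf.contDiffAt (hU.mem_nhds hx))
    · have : (fun x => η x • f x) =ᶠ[nhds x] fun _ => 0 := by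
        filter_upwards [hL.isClosed.isOpen_compl.mem_nhds fun h => hx (hLU h)] with y hy
        simp [hη0 y hy]
      exact contDiffAt_const.congr_of_eventuallyEq this
  refine ⟨hsupp.toSchwartzMap hsm, fun x hx => ?_⟩
  change η x • f x = f x
  rw [hη1.self_of_nhdsSet x hx, one_smul]

/-- Sampling a function that is smooth near a compact set along an affine map gives a
multiplier. -/
lemma exists_of_contDiffOn (d : ℕ) {K U : Set V} (hK : IsCompact K) (hU : IsOpen U) (hKU : K ⊆ U)
    {f : V → ℂ} (hf : ContDiffOn ℝ ∞ f U) :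
    ∃ C : ℝ, 0 ≤ C ∧ ∀ (θ : Matrix (Fin d) (Fin d) ℝ) (F : Finset (Fin d → ℤ))
      (L : (Fin d → ℤ) →+ V) (v₀ : V), (∀ m ∈ F, v₀ + L m ∈ K) →
        IsLpMultiplier θ F (fun m => f (v₀ + L m)) C := by
  obtain ⟨Ψ, hΨ⟩ := exists_schwartzMap_eqOn hK hU hKU hf
  exact ⟨_, integral_nonneg fun v => norm_nonneg _, fun θ F L v₀ h =>
    (schwartz Ψ L v₀).congr fun m hm => hΨ (h m hm)⟩

end Schwartz

end IsLpMultiplier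

end QuantumTorus

end

noncomputable section

namespace QuantumTorus

open scoped ENNReal NNReal SchwartzMap FourierTransform ContDiff
open MeasureTheory

variable {d : ℕ}

/-! ### The symbols of the potentials and of the fractional derivatives -/

/-- The frequencies `m` with `2^{k-1} ≤ |m| ≤ 2^{k+1}`. -/
def annulus (d k : ℕ) : Finset (Fin d → ℤ) :=
  {m ∈ Fintype.piFinset fun _ : Fin d => Finset.Icc (-2 ^ (k + 1) : ℤ) (2 ^ (k + 1)) |
    1 / 2 ≤ ‖(2 : ℝ) ^ (-(k : ℤ)) • toEuclid m‖ ∧ ‖(2 : ℝ) ^ (-(k : ℤ)) • toEuclid m‖ ≤ 2}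

lemma mem_annulus {k : ℕ} {m : Fin d → ℤ} (h : m ∈ annulus d k) :
    1 / 2 ≤ ‖(2 : ℝ) ^ (-(k : ℤ)) • toEuclid m‖ ∧ ‖(2 : ℝ) ^ (-(k : ℤ)) • toEuclid m‖ ≤ 2 :=
  (Finset.mem_filter.1 h).2

/-- The additive map `m ↦ c m` from `ℤᵈ` to `ℝᵈ`. -/
def dilation (d : ℕ) (c : ℝ) : (Fin d → ℤ) →+ EuclideanSpace ℝ (Fin d) where
  toFun m := c • toEuclid m
  map_zero' := by ext i; simp [toEuclid]
  map_add' m n := by ext i; simp [toEuclid, mul_add]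

/-- The additive map `m ↦ (0, c m)` from `ℤᵈ` to `ℝ × ℝᵈ`. -/
def optionDilation (d : ℕ) (c : ℝ) : (Fin d → ℤ) →+ EuclideanSpace ℝ (Option (Fin d)) where
  toFun m := WithLp.toLp 2 fun i => i.elim 0 fun j => c * m j
  map_zero' := by ext i; cases i <;> simp
  map_add' m n := by ext i; cases i <;> simp [mul_add]

lemma norm_smul_toEuclid_sq (c : ℝ) (m : Fin d → ℤ) :
    ‖c • toEuclid m‖ ^ 2 = ∑ j, (c * m j) ^ 2 := by
  rw [EuclideanSpace.norm_sq_eq]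
  simp [toEuclid, mul_pow]

lemma two_zpow_mul_sq (k : ℕ) (m : Fin d → ℤ) :
    ‖toEuclid m‖ ^ 2 = (2 ^ k) ^ 2 * ‖(2 : ℝ) ^ (-(k : ℤ)) • toEuclid m‖ ^ 2 := by
  rw [norm_smul, mul_pow, ← mul_assoc, ← mul_pow, Real.norm_of_nonneg (by positivity), zpow_neg,
    zpow_natCast, mul_inv_cancel₀ (by positivity)]
  ring

lemma sq_rpow_half {c : ℝ} (hc : 0 ≤ c) (k : ℕ) (β : ℝ) :
    ((2 ^ k) ^ 2 * c) ^ (β / 2) = (2 : ℝ) ^ (k * β) * c ^ (β / 2) := by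
  rw [Real.mul_rpow (by positivity) hc, ← pow_mul, ← Real.rpow_natCast, ← Real.rpow_mul zero_le_two]
  congr 2
  push_cast
  ring

/-- The symbols `(ε + |ξ|²)^{β/2}` are multipliers, uniformly in `0 ≤ ε ≤ 1` and `k`. -/
lemma exists_isLpMultiplier_perturbed (d : ℕ) (β : ℝ) :
    ∃ C : ℝ, 0 ≤ C ∧ ∀ (θ : Matrix (Fin d) (Fin d) ℝ) (k : ℕ) (ε : ℝ), 0 ≤ ε → ε ≤ 1 →
      IsLpMultiplier θ (annulus d k)
        (fun m => (((ε + ‖(2 : ℝ) ^ (-(k : ℤ)) • toEuclid m‖ ^ 2) ^ (β / 2) : ℝ) : ℂ)) C := by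
  -- The coordinate `none` carries `ε`. All values of `ε` and `k` then sample one fixed function
  -- along different affine maps, which makes the bound uniform.
  let Q : EuclideanSpace ℝ (Option (Fin d)) → ℝ := fun v => ∑ j, v (some j) ^ 2
  have hQ : ContDiff ℝ ∞ Q := by
    refine ContDiff.sum fun j _ => ContDiff.pow ?_ 2
    exact (EuclideanSpace.proj (𝕜 := ℝ) (some j)).contDiff
  have h0 : ContDiff ℝ ∞ fun v : EuclideanSpace ℝ (Option (Fin d)) => v none :=
    (EuclideanSpace.proj (𝕜 := ℝ) (none : Option (Fin d))).contDiff
  have hQc := hQ.continuous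
  have h0c := h0.continuous
  have hK : IsCompact {v : EuclideanSpace ℝ (Option (Fin d)) |
      (0 ≤ v none ∧ v none ≤ 1) ∧ 1 / 4 ≤ Q v ∧ Q v ≤ 4} := by
    -- Any radius at least `√5` would do: here `‖v‖² = v(none)² + Q ≤ 1 + 4`.
    refine (isCompact_closedBall (0 : EuclideanSpace ℝ (Option (Fin d))) 3).of_isClosed_subset ?_ ?_
    · exact ((isClosed_le continuous_const h0c).inter (isClosed_le h0c continuous_const)).inter
        ((isClosed_le continuous_const hQc).inter (isClosed_le hQc continuous_const))
    · rintro v ⟨⟨h1, h2⟩, h3, h4⟩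
      rw [mem_closedBall_zero_iff]
      have : ‖v‖ ^ 2 = v none ^ 2 + Q v := by
        rw [EuclideanSpace.norm_sq_eq, Fintype.sum_option]
        simp [Q]
      nlinarith [norm_nonneg v]
  obtain ⟨C, hC, h⟩ := IsLpMultiplier.exists_of_contDiffOn d hK
    (U := {v | 0 < v none + Q v}) (isOpen_lt continuous_const (h0c.add hQc))
    (fun v ⟨⟨h1, h2⟩, h3, h4⟩ => by
      change 0 < v none + Q v
      linarith) (f := fun v => (((v none + Q v) ^ (β / 2) : ℝ) : ℂ))
    (Complex.ofRealCLM.contDiff.comp_contDiffOn ((h0.add hQ).contDiffOn.rpow_const_of_ne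
      fun v hv => (ne_of_gt hv)))
  refine ⟨C, hC, fun θ k ε hε hε1 => ?_⟩
  let v₀ : EuclideanSpace ℝ (Option (Fin d)) := EuclideanSpace.single none ε
  let D := optionDilation d ((2 : ℝ) ^ (-(k : ℤ)))
  have hq : ∀ m : Fin d → ℤ, Q (v₀ + D m) = ‖(2 : ℝ) ^ (-(k : ℤ)) • toEuclid m‖ ^ 2 := by
    intro m
    rw [norm_smul_toEuclid_sq]
    simp [Q, v₀, D, optionDilation]
  have hn : ∀ m : Fin d → ℤ, (v₀ + D m) none = ε := by
    intro m
    simp [v₀, D, optionDilation]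
  have h' := h θ (annulus d k) D v₀ fun m hm => by
    obtain ⟨h1, h2⟩ := mem_annulus hm
    refine ⟨by rw [hn]; exact ⟨hε, hε1⟩, ?_⟩
    rw [hq]
    constructor <;> nlinarith
  refine h'.congr fun m _ => ?_
  rw [hn, hq]

/-- Scaling gives `1 + |m|² = 4^k (4^(-k) + |2^(-k) m|²)`, so this is the perturbed symbol with `ε =
4^(-k)`. -/
lemma exists_isLpMultiplier_besselSymbol (d : ℕ) (β : ℝ) :
    ∃ C : ℝ, 0 ≤ C ∧ ∀ (θ : Matrix (Fin d) (Fin d) ℝ) (k : ℕ),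
      IsLpMultiplier θ (annulus d k) (besselSymbol β) ((2 : ℝ) ^ (k * β) * C) := by
  obtain ⟨C, hC, h⟩ := exists_isLpMultiplier_perturbed d β
  refine ⟨C, hC, fun θ k => ?_⟩
  have h1 := (h θ k (((2 : ℝ) ^ k) ^ 2)⁻¹ (by positivity)
    (inv_le_one_of_one_le₀ (one_le_pow₀ (one_le_pow₀ one_le_two)))).const_mul
      (((2 : ℝ) ^ (k * β) : ℝ) : ℂ)
  rw [Complex.norm_real, Real.norm_of_nonneg (by positivity)] at h1
  refine h1.congr fun m _ => ?_
  rw [besselSymbol, ← Complex.ofReal_mul, ← sq_rpow_half (by positivity), mul_add,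
    mul_inv_cancel₀ (by positivity), ← two_zpow_mul_sq]

/-- The case `ε = 0` of the perturbed symbol, by homogeneity. -/
lemma exists_isLpMultiplier_rieszSymbol (d : ℕ) (β : ℝ) :
    ∃ C : ℝ, 0 ≤ C ∧ ∀ (θ : Matrix (Fin d) (Fin d) ℝ) (k : ℕ),
      IsLpMultiplier θ (annulus d k) (rieszSymbol β) ((2 : ℝ) ^ (k * β) * C) := by
  obtain ⟨C, hC, h⟩ := exists_isLpMultiplier_perturbed d β
  refine ⟨C, hC, fun θ k => ?_⟩
  have h1 := (h θ k 0 le_rfl zero_le_one).const_mul (((2 : ℝ) ^ (k * β) : ℝ) : ℂ)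
  rw [Complex.norm_real, Real.norm_of_nonneg (by positivity)] at h1
  refine h1.congr fun m _ => ?_
  rw [rieszSymbol, ← Complex.ofReal_mul, ← sq_rpow_half (by positivity), zero_add,
    ← two_zpow_mul_sq, ← Real.rpow_two, ← Real.rpow_mul (norm_nonneg _)]
  congr 2
  ring

/-! ### Fractional partial derivatives on the annuli. -/

/-- The function `t ↦ (2πi t)^b` on the real line. -/
def imagPow (b t : ℝ) : ℂ := (2 * Real.pi * Complex.I * (t : ℂ)) ^ (b : ℂ)

lemma partialSymbol_eq_imagPow (i : Fin d) (b : ℝ) (m : Fin d → ℤ) :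
    partialSymbol i b m = imagPow b (m i) := by
  rw [partialSymbol, imagPow, Complex.ofReal_intCast]

lemma two_pi_I_mul_ne_zero {t : ℝ} (ht : t ≠ 0) : 2 * Real.pi * Complex.I * (t : ℂ) ≠ 0 := by
  have := Real.pi_ne_zero
  simp [ht, this]

/-- A positive factor does not change the argument, so the principal logarithm is additive. At `t =
0` both sides vanish if `b ≠ 0`, while `b = 0` gives `1` everywhere. -/
lemma imagPow_mul {c : ℝ} (hc : 0 < c) (b t : ℝ) :
    imagPow b (c * t) = ((c ^ b : ℝ) : ℂ) * imagPow b t := by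
  rcases eq_or_ne b 0 with rfl | hb
  · simp [imagPow]
  rcases eq_or_ne t 0 with rfl | ht
  · simp [imagPow, hb]
  have h1 := two_pi_I_mul_ne_zero ht
  have h2 : (c : ℂ) ≠ 0 := by exact_mod_cast hc.ne'
  rw [imagPow, imagPow, show 2 * Real.pi * Complex.I * ((c * t : ℝ) : ℂ) =
      (c : ℂ) * (2 * Real.pi * Complex.I * (t : ℂ)) by push_cast; ring,
    Complex.cpow_def_of_ne_zero (mul_ne_zero h2 h1), Complex.log_ofReal_mul hc h1, add_mul,
    Complex.exp_add, ← Complex.cpow_def_of_ne_zero h1, Complex.ofReal_log hc.le,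
    ← Complex.cpow_def_of_ne_zero h2, Complex.ofReal_cpow hc.le]

/-- For `t ≠ 0` the base is a nonzero imaginary number, hence off the branch cut. -/
lemma contDiffAt_imagPow (b : ℝ) {t : ℝ} (ht : t ≠ 0) : ContDiffAt ℝ ∞ (imagPow b) t := by
  have hs : 2 * Real.pi * Complex.I * (t : ℂ) ∈ Complex.slitPlane := by
    refine Or.inr ?_
    have := Real.pi_ne_zero
    simp [ht, this]
  have hlin : ContDiffAt ℝ ∞ (fun t : ℝ => 2 * Real.pi * Complex.I * (t : ℂ)) t :=
    (contDiff_const.mul Complex.ofRealCLM.contDiff).contDiffAt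
  have hlog : ContDiffAt ℝ ∞ (fun t : ℝ =>
      Complex.exp (Complex.log (2 * Real.pi * Complex.I * (t : ℂ)) * b)) t :=
    (((Complex.contDiffAt_log hs).restrict_scalars ℝ).comp t hlin |>.mul contDiffAt_const).cexp
  refine hlog.congr_of_eventuallyEq ?_
  filter_upwards [isOpen_ne.mem_nhds ht] with s hs
  rw [imagPow, Complex.cpow_def_of_ne_zero (two_pi_I_mul_ne_zero hs)]

/-- The additive map `m ↦ c m_i` from `ℤᵈ` to `ℝ`. -/
def coordDilation (i : Fin d) (c : ℝ) : (Fin d → ℤ) →+ ℝ where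
  toFun m := c * m i
  map_zero' := by simp
  map_add' m n := by simp [mul_add]

lemma abs_coord_le_two {k : ℕ} {m : Fin d → ℤ} (hm : m ∈ annulus d k) (i : Fin d) :
    |(2 : ℝ) ^ (-(k : ℤ)) * m i| ≤ 2 := by
  refine le_trans ?_ (mem_annulus hm).2
  have := PiLp.norm_apply_le ((2 : ℝ) ^ (-(k : ℤ)) • toEuclid m) i
  simpa [toEuclid] using this

/-- The scaled symbols `(2πi 2^{-k} m_i)^b` are multipliers for `b > 0`, uniformly in `k`: they are
sums of dyadic pieces. -/
lemma exists_isLpMultiplier_imagPow (d : ℕ) {b : ℝ} (hb : 0 < b) :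
    ∃ C : ℝ, 0 ≤ C ∧ ∀ (θ : Matrix (Fin d) (Fin d) ℝ) (k : ℕ) (i : Fin d),
      IsLpMultiplier θ (annulus d k) (fun m => imagPow b ((2 : ℝ) ^ (-(k : ℤ)) * m i)) C := by
  let χ : ContDiffBump (0 : ℝ) := ⟨2, 4, by norm_num, by norm_num⟩
  have hχ1 : ∀ t : ℝ, |t| ≤ 2 → χ t = 1 := fun t ht =>
    χ.one_of_mem_closedBall (by simpa using ht)
  have hχ0 : ∀ t : ℝ, 4 ≤ |t| → χ t = 0 := fun t ht => χ.zero_of_le_dist (by simpa using ht)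
  -- The difference vanishes for `|t| ≤ 1` and for `|t| ≥ 4`, so the singularity at `0` is cut off
  -- and `h` is Schwartz.
  let h : ℝ → ℂ := fun t => (χ t - χ (2 * t)) • imagPow b t
  have hsupp : HasCompactSupport h :=
    HasCompactSupport.intro (isCompact_closedBall (0 : ℝ) 4) fun t ht => by
      have h1 : 4 < |t| := by simpa using ht
      have h2 : χ (2 * t) = 0 := hχ0 _ (by rw [abs_mul, abs_two]; linarith)
      simp [h, hχ0 t h1.le, h2]
  have hsm : ContDiff ℝ ∞ h := by
    rw [contDiff_iff_contDiffAt]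
    intro t
    by_cases ht : t = 0
    · have : h =ᶠ[nhds t] fun _ => 0 := by
        filter_upwards [Metric.ball_mem_nhds t one_pos] with s hs
        have hs : |s| < 1 := by simpa [ht] using hs
        have h2 : χ (2 * s) = 1 := hχ1 _ (by rw [abs_mul, abs_two]; linarith)
        simp [h, hχ1 s (by linarith), h2]
      exact contDiffAt_const.congr_of_eventuallyEq this
    · have h2 : ContDiff ℝ ∞ fun t : ℝ => χ (2 * t) :=
        χ.contDiff.comp (contDiff_const.mul contDiff_id)
      exact (χ.contDiff.sub h2).contDiffAt.smul (contDiffAt_imagPow b ht)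
  let Ψ := hsupp.toSchwartzMap hsm
  set I := ∫ v, ‖(𝓕⁻ Ψ : 𝓢(ℝ, ℂ)) v‖ with hI
  have hI0 : 0 ≤ I := integral_nonneg fun v => norm_nonneg _
  -- By homogeneity the `j`-th dyadic piece of `(2πi t)^b` is `r^j h(2^j t)`. Its multiplier norm is
  -- at most `r^j I`, which is summable since `b > 0`.
  set r : ℝ := (2 : ℝ) ^ (-b) with hr
  have hr0 : 0 < r := by positivity
  have hr1 : r < 1 := Real.rpow_lt_one_of_one_lt_of_neg one_lt_two (by linarith)
  refine ⟨(1 - r)⁻¹ * I, mul_nonneg (inv_nonneg.2 (by linarith)) hI0, fun θ k i => ?_⟩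
  have hterm : ∀ (j : ℕ) (t : ℝ), ((r ^ j : ℝ) : ℂ) * h (2 ^ j * t) =
      ((χ (2 ^ j * t) - χ (2 ^ (j + 1) * t) : ℝ) : ℂ) * imagPow b t := by
    intro j t
    have e : r ^ j * ((2 : ℝ) ^ j) ^ b = 1 := by
      rw [← Real.rpow_natCast, ← Real.rpow_natCast, hr, ← Real.rpow_mul zero_le_two,
        ← Real.rpow_mul zero_le_two, ← Real.rpow_add two_pos]
      ring_nf
      exact Real.rpow_zero _
    simp only [h, Complex.real_smul]
    rw [imagPow_mul (by positivity), ← mul_assoc 2, ← pow_succ']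
    calc _ = ((r ^ j * ((2 : ℝ) ^ j) ^ b : ℝ) : ℂ) *
          (((χ (2 ^ j * t) - χ (2 ^ (j + 1) * t) : ℝ) : ℂ) * imagPow b t) := by push_cast; ring
      _ = _ := by rw [e, Complex.ofReal_one, one_mul]
  refine IsLpMultiplier.of_tendsto (s := fun J m => ∑ j ∈ Finset.range J,
    ((r ^ j : ℝ) : ℂ) * h (2 ^ j * ((2 : ℝ) ^ (-(k : ℤ)) * m i))) (fun J => ?_) fun m hm => ?_
  · refine (IsLpMultiplier.sum (Finset.range J) (C := fun j => r ^ j * I) fun j _ => ?_).mono ?_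
    · have h1 := (IsLpMultiplier.schwartz (θ := θ) (F := annulus d k) Ψ
        (coordDilation i (2 ^ j * (2 : ℝ) ^ (-(k : ℤ)))) 0).const_mul ((r ^ j : ℝ) : ℂ)
      rw [Complex.norm_real, Real.norm_of_nonneg (by positivity)] at h1
      refine h1.congr fun m _ => ?_
      rw [zero_add]
      change _ * h (2 ^ j * (2 : ℝ) ^ (-(k : ℤ)) * m i) = _
      rw [mul_assoc]
    · rw [← Finset.sum_mul]
      refine mul_le_mul_of_nonneg_right ?_ hI0
      rw [← tsum_geometric_of_lt_one hr0.le hr1]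
      exact (summable_geometric_of_lt_one hr0.le hr1).sum_le_tsum _ fun j _ => by positivity
  · set t := (2 : ℝ) ^ (-(k : ℤ)) * m i with ht
    -- The sum telescopes and its first term is `χ(t) = 1`, because `|t| ≤ 2` on the annulus.
    have htel : ∀ J, ∑ j ∈ Finset.range J, ((r ^ j : ℝ) : ℂ) * h (2 ^ j * t) =
        ((1 - χ (2 ^ J * t) : ℝ) : ℂ) * imagPow b t := by
      intro J
      simp only [hterm]
      rw [← Finset.sum_mul, ← Complex.ofReal_sum, Finset.sum_range_sub' (fun j => χ (2 ^ j * t)),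
        pow_zero, one_mul, hχ1 t (abs_coord_le_two hm i)]
    simp only [htel]
    -- At `t = 0` the cutoff never leaves `1`, but the limit is still right because `0^b = 0` for `b
    -- > 0`. Elsewhere the partial sums are eventually constant.
    rcases eq_or_ne t 0 with h0 | h0
    · simp [h0, imagPow, hb.ne']
    · refine tendsto_const_nhds.congr' ?_
      have hlim : Filter.Tendsto (fun J : ℕ => (2 : ℝ) ^ J * |t|) Filter.atTop Filter.atTop :=
        (tendsto_pow_atTop_atTop_of_one_lt one_lt_two).atTop_mul_const (abs_pos.2 h0)
      filter_upwards [hlim.eventually_ge_atTop 4] with J hJ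
      rw [hχ0 _ (by rw [abs_mul, abs_of_pos (by positivity)]; exact hJ)]
      simp

lemma exists_isLpMultiplier_partialSymbol (d : ℕ) {b : ℝ} (hb : 0 ≤ b) :
    ∃ C : ℝ, 0 ≤ C ∧ ∀ (θ : Matrix (Fin d) (Fin d) ℝ) (k : ℕ) (i : Fin d),
      IsLpMultiplier θ (annulus d k) (partialSymbol i b) ((2 : ℝ) ^ (k * b) * C) := by
  rcases hb.eq_or_lt with rfl | hb
  · refine ⟨1, zero_le_one, fun θ k i => ?_⟩
    have h := IsLpMultiplier.const (θ := θ) (F := annulus d k) 1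
    rw [norm_one] at h
    simpa using h.congr (t := partialSymbol i 0) fun m _ => by simp [partialSymbol]
  · obtain ⟨C, hC, h⟩ := exists_isLpMultiplier_imagPow d hb
    refine ⟨C, hC, fun θ k i => ?_⟩
    have h1 := (h θ k i).const_mul (((2 : ℝ) ^ (k * b) : ℝ) : ℂ)
    rw [Complex.norm_real, Real.norm_of_nonneg (by positivity)] at h1
    refine h1.congr fun m _ => ?_
    rw [partialSymbol_eq_imagPow, Real.rpow_mul zero_le_two, Real.rpow_natCast,
      ← imagPow_mul (by positivity), ← mul_assoc, zpow_neg, zpow_natCast,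
      mul_inv_cancel₀ (by positivity), one_mul]

lemma exists_isLpMultiplier_fracDeriv (d : ℕ) {a : Fin d → ℝ} (ha : ∀ i, 0 ≤ a i) :
    ∃ C : ℝ, 0 ≤ C ∧ ∀ (θ : Matrix (Fin d) (Fin d) ℝ) (k : ℕ),
      IsLpMultiplier θ (annulus d k) (fun m => ∏ i, partialSymbol i (a i) m)
        ((2 : ℝ) ^ (k * ∑ i, a i) * C) := by
  choose C hC h using fun i => exists_isLpMultiplier_partialSymbol d (ha i)
  refine ⟨∏ i, C i, Finset.prod_nonneg fun i _ => hC i, fun θ k => ?_⟩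
  refine (IsLpMultiplier.prod Finset.univ (C := fun i => (2 : ℝ) ^ (k * a i) * C i)
    (fun i => mul_nonneg (by positivity) (hC i)) fun i _ => h i θ k i).mono (le_of_eq ?_)
  rw [Finset.prod_mul_distrib, Finset.mul_sum, Real.rpow_sum_of_pos two_pos]

/-- On the annuli, the constant symbol `1` is a combination of the symbols of the fractional partial
derivatives of order `β`, with multiplier coefficients. -/
lemma exists_isLpMultiplier_partition (d : ℕ) (β : ℝ) :
    ∃ C : ℝ, 0 ≤ C ∧ ∀ k : ℕ, ∃ s : Fin d → (Fin d → ℤ) → ℂ,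
      (∀ (θ : Matrix (Fin d) (Fin d) ℝ) (i : Fin d),
        IsLpMultiplier θ (annulus d k) (s i) ((2 : ℝ) ^ (k * (-β)) * C)) ∧
      ∀ m ∈ annulus d k, ∑ i, s i m * partialSymbol i β m = 1 := by
  -- Vanishes for `t² ≤ 1/(8d)` and is positive beyond. On the annulus `|ξ|² ≥ 1/4`, so some `ξ_j² ≥
  -- 1/(4d)`; hence the sum of the cutoffs is positive there.
  let χ : ℝ → ℝ := fun t => Real.smoothTransition (8 * d * t ^ 2 - 1)
  have hχ : ContDiff ℝ ∞ χ := Real.smoothTransition.contDiff.comp (by fun_prop)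
  have hχ0 : ∀ t, 0 ≤ χ t := fun t => Real.smoothTransition.nonneg _
  -- The cutoff vanishes near `t = 0`, so this smooth function inverts `(2πi t)^β` wherever `χ = 1`.
  let w : ℝ → ℂ := fun t => χ t • imagPow (-β) t
  have hw : ContDiff ℝ ∞ w := by
    rw [contDiff_iff_contDiffAt]
    intro t
    by_cases ht : t = 0
    · have : w =ᶠ[nhds t] fun _ => 0 := by
        have hc : Continuous fun s : ℝ => 8 * d * s ^ 2 - 1 := by fun_prop
        filter_upwards [(hc.tendsto t).eventually_lt_const
          (show 8 * d * t ^ 2 - 1 < 0 by simp [ht])] with s hs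
        simp [w, χ, Real.smoothTransition.zero_of_nonpos hs.le]
      exact contDiffAt_const.congr_of_eventuallyEq this
    · exact hχ.contDiffAt.smul (contDiffAt_imagPow _ ht)
  let total : EuclideanSpace ℝ (Fin d) → ℝ := fun ξ => ∑ j, χ (ξ j)
  have hproj : ∀ j : Fin d, ContDiff ℝ ∞ fun ξ : EuclideanSpace ℝ (Fin d) => ξ j := fun j =>
    (EuclideanSpace.proj (𝕜 := ℝ) j).contDiff
  have htotal : ContDiff ℝ ∞ total := ContDiff.sum fun j _ => hχ.comp (hproj j)
  have hK : IsCompact {ξ : EuclideanSpace ℝ (Fin d) | 1 / 2 ≤ ‖ξ‖ ∧ ‖ξ‖ ≤ 2} := by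
    refine (isCompact_closedBall (0 : EuclideanSpace ℝ (Fin d)) 2).of_isClosed_subset ?_ ?_
    · exact (isClosed_le continuous_const continuous_norm).inter
        (isClosed_le continuous_norm continuous_const)
    · exact fun ξ h => by simpa using h.2
  have hU : IsOpen {ξ : EuclideanSpace ℝ (Fin d) | 0 < total ξ} :=
    isOpen_lt continuous_const htotal.continuous
  have hKU : {ξ : EuclideanSpace ℝ (Fin d) | 1 / 2 ≤ ‖ξ‖ ∧ ‖ξ‖ ≤ 2} ⊆ {ξ | 0 < total ξ} := by
    rintro ξ ⟨h1, -⟩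
    obtain ⟨j, hj⟩ : ∃ j, 0 < 8 * d * ξ j ^ 2 - 1 := by
      by_contra! hcon
      have h2 : ‖ξ‖ ^ 2 = ∑ j, ξ j ^ 2 := by
        rw [EuclideanSpace.norm_sq_eq]; simp
      have h3 : 8 * d * ‖ξ‖ ^ 2 ≤ d := by
        rw [h2, Finset.mul_sum]
        calc ∑ j, 8 * (d : ℝ) * ξ j ^ 2 ≤ ∑ _j : Fin d, (1 : ℝ) :=
              Finset.sum_le_sum fun j _ => by linarith [hcon j]
          _ = d := by simp
      -- For `d = 0` the annulus is empty.
      rcases Nat.eq_zero_or_pos d with rfl | hd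
      · have : ξ = 0 := Subsingleton.elim _ _
        rw [this, norm_zero] at h1
        norm_num at h1
      · have hd' : (0 : ℝ) < d := by exact_mod_cast hd
        have h4 : 1 / 4 ≤ ‖ξ‖ ^ 2 := by nlinarith
        nlinarith
    exact Finset.sum_pos' (fun i _ => hχ0 _)
      ⟨j, Finset.mem_univ j, Real.smoothTransition.pos_of_pos hj⟩
  have hf : ∀ i : Fin d, ContDiffOn ℝ ∞ (fun ξ : EuclideanSpace ℝ (Fin d) => (total ξ)⁻¹ • w (ξ i))
      {ξ | 0 < total ξ} := fun i =>
    (htotal.contDiffOn.inv fun ξ hξ => ne_of_gt hξ).smul (hw.comp (hproj i)).contDiffOn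
  choose C hC h using fun i => IsLpMultiplier.exists_of_contDiffOn d hK hU hKU (hf i)
  refine ⟨∑ i, C i, Finset.sum_nonneg fun i _ => hC i, fun k => ?_⟩
  set D := dilation d ((2 : ℝ) ^ (-(k : ℤ))) with hD
  have hmem : ∀ m ∈ annulus d k, 0 + D m ∈ {ξ : EuclideanSpace ℝ (Fin d) | 1 / 2 ≤ ‖ξ‖ ∧ ‖ξ‖ ≤ 2} :=
    fun m hm => by rw [zero_add]; exact mem_annulus hm
  refine ⟨fun i m => (((2 : ℝ) ^ (k * (-β)) : ℝ) : ℂ) * ((total (0 + D m))⁻¹ • w ((0 + D m) i)),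
    fun θ i => ?_, fun m hm => ?_⟩
  · have h1 := (h i θ (annulus d k) D 0 hmem).const_mul (((2 : ℝ) ^ (k * (-β)) : ℝ) : ℂ)
    rw [Complex.norm_real, Real.norm_of_nonneg (by positivity)] at h1
    refine h1.mono ?_
    gcongr
    exact Finset.single_le_sum (f := C) (fun i _ => hC i) (Finset.mem_univ i)
  · have hpos : 0 < total (0 + D m) := hKU (hmem m hm)
    have hterm : ∀ i, (((2 : ℝ) ^ (k * (-β)) : ℝ) : ℂ) * ((total (0 + D m))⁻¹ • w ((0 + D m) i)) *
        partialSymbol i β m = (((total (0 + D m))⁻¹ * χ ((0 + D m) i) : ℝ) : ℂ) := by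
      intro i
      have e1 : (0 + D m) i = (2 : ℝ) ^ (-(k : ℤ)) * m i := by
        rw [zero_add, hD]
        simp [dilation, toEuclid]
      simp only [w, Complex.real_smul]
      -- The symbol may vanish at `m_i = 0`, but there the cutoff is zero as well, so no inverse is
      -- needed.
      by_cases h0 : (m i : ℝ) = 0
      · rw [e1, h0, mul_zero]
        simp [χ, Real.smoothTransition.zero_of_nonpos]
      · have e2 : (((2 : ℝ) ^ (k * (-β)) : ℝ) : ℂ) * imagPow (-β) ((0 + D m) i) *
            partialSymbol i β m = 1 := by
          rw [partialSymbol_eq_imagPow, e1, Real.rpow_mul zero_le_two, Real.rpow_natCast,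
            ← imagPow_mul (by positivity), ← mul_assoc, zpow_neg, zpow_natCast,
            mul_inv_cancel₀ (by positivity), one_mul, imagPow, imagPow, Complex.ofReal_neg,
            Complex.cpow_neg, inv_mul_cancel₀]
          rw [Complex.cpow_ne_zero_iff]
          exact Or.inl (two_pi_I_mul_ne_zero h0)
        calc _ = (((total (0 + D m))⁻¹ * χ ((0 + D m) i) : ℝ) : ℂ) *
              ((((2 : ℝ) ^ (k * (-β)) : ℝ) : ℂ) * imagPow (-β) ((0 + D m) i) *
                partialSymbol i β m) := by push_cast; ring
          _ = _ := by rw [e2, mul_one]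
    rw [Finset.sum_congr rfl fun i _ => hterm i, ← Complex.ofReal_sum, ← Finset.mul_sum,
      inv_mul_cancel₀ hpos.ne', Complex.ofReal_one]

end QuantumTorus

end

noncomputable section

namespace QuantumTorus

open scoped ENNReal NNReal
open MeasureTheory

variable {d : ℕ}

/-! ### Boundedness on Besov spaces -/

/-- The norm of `ℓ^q` of a sequence with a distinguished additional entry. -/
def seqNorm (q : ℝ≥0∞) (c : ℝ≥0∞) (t : ℕ → ℝ≥0∞) : ℝ≥0∞ :=
  if q = ∞ then max c (⨆ k, t k) else (c ^ q.toReal + ∑' k, t k ^ q.toReal) ^ (1 / q.toReal)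

lemma seqNorm_le_mul {q : ℝ≥0∞} (hq : 1 ≤ q) {c c' M : ℝ≥0∞} {t t' : ℕ → ℝ≥0∞}
    (hc : c ≤ M * c') (ht : ∀ k, t k ≤ M * t' k) : seqNorm q c t ≤ M * seqNorm q c' t' := by
  by_cases hq' : q = ∞
  · simp only [seqNorm, if_pos hq']
    refine max_le (hc.trans (by gcongr; exact le_max_left _ _)) (iSup_le fun k => (ht k).trans ?_)
    gcongr
    exact (le_iSup t' k).trans (le_max_right _ _)
  · have hq0 : 0 < q.toReal := ENNReal.toReal_pos (one_pos.trans_le hq).ne' hq'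
    simp only [seqNorm, if_neg hq']
    calc (c ^ q.toReal + ∑' k, t k ^ q.toReal) ^ (1 / q.toReal)
        ≤ ((M * c') ^ q.toReal + ∑' k, (M * t' k) ^ q.toReal) ^ (1 / q.toReal) := by
          gcongr with k
          exact ht k
      _ = (M ^ q.toReal * (c' ^ q.toReal + ∑' k, t' k ^ q.toReal)) ^ (1 / q.toReal) := by
          simp only [ENNReal.mul_rpow_of_nonneg _ _ hq0.le, ENNReal.tsum_mul_left, mul_add]
      _ = _ := by
          rw [ENNReal.mul_rpow_of_nonneg _ _ (by positivity), ← ENNReal.rpow_mul,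
            mul_one_div_cancel hq0.ne', ENNReal.rpow_one]

lemma seqNorm_mono {q : ℝ≥0∞} (hq : 1 ≤ q) {c c' : ℝ≥0∞} {t t' : ℕ → ℝ≥0∞}
    (hc : c ≤ c') (ht : ∀ k, t k ≤ t' k) : seqNorm q c t ≤ seqNorm q c' t' := by
  simpa using seqNorm_le_mul hq (M := 1) (by simpa using hc) (by simpa using ht)

lemma le_seqNorm {q : ℝ≥0∞} (hq : 1 ≤ q) (c : ℝ≥0∞) (t : ℕ → ℝ≥0∞) : c ≤ seqNorm q c t := by
  by_cases hq' : q = ∞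
  · simp only [seqNorm, if_pos hq']
    exact le_max_left _ _
  · have hq0 : 0 < q.toReal := ENNReal.toReal_pos (one_pos.trans_le hq).ne' hq'
    simp only [seqNorm, if_neg hq']
    calc c = (c ^ q.toReal) ^ (1 / q.toReal) := by
          rw [← ENNReal.rpow_mul, mul_one_div_cancel hq0.ne', ENNReal.rpow_one]
      _ ≤ _ := by gcongr; exact le_self_add

/-- Subadditivity of `t ↦ t^(1/q)`. It splits off the mean, which the annuli do not see. -/
lemma seqNorm_le_add {q : ℝ≥0∞} (hq : 1 ≤ q) (c : ℝ≥0∞) (t : ℕ → ℝ≥0∞) :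
    seqNorm q c t ≤ c + seqNorm q 0 t := by
  by_cases hq' : q = ∞
  · simp only [seqNorm, if_pos hq']
    exact max_le le_self_add (le_add_left (le_max_right _ _))
  · have hq1 : 1 ≤ q.toReal := by
      simpa using (ENNReal.toReal_le_toReal ENNReal.one_ne_top hq').2 hq
    have hq0 : 0 < q.toReal := one_pos.trans_le hq1
    simp only [seqNorm, if_neg hq', ENNReal.zero_rpow_of_pos hq0, zero_add]
    refine (ENNReal.rpow_add_le_add_rpow _ _ (by positivity)
      ((div_le_one hq0).2 hq1)).trans (le_of_eq ?_)
    rw [← ENNReal.rpow_mul, mul_one_div_cancel hq0.ne', ENNReal.rpow_one]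

/-- Minkowski's inequality in `ℓ^q`, read as `L^q` of the counting measure. -/
lemma seqNorm_add_le {q : ℝ≥0∞} (hq : 1 ≤ q) (t u : ℕ → ℝ≥0∞) :
    seqNorm q 0 (fun k => t k + u k) ≤ seqNorm q 0 t + seqNorm q 0 u := by
  by_cases hq' : q = ∞
  · simp only [seqNorm, if_pos hq', zero_le, max_eq_right]
    exact iSup_le fun k => add_le_add (le_iSup t k) (le_iSup u k)
  · have hq1 : 1 ≤ q.toReal := by
      simpa using (ENNReal.toReal_le_toReal ENNReal.one_ne_top hq').2 hq
    have hq0 : 0 < q.toReal := one_pos.trans_le hq1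
    simp only [seqNorm, if_neg hq', ENNReal.zero_rpow_of_pos hq0, zero_add]
    have h := ENNReal.lintegral_Lp_add_le (μ := Measure.count) (f := t) (g := u)
      (measurable_of_countable _).aemeasurable (measurable_of_countable _).aemeasurable hq1
    simpa only [lintegral_count, Pi.add_apply] using h

lemma seqNorm_sum_le {q : ℝ≥0∞} (hq : 1 ≤ q) {ι : Type*} (s : Finset ι)
    (t : ι → ℕ → ℝ≥0∞) :
    seqNorm q 0 (fun k => ∑ i ∈ s, t i k) ≤ ∑ i ∈ s, seqNorm q 0 (t i) := by
  classical
  induction s using Finset.induction_on with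
  | empty =>
    simpa using seqNorm_le_mul hq (M := 0) (c := 0) (c' := 0) (t := fun _ => 0) (t' := fun _ => 0)
      (by simp) (by simp)
  | insert i s hi ih =>
    simp only [Finset.sum_insert hi]
    exact (seqNorm_add_le hq _ _).trans (by gcongr)

/-! ### Fourier multipliers on Besov norms. -/

variable {θ : Matrix (Fin d) (Fin d) ℝ} {φ : SchwartzMap (EuclideanSpace ℝ (Fin d)) ℝ}

lemma besovNorm_eq_seqNorm (φ : SchwartzMap (EuclideanSpace ℝ (Fin d)) ℝ) (α : ℝ) (p q : ℝ≥0∞)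
    (x : Distribution θ) :
    besovNorm φ α p q x = seqNorm q ‖fourierCoeff x 0‖ₑ
      fun k => ENNReal.ofReal ((2 : ℝ) ^ (k * α) * lpNorm p (piece φ k x)) := rfl

/-- The support condition on `φ` cuts the cube of summation down to the annulus on which the symbol
estimates hold. -/
lemma piece_eq_trigPoly (hφ : IsLittlewoodPaley φ) (k : ℕ) (x : Distribution θ) :
    piece φ k x = trigPoly θ (annulus d k)
      fun m => ((φ ((2 : ℝ) ^ (-(k : ℤ)) • toEuclid m) : ℝ) : ℂ) * fourierCoeff x m := by
  symm
  refine Finset.sum_subset (Finset.filter_subset _ _) fun m hm hm' => ?_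
  have h0 : φ ((2 : ℝ) ^ (-(k : ℤ)) • toEuclid m) = 0 := by
    refine image_eq_zero_of_notMem_tsupport fun h => hm' ?_
    exact Finset.mem_filter.2 ⟨hm, hφ.support h⟩
  simp only [h0, Complex.ofReal_zero, zero_mul, zero_smul]

lemma piece_multiplier (hφ : IsLittlewoodPaley φ) {s : (Fin d → ℤ) → ℂ} (hs : PolyGrowth s)
    (k : ℕ) (x : Distribution θ) :
    piece φ k (multiplier θ s hs x) = trigPoly θ (annulus d k) fun m =>
      s m * (((φ ((2 : ℝ) ^ (-(k : ℤ)) • toEuclid m) : ℝ) : ℂ) * fourierCoeff x m) := by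
  rw [piece_eq_trigPoly hφ]
  refine trigPoly_congr θ fun m _ => ?_
  rw [fourierCoeff_multiplier]
  ring

lemma two_rpow_sub_mul (k : ℕ) (α β : ℝ) :
    (2 : ℝ) ^ (k * (α - β)) * (2 : ℝ) ^ (k * β) = (2 : ℝ) ^ (k * α) := by
  rw [← Real.rpow_add two_pos]
  ring_nf

/-- A Fourier multiplier whose symbol is of order `β` on the annuli maps `B^α_{p,q}` to
`B^{α-β}_{p,q}`. -/
lemma exists_besovNorm_multiplier_le (hφ : IsLittlewoodPaley φ) {p q : ℝ≥0∞} (hp : 1 ≤ p)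
    (hq : 1 ≤ q) (α β : ℝ) {s : (Fin d → ℤ) → ℂ} (hs : PolyGrowth s)
    (h : ∃ C : ℝ, 0 ≤ C ∧ ∀ k : ℕ, IsLpMultiplier θ (annulus d k) s ((2 : ℝ) ^ (k * β) * C)) :
    ∃ C : ℝ≥0, ∀ x : Distribution θ,
      besovNorm φ (α - β) p q (multiplier θ s hs x) ≤ C * besovNorm φ α p q x := by
  obtain ⟨C, hC, h⟩ := h
  -- The frequency `0` lies in no annulus, so the mean is controlled by `|s(0)|` directly.
  refine ⟨‖s 0‖₊ + C.toNNReal, fun x => ?_⟩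
  rw [besovNorm_eq_seqNorm, besovNorm_eq_seqNorm]
  refine seqNorm_le_mul hq ?_ fun k => ?_
  · rw [fourierCoeff_multiplier, enorm_mul]
    gcongr
    rw [ENNReal.coe_add]
    exact le_self_add
  · have h1 : lpNorm p (piece φ k (multiplier θ s hs x)) ≤
        (2 : ℝ) ^ (k * β) * C * lpNorm p (piece φ k x) := by
      rw [piece_multiplier hφ, piece_eq_trigPoly hφ]
      exact h k p hp _
    calc ENNReal.ofReal ((2 : ℝ) ^ (k * (α - β)) * lpNorm p (piece φ k (multiplier θ s hs x)))
        ≤ ENNReal.ofReal (C * ((2 : ℝ) ^ (k * α) * lpNorm p (piece φ k x))) := by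
          refine ENNReal.ofReal_le_ofReal ?_
          calc _ ≤ (2 : ℝ) ^ (k * (α - β)) * ((2 : ℝ) ^ (k * β) * C * lpNorm p (piece φ k x)) := by
                gcongr
            _ = C * ((2 : ℝ) ^ (k * (α - β)) * (2 : ℝ) ^ (k * β) * lpNorm p (piece φ k x)) := by
                ring
            _ = _ := by rw [two_rpow_sub_mul]
      _ = C.toNNReal * ENNReal.ofReal ((2 : ℝ) ^ (k * α) * lpNorm p (piece φ k x)) := by
          rw [ENNReal.ofReal_mul hC]; rfl
      _ ≤ _ := by
          gcongr
          exact le_add_self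

/-- Tested on a rapidly decreasing family, the composition differs from the identity only in the
entry at `0`. The error is a multiple of `(s(0) t(0) - 1) x̂(0)`, which either alternative kills. -/
lemma multiplier_multiplier_eq_self {s t : (Fin d → ℤ) → ℂ} (hs : PolyGrowth s)
    (ht : PolyGrowth t) {x : Distribution θ} (h : ∀ m, m ≠ 0 → s m * t m = 1)
    (h0 : s 0 * t 0 = 1 ∨ fourierCoeff x 0 = 0) :
    multiplier θ s hs (multiplier θ t ht x) = x := by
  refine Subtype.ext (LinearMap.ext fun y => ?_)
  obtain ⟨a, rfl⟩ := (smoothEquiv θ).surjective y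
  change (x : smooth θ →ₗ[ℂ] ℂ) (smoothMultiplier θ _ ht.comp_neg
    (smoothMultiplier θ _ hs.comp_neg (smoothEquiv θ a))) = _
  have e1 : mulRapid _ ht.comp_neg (mulRapid _ hs.comp_neg a) =
      a + ((s 0 * t 0 - 1) * (a : (Fin d → ℤ) → ℂ) 0) • rapidSingle 0 1 := by
    ext m
    change t (-m) * (s (-m) * (a : (Fin d → ℤ) → ℂ) m) = (a : (Fin d → ℤ) → ℂ) m +
      ((s 0 * t 0 - 1) * (a : (Fin d → ℤ) → ℂ) 0) * (Pi.single 0 1 : (Fin d → ℤ) → ℂ) m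
    by_cases hm : m = 0
    · subst hm
      simp only [neg_zero, Pi.single_eq_same]
      ring
    · rw [Pi.single_eq_of_ne hm, mul_zero, add_zero, ← mul_assoc, mul_comm (t _),
        h (-m) (neg_ne_zero.2 hm), one_mul]
  have e2 : (x : smooth θ →ₗ[ℂ] ℂ) (smoothEquiv θ (rapidSingle 0 1)) = fourierCoeff x 0 := by
    refine congrArg (x : smooth θ →ₗ[ℂ] ℂ) (Subtype.ext ?_)
    change synth θ (rapidSingle 0 1) = star (monomial θ 0)
    rw [synth_rapidSingle, one_smul, monomial_zero, star_one]
  rw [smoothMultiplier_synth, smoothMultiplier_synth, e1, map_add, map_add, map_smul, map_smul, e2,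
    smul_eq_mul]
  rcases h0 with h0 | h0
  · rw [h0, sub_self, zero_mul, zero_mul, add_zero]
  · rw [h0, mul_zero, add_zero]

/-- The inverse is the multiplier with the reciprocal symbol, of order `-β`. The set `Z` allows both
cases: all distributions for Bessel, mean zero for Riesz, whose symbols are reciprocal only off `m =
0`. -/
lemma isIsomorphismOn_multiplier (hφ : IsLittlewoodPaley φ) {p q : ℝ≥0∞} (hp : 1 ≤ p)
    (hq : 1 ≤ q) (α β : ℝ) {s t : (Fin d → ℤ) → ℂ} (hs : PolyGrowth s) (ht : PolyGrowth t)
    (hsC : ∃ C : ℝ, 0 ≤ C ∧ ∀ k : ℕ, IsLpMultiplier θ (annulus d k) s ((2 : ℝ) ^ (k * β) * C))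
    (htC : ∃ C : ℝ, 0 ≤ C ∧ ∀ k : ℕ, IsLpMultiplier θ (annulus d k) t ((2 : ℝ) ^ (k * (-β)) * C))
    {Z : Set (Distribution θ)} (hsZ : Set.MapsTo (multiplier θ s hs) Z Z)
    (htZ : Set.MapsTo (multiplier θ t ht) Z Z)
    (hts : ∀ x ∈ Z, multiplier θ t ht (multiplier θ s hs x) = x)
    (hst : ∀ x ∈ Z, multiplier θ s hs (multiplier θ t ht x) = x) :
    IsIsomorphismOn (multiplier θ s hs) (besovSpace θ φ α p q ∩ Z) (besovNorm φ α p q)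
      (besovSpace θ φ (α - β) p q ∩ Z) (besovNorm φ (α - β) p q) := by
  obtain ⟨C, hC⟩ := exists_besovNorm_multiplier_le hφ hp hq α β hs hsC
  obtain ⟨D, hD⟩ := exists_besovNorm_multiplier_le hφ hp hq (α - β) (-β) ht htC
  rw [sub_neg_eq_add, sub_add_cancel] at hD
  refine ⟨Set.InvOn.bijOn (f' := multiplier θ t ht) ⟨fun x hx => hts x hx.2, fun x hx => hst x hx.2⟩
    (fun x hx => ⟨?_, hsZ hx.2⟩) (fun x hx => ⟨?_, htZ hx.2⟩), C + D, fun x hx => ⟨?_, ?_⟩⟩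
  · exact (hC x).trans_lt (ENNReal.mul_lt_top ENNReal.coe_lt_top hx.1)
  · exact (hD x).trans_lt (ENNReal.mul_lt_top ENNReal.coe_lt_top hx.1)
  · refine (hC x).trans ?_
    gcongr
    exact le_self_add
  · have h := hD (multiplier θ s hs x)
    rw [hts x hx.2] at h
    refine h.trans ?_
    gcongr
    exact le_add_self

lemma isIsomorphismOn_besselPotential (hφ : IsLittlewoodPaley φ) {p q : ℝ≥0∞} (hp : 1 ≤ p)
    (hq : 1 ≤ q) (α β : ℝ) :
    IsIsomorphismOn (besselPotential θ β) (besovSpace θ φ α p q) (besovNorm φ α p q)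
      (besovSpace θ φ (α - β) p q) (besovNorm φ (α - β) p q) := by
  obtain ⟨C, hC, h⟩ := exists_isLpMultiplier_besselSymbol d β
  obtain ⟨D, hD, h'⟩ := exists_isLpMultiplier_besselSymbol d (-β)
  have hinv : ∀ (β : ℝ) (m : Fin d → ℤ), besselSymbol (-β) m * besselSymbol β m = 1 := by
    intro β m
    rw [besselSymbol, besselSymbol, ← Complex.ofReal_mul, ← Real.rpow_add (by positivity),
      neg_div, neg_add_cancel, Real.rpow_zero, Complex.ofReal_one]
  have hinv' : ∀ m : Fin d → ℤ, besselSymbol β m * besselSymbol (-β) m = 1 := fun m => by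
    rw [mul_comm, hinv]
  have key := isIsomorphismOn_multiplier (θ := θ) hφ hp hq α β (polyGrowth_besselSymbol β)
    (polyGrowth_besselSymbol (-β)) ⟨C, hC, h θ⟩ ⟨D, hD, h' θ⟩ (Z := Set.univ)
    (Set.mapsTo_univ _ _) (Set.mapsTo_univ _ _)
    (fun x _ => multiplier_multiplier_eq_self _ _ (fun m _ => hinv β m) (Or.inl (hinv β 0)))
    (fun x _ => multiplier_multiplier_eq_self _ _ (fun m _ => hinv' m) (Or.inl (hinv' 0)))
  rw [Set.inter_univ, Set.inter_univ] at key
  exact key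

lemma mapsTo_meanZero_multiplier {s : (Fin d → ℤ) → ℂ} (hs : PolyGrowth s) :
    Set.MapsTo (multiplier θ s hs) (meanZero θ) (meanZero θ) := fun x hx => by
  change fourierCoeff _ 0 = 0
  rw [fourierCoeff_multiplier, show fourierCoeff x 0 = 0 from hx, mul_zero]

lemma norm_toEuclid_pos {m : Fin d → ℤ} (hm : m ≠ 0) : 0 < ‖toEuclid m‖ := by
  rw [norm_pos_iff]
  intro h
  refine hm (funext fun i => ?_)
  have := congrArg (fun v : EuclideanSpace ℝ (Fin d) => v i) h
  simpa [toEuclid] using this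

lemma isIsomorphismOn_rieszPotential (hφ : IsLittlewoodPaley φ) {p q : ℝ≥0∞} (hp : 1 ≤ p)
    (hq : 1 ≤ q) (α β : ℝ) :
    IsIsomorphismOn (rieszPotential θ β) (besovSpace θ φ α p q ∩ meanZero θ) (besovNorm φ α p q)
      (besovSpace θ φ (α - β) p q ∩ meanZero θ) (besovNorm φ (α - β) p q) := by
  obtain ⟨C, hC, h⟩ := exists_isLpMultiplier_rieszSymbol d β
  obtain ⟨D, hD, h'⟩ := exists_isLpMultiplier_rieszSymbol d (-β)
  have hinv : ∀ m : Fin d → ℤ, m ≠ 0 → rieszSymbol (-β) m * rieszSymbol β m = 1 := by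
    intro m hm
    rw [rieszSymbol, rieszSymbol, ← Complex.ofReal_mul, ← Real.rpow_add (norm_toEuclid_pos hm),
      neg_add_cancel, Real.rpow_zero, Complex.ofReal_one]
  exact isIsomorphismOn_multiplier (θ := θ) hφ hp hq α β (polyGrowth_rieszSymbol β)
    (polyGrowth_rieszSymbol (-β)) ⟨C, hC, h θ⟩ ⟨D, hD, h' θ⟩ (mapsTo_meanZero_multiplier _)
    (mapsTo_meanZero_multiplier _)
    (fun x hx => multiplier_multiplier_eq_self _ _ hinv (Or.inr hx))
    (fun x hx => multiplier_multiplier_eq_self _ _ (fun m hm => by rw [mul_comm, hinv m hm])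
      (Or.inr hx))

/-- The Besov norm is controlled by the mean and the fractional partial derivatives. -/
lemma exists_besovNorm_le_fracPartial (hφ : IsLittlewoodPaley φ) {p q : ℝ≥0∞} (hp : 1 ≤ p)
    (hq : 1 ≤ q) (α β : ℝ) : ∃ C : ℝ≥0, ∀ x : Distribution θ, besovNorm φ α p q x ≤
      C * (‖fourierCoeff x 0‖ₑ + ∑ i, besovNorm φ (α - β) p q (fracPartial θ i β x)) := by
  obtain ⟨C, hC, h⟩ := exists_isLpMultiplier_partition d β
  refine ⟨1 + C.toNNReal, fun x => ?_⟩
  set u : Fin d → ℕ → ℝ≥0∞ := fun i k =>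
    ENNReal.ofReal ((2 : ℝ) ^ (k * (α - β)) * lpNorm p (piece φ k (fracPartial θ i β x))) with hu
  have hterm : ∀ k : ℕ, ENNReal.ofReal ((2 : ℝ) ^ (k * α) * lpNorm p (piece φ k x)) ≤
      C.toNNReal * ∑ i, u i k := by
    intro k
    obtain ⟨s, hs, hsum⟩ := h k
    -- Inserting `1 = ∑ s_i (2πi m_i)^β` on the annulus recovers the piece of `x` from the pieces of
    -- its fractional derivatives.
    have e1 : piece φ k x = ∑ i, trigPoly θ (annulus d k) fun m => s i m * (partialSymbol i β m *
        (((φ ((2 : ℝ) ^ (-(k : ℤ)) • toEuclid m) : ℝ) : ℂ) * fourierCoeff x m)) := by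
      simp only [trigPoly]
      rw [Finset.sum_comm, piece_eq_trigPoly hφ, trigPoly]
      refine Finset.sum_congr rfl fun m hm => ?_
      rw [← Finset.sum_smul]
      simp only [← mul_assoc (s _ _)]
      rw [← Finset.sum_mul, hsum m hm, one_mul]
    have e2 : lpNorm p (piece φ k x) ≤
        ∑ i, (2 : ℝ) ^ (k * (-β)) * C * lpNorm p (piece φ k (fracPartial θ i β x)) := by
      rw [e1]
      refine (lpNorm_sum_le θ hp _ _ fun i _ => trigPoly_mem θ _ _).trans
        (Finset.sum_le_sum fun i _ => ?_)
      rw [fracPartial, piece_multiplier hφ]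
      exact hs θ i p hp _
    calc ENNReal.ofReal ((2 : ℝ) ^ (k * α) * lpNorm p (piece φ k x))
        ≤ ENNReal.ofReal (C * ∑ i, (2 : ℝ) ^ (k * (α - β)) *
            lpNorm p (piece φ k (fracPartial θ i β x))) := by
          refine ENNReal.ofReal_le_ofReal ?_
          refine (mul_le_mul_of_nonneg_left e2 (by positivity)).trans (le_of_eq ?_)
          rw [Finset.mul_sum, Finset.mul_sum]
          refine Finset.sum_congr rfl fun i _ => ?_
          rw [← two_rpow_sub_mul k (α - β) (-β), sub_neg_eq_add, sub_add_cancel]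
          ring
      _ = C.toNNReal * ∑ i, u i k := by
          rw [ENNReal.ofReal_mul hC, ENNReal.ofReal_sum_of_nonneg fun i _ =>
            mul_nonneg (by positivity) (lpNorm_nonneg _ _)]
          rfl
  calc besovNorm φ α p q x
      ≤ ‖fourierCoeff x 0‖ₑ + seqNorm q 0 fun k =>
          ENNReal.ofReal ((2 : ℝ) ^ (k * α) * lpNorm p (piece φ k x)) := seqNorm_le_add hq _ _
    _ ≤ ‖fourierCoeff x 0‖ₑ + C.toNNReal * seqNorm q 0 fun k => ∑ i, u i k := by
        gcongr
        exact seqNorm_le_mul hq (by simp) hterm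
    _ ≤ ‖fourierCoeff x 0‖ₑ +
          C.toNNReal * ∑ i, besovNorm φ (α - β) p q (fracPartial θ i β x) := by
        gcongr
        refine (seqNorm_sum_le hq _ _).trans (Finset.sum_le_sum fun i _ => ?_)
        exact seqNorm_mono hq zero_le fun k => le_rfl
    _ ≤ _ := by
        rw [mul_add]
        gcongr
        · rw [ENNReal.coe_add, add_mul, ENNReal.coe_one, one_mul]
          exact le_self_add
        · exact le_add_self

lemma exists_fracPartial_le_besovNorm (hφ : IsLittlewoodPaley φ) {p q : ℝ≥0∞} (hp : 1 ≤ p)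
    (hq : 1 ≤ q) (α : ℝ) {β : ℝ} (hβ : 0 ≤ β) : ∃ C : ℝ≥0, ∀ (i : Fin d) (x : Distribution θ),
      besovNorm φ (α - β) p q (fracPartial θ i β x) ≤ C * besovNorm φ α p q x := by
  obtain ⟨C, hC, h⟩ := exists_isLpMultiplier_partialSymbol d hβ
  choose D hD using fun i => exists_besovNorm_multiplier_le (θ := θ) hφ hp hq α β
    (polyGrowth_partialSymbol i β) ⟨C, hC, fun k => h θ k i⟩
  refine ⟨∑ i, D i, fun i x => (hD i x).trans ?_⟩
  gcongr
  exact Finset.single_le_sum (fun j _ => zero_le) (Finset.mem_univ i)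

end QuantumTorus

end

theorem mainTheorem1 (d : ℕ) (hd : 2 ≤ d) (θ : Matrix (Fin d) (Fin d) ℝ)
    (hθ : θ.transpose = -θ) (φ : SchwartzMap (EuclideanSpace ℝ (Fin d)) ℝ)
    (hφ : QuantumTorus.IsLittlewoodPaley φ) (p q : ENNReal) (hp : 1 ≤ p) (hq : 1 ≤ q) (α : ℝ) :
    (∀ β : ℝ,
      QuantumTorus.IsIsomorphismOn (QuantumTorus.besselPotential θ β)
        (QuantumTorus.besovSpace θ φ α p q) (QuantumTorus.besovNorm φ α p q)
        (QuantumTorus.besovSpace θ φ (α - β) p q) (QuantumTorus.besovNorm φ (α - β) p q) ∧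
      QuantumTorus.IsIsomorphismOn (QuantumTorus.rieszPotential θ β)
        (QuantumTorus.besovSpace θ φ α p q ∩ QuantumTorus.meanZero θ)
        (QuantumTorus.besovNorm φ α p q)
        (QuantumTorus.besovSpace θ φ (α - β) p q ∩ QuantumTorus.meanZero θ)
        (QuantumTorus.besovNorm φ (α - β) p q)) ∧
    (∀ a : Fin d → ℝ, (∀ i, 0 ≤ a i) → ∃ C : NNReal,
      ∀ x ∈ QuantumTorus.besovSpace θ φ α p q,
        QuantumTorus.fracDeriv θ a x ∈ QuantumTorus.besovSpace θ φ (α - ∑ i, a i) p q ∧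
        QuantumTorus.besovNorm φ (α - ∑ i, a i) p q (QuantumTorus.fracDeriv θ a x) ≤
          C * QuantumTorus.besovNorm φ α p q x) ∧
    (∀ β : ℝ, 0 < β →
      (∀ x : QuantumTorus.Distribution θ,
        x ∈ QuantumTorus.besovSpace θ φ α p q ↔
          ∀ i, QuantumTorus.fracPartial θ i β x ∈ QuantumTorus.besovSpace θ φ (α - β) p q) ∧
      ∃ C : NNReal, ∀ x ∈ QuantumTorus.besovSpace θ φ α p q,
        QuantumTorus.besovNorm φ α p q x ≤
          C * (‖QuantumTorus.fourierCoeff x 0‖ₑ + ∑ i,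
            QuantumTorus.besovNorm φ (α - β) p q (QuantumTorus.fracPartial θ i β x)) ∧
        ‖QuantumTorus.fourierCoeff x 0‖ₑ + ∑ i,
            QuantumTorus.besovNorm φ (α - β) p q (QuantumTorus.fracPartial θ i β x) ≤
          C * QuantumTorus.besovNorm φ α p q x) := by
  refine ⟨fun β => ⟨QuantumTorus.isIsomorphismOn_besselPotential hφ hp hq α β,
    QuantumTorus.isIsomorphismOn_rieszPotential hφ hp hq α β⟩, fun a ha => ?_, fun β hβ => ?_⟩
  · obtain ⟨C, hC, h⟩ := QuantumTorus.exists_isLpMultiplier_fracDeriv d ha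
    obtain ⟨D, hD⟩ := QuantumTorus.exists_besovNorm_multiplier_le (θ := θ) hφ hp hq α (∑ i, a i)
      (QuantumTorus.PolyGrowth.prod Finset.univ fun i =>
        QuantumTorus.polyGrowth_partialSymbol i (a i)) ⟨C, hC, h θ⟩
    exact ⟨D, fun x hx => ⟨(hD x).trans_lt (ENNReal.mul_lt_top ENNReal.coe_lt_top hx), hD x⟩⟩
  · obtain ⟨C, hC⟩ := QuantumTorus.exists_besovNorm_le_fracPartial (θ := θ) hφ hp hq α β
    obtain ⟨D, hD⟩ := QuantumTorus.exists_fracPartial_le_besovNorm (θ := θ) hφ hp hq α hβ.le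
    -- Both estimates hold in `[0, ∞]` for every distribution, so finiteness passes either way; the
    -- mean of a distribution is always finite.
    refine ⟨fun x => ⟨fun hx i => (hD i x).trans_lt (ENNReal.mul_lt_top ENNReal.coe_lt_top hx),
      fun hx => (hC x).trans_lt (ENNReal.mul_lt_top ENNReal.coe_lt_top ?_)⟩,
      C + (1 + d * D), fun x _ => ⟨(hC x).trans ?_, ?_⟩⟩
    · exact ENNReal.add_lt_top.2 ⟨enorm_lt_top, ENNReal.sum_lt_top.2 fun i _ => hx i⟩
    · gcongr
      exact le_self_add
    · calc ‖QuantumTorus.fourierCoeff x 0‖ₑ + ∑ i,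
            QuantumTorus.besovNorm φ (α - β) p q (QuantumTorus.fracPartial θ i β x)
          ≤ QuantumTorus.besovNorm φ α p q x +
              ∑ _i : Fin d, D * QuantumTorus.besovNorm φ α p q x :=
            add_le_add (QuantumTorus.le_seqNorm hq _ _) (Finset.sum_le_sum fun i _ => hD i x)
        _ = ((1 + d * D : NNReal) : ENNReal) * QuantumTorus.besovNorm φ α p q x := by
            rw [Finset.sum_const, Finset.card_univ, Fintype.card_fin, nsmul_eq_mul]
            push_cast
            ring
        _ ≤ _ := by
            exact mul_le_mul' (ENNReal.coe_le_coe.2 le_add_self) le_rfl
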